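/- Let $B$ be a real Banach space of martingale cotype $q\in[2,\infty)$, that is: there are $r\in(1,\infty)$ and a constant $c$ such that $$\Big\|\Big(\sum_{n\ge1}\|f_n-f_{n-1}\|_B^q\Big)^{1/q}\Big\|_{L^r}\le c\,\sup_n\|f_n\|_{L^r_B}$$ for every bounded $B$-valued $L^r$-martingale $(f_n)_{n\ge0}$ on a probability space. Let $1<p<\infty$. Then there is a constant $C=C_{p,q,B}$, depending only on $p$, $q$ and $B$, such that the following holds for every measure space $(\Omega,\mu)$ and every symmetric diffusion semigroup $(T_t)_{t\ge0}$ on it. Here a symmetric diffusion semigroup is a family of linear operators acting consistently on the real spaces $L^r(\Omega)$, $1\le r\le\infty$, with $T_0=\mathrm{Id}$, $T_{t+s}=T_tT_s$, $\|T_t\|_{L^r\to L^r}\le1$ for all $r\in[1,\infty]$, $\lim_{t\to0}T_tf=f$ in $L^2$ for $f\in L^2$, $T_t^*=T_t$ on $L^2$, $T_tf\ge0$ if $f\ge0$, and $T_t1=1$. Denote again by $T_t$ its continuous extension $T_t\otimes\mathrm{Id}_B$ to the Bochner space $L^p_B(\Omega)$. For every $f\in L^p_B(\Omega)$ the mean $M_tf=\frac1t\int_0^tT_sf\,ds$,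 $t>0$, is well defined as a Bochner integral in $L^p_B(\Omega)$. There are representatives $M_tf(x)$ of these classes for which $t\mapsto M_tf(x)$ is continuous on $(0,\infty)$ for almost every $x$. For any such representatives and for almost every $x$, the derivative $\frac{\partial}{\partial t}M_tf(x)$ exists for almost every $t>0$. Moreover, the function $x\mapsto\big(\int_0^\infty\big\|t\,\frac{\partial}{\partial t}M_tf(x)\big\|_B^q\,\frac{dt}{t}\big)^{1/q}$ is $\mu$-measurable, and $$\Big\|\Big(\int_0^\infty\Big\|t\,\frac{\partial M_tf}{\partial t}\Big\|_B^q\,\frac{dt}{t}\Big)^{1/q}\Big\|_{L^p(\Omega)}\le C\,\|f\|_{L^p_B(\Omega)}.$$ -/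

import Mathlib

open MeasureTheory Set Filter Topology
open scoped NNReal ENNReal TensorProduct

/-- Martingale cotype `q` of a real Banach space `B`: for some `p ∈ (1, ∞)` there is a constant `C`
with `‖S_q f‖_{L^p} ≤ C sup_n ‖f_n‖_{L^p_B}` for all bounded `B`-valued `L^p`-martingales `f`
(on all probability spaces and for all filtrations), where
`S_q f = (∑_{n ≥ 1} ‖f_n - f_{n-1}‖^q)^{1/q}`. -/
def HasMartingaleCotype (B : Type*) [NormedAddCommGroup B] [NormedSpace ℝ B] [CompleteSpace B]
    (q : ℝ) : Prop :=
  ∃ p : ℝ≥0∞, 1 < p ∧ p < ∞ ∧ ∃ C : ℝ≥0,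
    ∀ (Ω : Type) (mΩ : MeasurableSpace Ω) (P : Measure Ω) [IsProbabilityMeasure P]
      (ℱ : Filtration ℕ mΩ) (f : ℕ → Ω → B), Martingale f ℱ P →
      (⨆ n, eLpNorm (f n) p P) < ∞ →
        eLpNorm (fun ω => (∑' n, ‖f (n + 1) ω - f n ω‖ₑ ^ q) ^ (1 / q)) p P
          ≤ C * ⨆ n, eLpNorm (f n) p P

/-- A symmetric diffusion semigroup on the measure space `(Ω, μ)`: linear operators `op p t`
on `L^p(Ω, μ)`, for every `p ∈ [1, ∞]` and `t ≥ 0`, such that `op p t` and `op r t` agree on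
`L^p ∩ L^r`, together with the semigroup, contraction, continuity, symmetry, positivity and Markov
properties. -/
structure SymmetricDiffusionSemigroup {Ω : Type*} [MeasurableSpace Ω] (μ : Measure Ω) where
  op : ∀ (p : ℝ≥0∞) [Fact (1 ≤ p)], ℝ≥0 → Lp ℝ p μ →L[ℝ] Lp ℝ p μ
  op_compat : ∀ (p r : ℝ≥0∞) [Fact (1 ≤ p)] [Fact (1 ≤ r)] (t : ℝ≥0) (f : Lp ℝ p μ)
    (g : Lp ℝ r μ), f =ᵐ[μ] g → op p t f =ᵐ[μ] op r t g
  op_zero : ∀ (p : ℝ≥0∞) [Fact (1 ≤ p)] (f : Lp ℝ p μ), op p 0 f = f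
  op_add : ∀ (p : ℝ≥0∞) [Fact (1 ≤ p)] (s t : ℝ≥0) (f : Lp ℝ p μ),
    op p (s + t) f = op p s (op p t f)
  norm_op_le : ∀ (p : ℝ≥0∞) [Fact (1 ≤ p)] (t : ℝ≥0) (f : Lp ℝ p μ), ‖op p t f‖ ≤ ‖f‖
  tendsto_op : ∀ f : Lp ℝ 2 μ, Tendsto (fun t => op 2 t f) (𝓝 0) (𝓝 f)
  op_symm : ∀ (t : ℝ≥0) (f g : Lp ℝ 2 μ), inner ℝ (op 2 t f) g = inner ℝ f (op 2 t g)
  op_nonneg : ∀ (p : ℝ≥0∞) [Fact (1 ≤ p)] (t : ℝ≥0) (f : Lp ℝ p μ), 0 ≤ f → 0 ≤ op p t f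
  op_one : ∀ t : ℝ≥0, op ∞ t (memLp_top_const (1 : ℝ)).toLp = (memLp_top_const (1 : ℝ)).toLp

noncomputable section VectorExtension

variable {Ω : Type*} [MeasurableSpace Ω] {μ : Measure Ω} {p : ℝ≥0∞} [Fact (1 ≤ p)]
  {B : Type*} [NormedAddCommGroup B] [NormedSpace ℝ B]

variable (μ p B) in
/-- The canonical map `L^p(Ω) ⊗ B → L^p_B(Ω)`, sending `φ ⊗ b` to the function
`x ↦ φ(x) b`. -/
def tensorToLp : Lp ℝ p μ ⊗[ℝ] B →ₗ[ℝ] Lp B p μ :=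
  TensorProduct.lift (LinearMap.mk₂ ℝ
    (fun (φ : Lp ℝ p μ) (b : B) => (ContinuousLinearMap.toSpanSingleton ℝ b).compLpL p μ φ)
    (fun φ ψ b => map_add _ φ ψ)
    (fun c φ b => map_smul _ c φ)
    (fun φ b c => by
      rw [ContinuousLinearMap.toSpanSingleton_add, ContinuousLinearMap.add_compLpL,
        add_apply])
    (fun c φ b => by
      rw [ContinuousLinearMap.toSpanSingleton_smul, ContinuousLinearMap.smul_compLpL,
        smul_apply]))

/-- The extension `Q ⊗ Id_B` of an operator `Q` on `L^p(Ω)` to an operator on `L^p_B(Ω)`: the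
continuous extension of `∑ φ_k ⊗ b_k ↦ ∑ Q φ_k ⊗ b_k` from the algebraic tensor product. For
`p < ∞` and positive `Q` the extension exists, see `vectorExtension_tensor`, and it is unique, see
`denseRange_tensorToLp`. -/
def vectorExtension (B : Type*) [NormedAddCommGroup B] [NormedSpace ℝ B] [CompleteSpace B]
    (Q : Lp ℝ p μ →L[ℝ] Lp ℝ p μ) : Lp B p μ →L[ℝ] Lp B p μ :=
  LinearMap.extendOfNorm (tensorToLp μ p B ∘ₗ LinearMap.rTensor B Q.toLinearMap)
    (tensorToLp μ p B)

lemma tensorToLp_tmul (φ : Lp ℝ p μ) (b : B) :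
    tensorToLp μ p B (φ ⊗ₜ b) =ᵐ[μ] fun x => φ x • b := by
  have h : tensorToLp μ p B (φ ⊗ₜ b)
      = (ContinuousLinearMap.toSpanSingleton ℝ b).compLpL p μ φ := rfl
  rw [h]
  filter_upwards [(ContinuousLinearMap.toSpanSingleton ℝ b).coeFn_compLpL (p := p) (μ := μ) φ]
    with x hx
  rw [hx, ContinuousLinearMap.toSpanSingleton_apply]

/-- Sums of functions `φ(x) b` are dense in `L^p_B(Ω)`, `p < ∞`. -/
lemma denseRange_tensorToLp (hp : p ≠ ∞) : DenseRange (tensorToLp μ p B) := by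
  have key : ∀ f : Lp B p μ, f ∈ (LinearMap.range (tensorToLp μ p B)).topologicalClosure := by
    refine Lp.induction hp _ ?_ ?_ ?_
    · intro c s hs hμs
      refine Submodule.le_topologicalClosure _ ⟨indicatorConstLp p hs hμs.ne 1 ⊗ₜ c, ?_⟩
      rw [Lp.simpleFunc.coe_indicatorConst]
      refine Lp.ext ?_
      filter_upwards [tensorToLp_tmul (indicatorConstLp p hs hμs.ne (1 : ℝ)) c,
        indicatorConstLp_coeFn (p := p) (hs := hs) (hμs := hμs.ne) (c := (1 : ℝ)),
        indicatorConstLp_coeFn (p := p) (hs := hs) (hμs := hμs.ne) (c := c)] with x h1 h2 h3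
      rw [h1, h2, h3]
      by_cases hx : x ∈ s <;> simp [hx]
    · intro f g hf hg _ h1 h2
      exact Submodule.add_mem _ h1 h2
    · exact Submodule.isClosed_topologicalClosure _
  intro f
  have := key f
  rwa [← SetLike.mem_coe, Submodule.topologicalClosure_coe, LinearMap.coe_range] at this

/-- Composition with a continuous functional commutes with `Q ⊗ Id_B`. -/
lemma compLp_rTensor (Q : Lp ℝ p μ →L[ℝ] Lp ℝ p μ) (ξ : B →L[ℝ] ℝ) (z : Lp ℝ p μ ⊗[ℝ] B) :
    ξ.compLpL p μ (tensorToLp μ p B (LinearMap.rTensor B Q.toLinearMap z))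
      = Q (ξ.compLpL p μ (tensorToLp μ p B z)) := by
  have aux : ∀ (φ : Lp ℝ p μ) (b : B),
      ξ.compLpL p μ (tensorToLp μ p B (φ ⊗ₜ b)) = ξ b • φ := by
    intro φ b
    refine Lp.ext ?_
    filter_upwards [ξ.coeFn_compLpL (p := p) (μ := μ) (tensorToLp μ p B (φ ⊗ₜ b)),
      tensorToLp_tmul φ b, Lp.coeFn_smul (ξ b) φ] with x h1 h2 h3
    rw [h1, h2, h3]
    simp [mul_comm]
  induction z using TensorProduct.induction_on with
  | zero => simp
  | tmul φ b =>
    rw [LinearMap.rTensor_tmul, aux, aux, map_smul]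
    rfl
  | add x y hx hy => rw [map_add, map_add, map_add, hx, hy, map_add, map_add, map_add]

lemma norm_tensorToLp_rTensor_le (Q : Lp ℝ p μ →L[ℝ] Lp ℝ p μ)
    (hQ : ∀ f : Lp ℝ p μ, 0 ≤ f → 0 ≤ Q f) (z : Lp ℝ p μ ⊗[ℝ] B) :
    ‖tensorToLp μ p B (LinearMap.rTensor B Q.toLinearMap z)‖
      ≤ ‖Q‖ * ‖tensorToLp μ p B z‖ := by
  set F := tensorToLp μ p B z with hF
  set G := tensorToLp μ p B (LinearMap.rTensor B Q.toLinearMap z) with hG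
  let N : Lp ℝ p μ := (Lp.memLp F).norm.toLp
  have hN : N =ᵐ[μ] fun x => ‖F x‖ := MemLp.coeFn_toLp _
  have hNn : ‖N‖ = ‖F‖ := by
    refine le_antisymm (Lp.norm_le_norm_of_ae_le ?_) (Lp.norm_le_norm_of_ae_le ?_) <;>
    · filter_upwards [hN] with x hx
      rw [hx, norm_norm]
  have step : ∀ ξ : B →L[ℝ] ℝ, ‖ξ‖ ≤ 1 → ∀ᵐ x ∂μ, ξ (G x) ≤ Q N x := by
    intro ξ hξ
    have h1 : 0 ≤ N - ξ.compLpL p μ F := by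
      rw [← Lp.coeFn_nonneg]
      filter_upwards [Lp.coeFn_sub N (ξ.compLpL p μ F), hN,
        ξ.coeFn_compLpL (p := p) (μ := μ) F] with x h1 h2 h3
      rw [h1, Pi.sub_apply, h2, h3, Pi.zero_apply, sub_nonneg]
      calc ξ (F x) ≤ ‖ξ (F x)‖ := Real.le_norm_self _
        _ ≤ ‖ξ‖ * ‖F x‖ := ξ.le_opNorm _
        _ ≤ 1 * ‖F x‖ := by gcongr
        _ = ‖F x‖ := one_mul _
    have h2 := hQ _ h1
    rw [map_sub, ← compLp_rTensor Q ξ z, ← hG, ← Lp.coeFn_nonneg] at h2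
    filter_upwards [h2, Lp.coeFn_sub (Q N) (ξ.compLpL p μ G),
      ξ.coeFn_compLpL (p := p) (μ := μ) G] with x h3 h4 h5
    rw [h4, Pi.zero_apply, Pi.sub_apply, h5, sub_nonneg] at h3
    exact h3
  obtain ⟨t, ht, htG⟩ := (Lp.aestronglyMeasurable G).isSeparable_ae_range
  obtain ⟨d, d_count, hd⟩ := ht
  have : Countable d := d_count
  have hs : ∀ y : d, ∃ ξ : B →L[ℝ] ℝ, ‖ξ‖ ≤ 1 ∧ ξ y = ‖(y : B)‖ :=
    fun y => exists_dual_vector'' ℝ (y : B)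
  choose s hs1 hs2 using hs
  have hall : ∀ᵐ x ∂μ, ∀ y : d, s y (G x) ≤ Q N x := ae_all_iff.mpr fun y => step _ (hs1 y)
  have hdom : ∀ᵐ x ∂μ, ‖G x‖ ≤ ‖Q N x‖ := by
    filter_upwards [hall, htG] with x hx hxt
    refine le_trans (le_of_forall_pos_le_add fun ε hε => ?_) (Real.le_norm_self _)
    obtain ⟨y, hyd, hy⟩ := Metric.mem_closure_iff.mp (hd hxt) (ε / 2) (half_pos hε)
    rw [dist_eq_norm] at hy
    have e1 : ‖G x‖ ≤ ‖y‖ + ‖G x - y‖ := by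
      simpa using norm_add_le y (G x - y)
    have e2 : ‖y‖ = s ⟨y, hyd⟩ (G x) - s ⟨y, hyd⟩ (G x - y) := by
      rw [map_sub, hs2 ⟨y, hyd⟩]; ring
    have e3 : -(s ⟨y, hyd⟩ (G x - y)) ≤ ‖G x - y‖ := by
      calc -(s ⟨y, hyd⟩ (G x - y)) ≤ ‖s ⟨y, hyd⟩ (G x - y)‖ := neg_le_abs _
        _ ≤ ‖s ⟨y, hyd⟩‖ * ‖G x - y‖ := ContinuousLinearMap.le_opNorm _ _
        _ ≤ 1 * ‖G x - y‖ := by gcongr; exact hs1 _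
        _ = ‖G x - y‖ := one_mul _
    have e4 := hx ⟨y, hyd⟩
    linarith
  calc ‖G‖ ≤ ‖Q N‖ := Lp.norm_le_norm_of_ae_le hdom
    _ ≤ ‖Q‖ * ‖N‖ := Q.le_opNorm N
    _ = ‖Q‖ * ‖F‖ := by rw [hNn]

/-- For `p < ∞` and positive `Q`, the operator `vectorExtension B Q` does extend `Q ⊗ Id_B`. -/
lemma vectorExtension_tensor [CompleteSpace B] (hp : p ≠ ∞) (Q : Lp ℝ p μ →L[ℝ] Lp ℝ p μ)
    (hQ : ∀ f : Lp ℝ p μ, 0 ≤ f → 0 ≤ Q f) (z : Lp ℝ p μ ⊗[ℝ] B) :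
    vectorExtension B Q (tensorToLp μ p B z)
      = tensorToLp μ p B (LinearMap.rTensor B Q.toLinearMap z) := by
  have h := LinearMap.extendOfNorm_eq
    (f := tensorToLp μ p B ∘ₗ LinearMap.rTensor B Q.toLinearMap) (e := tensorToLp μ p B)
    (denseRange_tensorToLp hp) ⟨‖Q‖, fun y => norm_tensorToLp_rTensor_le Q hQ y⟩ z
  rw [LinearMap.comp_apply] at h
  exact h

lemma norm_vectorExtension_le [CompleteSpace B] (hp : p ≠ ∞) (Q : Lp ℝ p μ →L[ℝ] Lp ℝ p μ)
    (hQ : ∀ f : Lp ℝ p μ, 0 ≤ f → 0 ≤ Q f) : ‖vectorExtension B Q‖ ≤ ‖Q‖ := by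
  have h := LinearMap.opNorm_extendOfNorm_le
    (f := tensorToLp μ p B ∘ₗ LinearMap.rTensor B Q.toLinearMap) (e := tensorToLp μ p B)
    (denseRange_tensorToLp hp) (norm_nonneg Q) (fun y => norm_tensorToLp_rTensor_le Q hQ y)
  exact h

end VectorExtension

noncomputable section Means

variable {Ω : Type*} [MeasurableSpace Ω] {μ : Measure Ω} {p : ℝ≥0∞} [Fact (1 ≤ p)]
  {B : Type*} [NormedAddCommGroup B] [NormedSpace ℝ B]

/-- The operator `T_s`, `s ≥ 0`, acting on `L^p_B(Ω)` (for `s < 0` the value is that at `0`). -/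
def SymmetricDiffusionSemigroup.vectorOp [CompleteSpace B] (T : SymmetricDiffusionSemigroup μ)
    (s : ℝ) : Lp B p μ →L[ℝ] Lp B p μ :=
  vectorExtension B (T.op p s.toNNReal)

/-- The mean `M_t f = (1/t) ∫_0^t T_s f ds` in `L^p_B(Ω)`. -/
def SymmetricDiffusionSemigroup.mean [CompleteSpace B] (T : SymmetricDiffusionSemigroup μ)
    (t : ℝ) (f : Lp B p μ) : Lp B p μ :=
  t⁻¹ • ∫ s in (0 : ℝ)..t, T.vectorOp s f

/-- `m t x` is a pointwise version of `M_t f(x)`, `t > 0`, with continuous trajectories: for every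
`t > 0` the function `m t` represents the class `M_t f`, and for almost every `x` the function
`t ↦ m t x` is continuous on `(0, ∞)`. Any two such versions agree for almost every `x`, for
all `t > 0` simultaneously. -/
def SymmetricDiffusionSemigroup.IsMeanVersion [CompleteSpace B]
    (T : SymmetricDiffusionSemigroup μ) (f : Lp B p μ) (m : ℝ → Ω → B) : Prop :=
  (∀ t : ℝ, 0 < t → m t =ᵐ[μ] T.mean t f) ∧
    ∀ᵐ x ∂μ, ContinuousOn (fun t => m t x) (Ioi 0)

/-- `(∫_0^∞ ‖t ∂u/∂t (t, x)‖^q dt/t)^{1/q}`, as a function of `x` with values in `[0, ∞]`. -/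
def squareFunction (q : ℝ) (u : ℝ → Ω → B) (x : Ω) : ℝ≥0∞ :=
  (∫⁻ t in Ioi (0 : ℝ), ‖t • deriv (fun r => u r x) t‖ₑ ^ q / ENNReal.ofReal t) ^ (1 / q)

end Means

/-!
Since `t ∂_t M_t f = T_t f - M_t f` for almost every `t`, the square function measures how far the
trajectory of `f` under the semigroup deviates from its own running means. No analyticity of the
semigroup is needed: deviations from running means are controlled by the oscillation over dyadic
time blocks (`sum_avgDev_rpow_le`), and the oscillation of a martingale over arbitrary time blocks
is controlled by martingale cotype.

**Martingales.** For a martingale on a finite weighted set, let `W f` be the `ℓ^q`-sum of its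
oscillations over consecutive blocks of time. Martingale cotype `q` bounds `W f` in some `L^r`
when the blocks are single steps. The good-`λ` method, applied to the good part of the
decomposition of Davis, moves a bound on `W f` from one exponent to any other
(`BlockBound.extrapolate`). In `L^q` the maximal inequality of Doob on each block passes from
single steps to arbitrary blocks (`BlockBound.of_id`). Together this bounds `W f` in every `L^p`,
`1 < p < ∞`, uniformly in the blocks (`HasMartingaleCotype.exists_blockBound`). All martingales
needed live on finite sets, where conditional expectations are weighted averages.

**Markov chains.** Rota's dilation turns iterates into martingales: if `K` is a reversible
transition matrix and `y` a stationary path of length `N`, then `(K^n b)(y_{N - n})` is a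
martingale in reversed time `n`, and its conditional expectation given the final position `y_N` is
`K^{2n} b`. Hence the discrete square function of `K^{2n} b` is bounded in `L^p`
(`HasMartingaleCotype.exists_markov_bound`). A chain that loses mass is completed by a cemetery of
weight `1/ε`, and `ε → 0` (`HasMartingaleCotype.exists_subMarkov_bound`).

**Semigroups.** With `S = T_{ε/2}` one has `T_{nε} = S^{2n}`. Finitely many of these functions are
nearly step functions on a common finite partition, and the compression of `S` to such step
functions is a reversible chain that may lose mass. So the discrete square function along `T_{nε}`
is bounded with a constant independent of `ε` and of the semigroup
(`HasMartingaleCotype.exists_skeleton_bound`).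

**The limit `ε → 0`.** The orbit `s ↦ T_s f` is uniformly continuous in `L^p_B`. Along
sufficiently fine lattices its step approximations converge, for almost every `x`, in `L^1_loc`
and almost everywhere in time (`exists_trajectory`); this uses only countably many values at a
time, so `μ` need not be `σ`-finite. The averages of the limit are a continuous version of
`M_t f(x)`, and Lebesgue differentiation gives the derivative as a limit of discrete deviations
(`ae_tendsto_avgDev`). The inequality then follows from Fatou's lemma
(`eLpNorm_stepSquareFunction_le`).
-/


/-! ### Martingales on finite weighted sets -/

section FiniteMartingale

/-- Measurability with respect to the finite σ-algebra whose atoms are the classes of `s`. -/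
def IsMeas {Ω α : Type*} (s : Setoid Ω) (X : Ω → α) : Prop := ∀ ⦃a b⦄, s a b → X a = X b

namespace IsMeas

variable {Ω α β γ : Type*} {s s' : Setoid Ω}

lemma mono (h : s' ≤ s) {X : Ω → α} (hX : IsMeas s X) : IsMeas s' X :=
  fun _ _ hab => hX (h hab)

lemma comp (F : α → β) {X : Ω → α} (hX : IsMeas s X) : IsMeas s (fun ω => F (X ω)) :=
  fun _ _ hab => congrArg F (hX hab)

lemma comp₂ (F : α → β → γ) {X : Ω → α} {Y : Ω → β} (hX : IsMeas s X) (hY : IsMeas s Y) :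
    IsMeas s (fun ω => F (X ω) (Y ω)) :=
  fun _ _ hab => by simp only [hX hab, hY hab]

lemma pi {ι : Type*} {X : ι → Ω → α} (hX : ∀ i, IsMeas s (X i)) :
    IsMeas s (fun ω i => X i ω) :=
  fun _ _ hab => funext fun i => hX i hab

end IsMeas

variable {Ω : Type*} [Fintype Ω] {E : Type*} [NormedAddCommGroup E] [NormedSpace ℝ E]

open Classical in
/-- Conditional expectation on a finite set with weights `w`: the weighted average over the class
of `a`. On a class of weight zero its value is `0`. -/
noncomputable def condAvg (w : Ω → ℝ) (s : Setoid Ω) (X : Ω → E) (a : Ω) : E :=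
  (∑ b with s a b, w b)⁻¹ • ∑ b with s a b, w b • X b

/-- A martingale on a finite set with weights `w` and a filtration given by equivalence relations
`r n`. Orthogonality of the increments to measurable test functions replaces conditional
expectations. -/
structure IsMart (w : Ω → ℝ) (r : ℕ → Setoid Ω) (f : ℕ → Ω → E) : Prop where
  meas : ∀ n, IsMeas (r n) (f n)
  sum_eq : ∀ n (u : Ω → ℝ), IsMeas (r n) u →
    ∑ ω, (w ω * u ω) • (f (n + 1) ω - f n ω) = 0

lemma isMeas_condAvg (w : Ω → ℝ) (s : Setoid Ω) (X : Ω → E) : IsMeas s (condAvg w s X) := by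
  classical
  intro a b hab
  have : (Finset.univ.filter fun c => s a c) = Finset.univ.filter fun c => s b c := by
    ext c
    simp only [Finset.mem_filter, Finset.mem_univ, true_and]
    exact ⟨fun h => s.trans (s.symm hab) h, fun h => s.trans hab h⟩
  unfold condAvg
  convert rfl using 3 <;> rw [this]

/-- The defining property of the conditional expectation. It survives classes of weight zero, on
which `condAvg` has the junk value `0`, because the factor `w` vanishes there. -/
lemma sum_mul_condAvg {w : Ω → ℝ} (hw : ∀ ω, 0 ≤ w ω) (s : Setoid Ω) (X : Ω → E) {u : Ω → ℝ}
    (hu : IsMeas s u) :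
    ∑ ω, (w ω * u ω) • condAvg w s X ω = ∑ ω, (w ω * u ω) • X ω := by
  classical
  have h1 : ∀ a, (w a * u a) • condAvg w s X a
      = ∑ b, if s a b then (w a * u a * (∑ c with s a c, w c)⁻¹ * w b) • X b else 0 := by
    intro a
    unfold condAvg
    rw [Finset.sum_filter (fun b => s a b) (fun b => w b • X b), Finset.smul_sum, Finset.smul_sum]
    refine Finset.sum_congr rfl fun b _ => ?_
    split_ifs
    · rw [smul_smul, smul_smul]
    · simp
  simp_rw [h1]
  rw [Finset.sum_comm]
  refine Finset.sum_congr rfl fun b _ => ?_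
  have h2 : ∀ a, (if s a b then (w a * u a * (∑ c with s a c, w c)⁻¹ * w b) • X b else 0)
      = (if s b a then w a else 0) • ((u b * (∑ c with s b c, w c)⁻¹ * w b) • X b) := by
    intro a
    by_cases hab : s a b
    · have hba := s.symm hab
      have : (Finset.univ.filter fun c => s a c) = Finset.univ.filter fun c => s b c := by
        ext c
        simp only [Finset.mem_filter, Finset.mem_univ, true_and]
        exact ⟨fun h => s.trans (s.symm hab) h, fun h => s.trans hab h⟩
      rw [if_pos hab, if_pos hba, hu hab, this, smul_smul]
      congr 1
      ring
    · have hba : ¬ s b a := fun h => hab (s.symm h)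
      rw [if_neg hab, if_neg hba, zero_smul]
  simp_rw [h2]
  rw [← Finset.sum_smul, ← Finset.sum_filter, smul_smul]
  congr 1
  by_cases h0 : (∑ c with s b c, w c) = 0
  · have : w b = 0 := (Finset.sum_eq_zero_iff_of_nonneg (fun c _ => hw c)).mp h0 b
      (by simp)
    rw [this]; ring
  · field_simp

lemma norm_condAvg_le {w : Ω → ℝ} (hw : ∀ ω, 0 ≤ w ω) (s : Setoid Ω) (X : Ω → E) (a : Ω) :
    ‖condAvg w s X a‖ ≤ condAvg w s (fun ω => ‖X ω‖) a := by
  classical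
  unfold condAvg
  have h0 : 0 ≤ (∑ b with s a b, w b)⁻¹ := inv_nonneg.mpr (Finset.sum_nonneg fun b _ => hw b)
  rw [norm_smul, Real.norm_of_nonneg h0, smul_eq_mul]
  refine mul_le_mul_of_nonneg_left ((norm_sum_le _ _).trans (le_of_eq ?_)) h0
  refine Finset.sum_congr rfl fun b _ => ?_
  rw [norm_smul, Real.norm_of_nonneg (hw b), smul_eq_mul]

lemma condAvg_le_of_forall_le {w : Ω → ℝ} (hw : ∀ ω, 0 ≤ w ω) (s : Setoid Ω) {X : Ω → ℝ} {a : Ω}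
    {c : ℝ} (hc : 0 ≤ c) (h : ∀ b, s a b → X b ≤ c) : condAvg w s X a ≤ c := by
  classical
  unfold condAvg
  have h0 : 0 ≤ (∑ b with s a b, w b) := Finset.sum_nonneg fun b _ => hw b
  rw [smul_eq_mul]
  have h1 : ∑ b with s a b, w b • X b ≤ (∑ b with s a b, w b) * c := by
    rw [Finset.sum_mul]
    refine Finset.sum_le_sum fun b hb => ?_
    exact mul_le_mul_of_nonneg_left (h b (by simpa using hb)) (hw b)
  refine (mul_le_mul_of_nonneg_left h1 (inv_nonneg.mpr h0)).trans ?_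
  rw [← mul_assoc]
  by_cases h2 : (∑ b with s a b, w b) = 0
  · rw [h2]; simpa using hc
  · rw [inv_mul_cancel₀ h2, one_mul]

lemma condAvg_nonneg {w : Ω → ℝ} (hw : ∀ ω, 0 ≤ w ω) (s : Setoid Ω) {X : Ω → ℝ}
    (hX : ∀ ω, 0 ≤ X ω) (a : Ω) : 0 ≤ condAvg w s X a := by
  classical
  unfold condAvg
  exact smul_nonneg (inv_nonneg.mpr (Finset.sum_nonneg fun b _ => hw b))
    (Finset.sum_nonneg fun b _ => smul_nonneg (hw b) (hX b))

lemma condAvg_add (w : Ω → ℝ) (s : Setoid Ω) (X Y : Ω → E) (a : Ω) :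
    condAvg w s (fun ω => X ω + Y ω) a = condAvg w s X a + condAvg w s Y a := by
  simp only [condAvg, smul_add, Finset.sum_add_distrib]

namespace IsMart

variable {w : Ω → ℝ} {r : ℕ → Setoid Ω} {f : ℕ → Ω → E}

lemma sum_sub_eq_zero (hf : IsMart w r f) (hr : Antitone r) {n : ℕ} {u : Ω → ℝ}
    (hu : IsMeas (r n) u) (k : ℕ) : ∑ ω, (w ω * u ω) • (f (n + k) ω - f n ω) = 0 := by
  induction k with
  | zero => simp
  | succ k ih =>
    have h1 := hf.sum_eq (n + k) u (hu.mono (hr (Nat.le_add_right n k)))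
    have h2 : ∀ ω, (w ω * u ω) • (f (n + (k + 1)) ω - f n ω)
        = (w ω * u ω) • (f (n + k) ω - f n ω)
          + (w ω * u ω) • (f (n + k + 1) ω - f (n + k) ω) := fun ω => by
      rw [← smul_add, ← add_assoc]; congr 1; abel
    simp_rw [h2]
    rw [Finset.sum_add_distrib, ih, h1, add_zero]

/-- The norm of a martingale is a submartingale. -/
lemma sum_norm_le (hw : ∀ ω, 0 ≤ w ω) (hf : IsMart w r f) (hr : Antitone r) {n L : ℕ}
    (hnL : n ≤ L) {u : Ω → ℝ} (hu : IsMeas (r n) u) (hu0 : ∀ ω, 0 ≤ u ω) :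
    ∑ ω, w ω * u ω * ‖f n ω‖ ≤ ∑ ω, w ω * u ω * ‖f L ω‖ := by
  classical
  have key : ∀ a, w a * ‖f n a‖ ≤ w a * condAvg w (r n) (fun ω => ‖f L ω‖) a := by
    intro a
    rcases (hw a).eq_or_lt with h0 | h0
    · rw [← h0]; simp
    refine mul_le_mul_of_nonneg_left ?_ h0.le
    have hS : 0 < ∑ b with r n a b, w b :=
      Finset.sum_pos' (fun b _ => hw b) ⟨a, by simp, h0⟩
    obtain ⟨k, rfl⟩ := Nat.exists_eq_add_of_le hnL
    have h1 := hf.sum_sub_eq_zero hr (n := n) (u := fun b => if r n a b then 1 else 0)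
      (fun b c hbc => by
        by_cases hab : r n a b
        · simp only [if_pos hab, if_pos ((r n).trans hab hbc)]
        · have : ¬ r n a c := fun h => hab ((r n).trans h ((r n).symm hbc))
          simp only [if_neg hab, if_neg this]) k
    have h2 : ∑ b with r n a b, w b • f (n + k) b = (∑ b with r n a b, w b) • f n a := by
      rw [Finset.sum_smul, ← sub_eq_zero, ← Finset.sum_sub_distrib, ← h1, Finset.sum_filter]
      refine Finset.sum_congr rfl fun b _ => ?_
      by_cases hab : r n a b
      · simp only [if_pos hab, hf.meas n hab, mul_one, smul_sub]
      · simp only [if_neg hab, mul_zero, zero_smul]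
    have h3 : f n a = condAvg w (r n) (f (n + k)) a := by
      unfold condAvg
      rw [h2, smul_smul, inv_mul_cancel₀ hS.ne', one_smul]
    rw [h3]
    exact norm_condAvg_le hw _ _ _
  calc ∑ ω, w ω * u ω * ‖f n ω‖
      ≤ ∑ ω, (w ω * u ω) • condAvg w (r n) (fun ω => ‖f L ω‖) ω := by
        refine Finset.sum_le_sum fun ω _ => ?_
        have := mul_le_mul_of_nonneg_left (key ω) (hu0 ω)
        simp only [smul_eq_mul]
        nlinarith
    _ = ∑ ω, w ω * u ω * ‖f L ω‖ := by
        rw [sum_mul_condAvg hw _ _ hu]; rfl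

lemma sub_const (hf : IsMart w r f) {g : Ω → E} (hg : IsMeas (r 0) g) (hr : Antitone r) :
    IsMart w r (fun n ω => f n ω - g ω) where
  meas n := (hf.meas n).comp₂ (fun x y => x - y) (hg.mono (hr (Nat.zero_le n)))
  sum_eq n u hu := by
    rw [← hf.sum_eq n u hu]
    refine Finset.sum_congr rfl fun ω _ => ?_
    congr 1; abel

lemma shift (hf : IsMart w r f) (k : ℕ) :
    IsMart w (fun n => r (k + n)) (fun n => f (k + n)) where
  meas n := hf.meas (k + n)
  sum_eq n u hu := hf.sum_eq (k + n) u hu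

/-- The martingale `(f_{t_n})` along a monotone sequence of times. -/
lemma comp_monotone (hf : IsMart w r f) (hr : Antitone r) {t : ℕ → ℕ} (ht : Monotone t) :
    IsMart w (fun n => r (t n)) (fun n => f (t n)) where
  meas n := hf.meas (t n)
  sum_eq n u hu := by
    obtain ⟨k, hk⟩ := Nat.exists_eq_add_of_le (ht n.le_succ)
    have := hf.sum_sub_eq_zero hr hu k
    rwa [← hk] at this

/-- Martingale transform by a predictable sequence. -/
lemma transform (hf : IsMart w r f) (hr : Antitone r) {v : ℕ → Ω → ℝ}
    (hv : ∀ n, IsMeas (r n) (v n)) :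
    IsMart w r (fun n ω => ∑ k ∈ Finset.range n, v k ω • (f (k + 1) ω - f k ω)) where
  meas n a b hab := by
    refine Finset.sum_congr rfl fun k hk => ?_
    have hk' : k + 1 ≤ n := Finset.mem_range.mp hk
    rw [hv k (hr (Nat.le_of_succ_le hk') hab), hf.meas (k + 1) (hr hk' hab),
      hf.meas k (hr (Nat.le_of_succ_le hk') hab)]
  sum_eq n u hu := by
    rw [← hf.sum_eq n (fun ω => u ω * v n ω) (hu.comp₂ (fun x y => x * y) (hv n))]
    refine Finset.sum_congr rfl fun ω _ => ?_
    rw [Finset.sum_range_succ, add_sub_cancel_left, smul_smul, mul_assoc]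

/-- Sums of adapted summands, compensated to have zero conditional expectation, form a
martingale. -/
lemma of_compensated (hw : ∀ ω, 0 ≤ w ω) (hr : Antitone r) {a : ℕ → Ω → E}
    (ha : ∀ n, IsMeas (r (n + 1)) (a n)) :
    IsMart w r (fun n ω => ∑ k ∈ Finset.range n, (a k ω - condAvg w (r k) (a k) ω)) where
  meas n x y hxy := by
    refine Finset.sum_congr rfl fun k hk => ?_
    have hk' : k + 1 ≤ n := Finset.mem_range.mp hk
    rw [ha k (hr hk' hxy), isMeas_condAvg w (r k) (a k) (hr (Nat.le_of_succ_le hk') hxy)]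
  sum_eq n u hu := by
    simp_rw [Finset.sum_range_succ, add_sub_cancel_left, smul_sub]
    rw [Finset.sum_sub_distrib, sum_mul_condAvg hw _ _ hu, sub_self]

/-- This holds everywhere, also on classes of weight zero, where `condAvg` is `0`. -/
lemma condAvg_sub_eq_zero (hf : IsMart w r f) (n : ℕ) (a : Ω) :
    condAvg w (r n) (fun ω => f (n + 1) ω - f n ω) a = 0 := by
  classical
  have h1 := hf.sum_eq n (fun b => if r n a b then 1 else 0)
    (fun b c hbc => by
      by_cases hab : r n a b
      · simp only [if_pos hab, if_pos ((r n).trans hab hbc)]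
      · have : ¬ r n a c := fun h => hab ((r n).trans h ((r n).symm hbc))
        simp only [if_neg hab, if_neg this])
  unfold condAvg
  rw [Finset.sum_filter (fun b => r n a b) (fun b => w b • (f (n + 1) b - f n b))]
  have h2 : ∑ b, (if r n a b then w b • (f (n + 1) b - f n b) else 0) = 0 := by
    refine Eq.trans ?_ h1
    refine Finset.sum_congr rfl fun b _ => ?_
    by_cases hab : r n a b
    · simp only [if_pos hab, mul_one]
    · simp only [if_neg hab, mul_zero, zero_smul]
  rw [h2, smul_zero]

end IsMart

/-! ### Maximal inequalities -/

/-- Absorption by Young's inequality. -/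
lemma sum_rpow_le_of_sum_mul_rpow_le {w Y Z : Ω → ℝ} (hw : ∀ ω, 0 ≤ w ω) (hY : ∀ ω, 0 ≤ Y ω)
    (hZ : ∀ ω, 0 ≤ Z ω) {p c : ℝ} (hp : 1 < p) (hc : 0 ≤ c)
    (h : ∑ ω, w ω * Y ω ^ p ≤ c * ∑ ω, w ω * (Z ω * Y ω ^ (p - 1))) :
    ∑ ω, w ω * Y ω ^ p ≤ c ^ p * ∑ ω, w ω * Z ω ^ p := by
  have hp0 : 0 < p := by linarith
  have hpq : p.HolderConjugate (p / (p - 1)) := Real.HolderConjugate.conjExponent hp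
  have h1 : ∀ ω, c * (w ω * (Z ω * Y ω ^ (p - 1)))
      ≤ w ω * (c ^ p * Z ω ^ p / p) + w ω * (Y ω ^ p * (1 - 1 / p)) := by
    intro ω
    have := Real.young_inequality_of_nonneg (mul_nonneg hc (hZ ω))
      (Real.rpow_nonneg (hY ω) (p - 1)) hpq
    rw [← Real.rpow_mul (hY ω), mul_div_cancel₀ _ (by linarith : p - 1 ≠ 0),
      Real.mul_rpow hc (hZ ω)] at this
    have h2 : Y ω ^ p / (p / (p - 1)) = Y ω ^ p * (1 - 1 / p) := by
      field_simp
    rw [h2] at this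
    have := mul_le_mul_of_nonneg_left this (hw ω)
    linarith
  rw [Finset.mul_sum] at h
  have h2 := h.trans (Finset.sum_le_sum fun ω _ => h1 ω)
  rw [Finset.sum_add_distrib] at h2
  have h3 : ∑ ω, w ω * (c ^ p * Z ω ^ p / p) = (c ^ p * ∑ ω, w ω * Z ω ^ p) / p := by
    rw [Finset.mul_sum, Finset.sum_div]
    exact Finset.sum_congr rfl fun ω _ => by ring
  have h4 : ∑ ω, w ω * (Y ω ^ p * (1 - 1 / p)) = (∑ ω, w ω * Y ω ^ p) * (1 - 1 / p) := by
    rw [Finset.sum_mul]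
    exact Finset.sum_congr rfl fun ω _ => by ring
  rw [h3, h4] at h2
  have h5 : (∑ ω, w ω * Y ω ^ p) / p ≤ (c ^ p * ∑ ω, w ω * Z ω ^ p) / p := by
    have : (∑ ω, w ω * Y ω ^ p) / p = (∑ ω, w ω * Y ω ^ p) * (1 / p) := by ring
    rw [this]; linarith
  exact (div_le_div_iff_of_pos_right hp0).mp h5

/-- One step of the pathwise form of Doob's inequality. -/
lemma rpow_sub_rpow_le {p a c : ℝ} (hp : 1 < p) (ha : 0 ≤ a) (hc : 0 ≤ c) :
    a ^ p - c ^ p ≤ p / (p - 1) * (a * (a ^ (p - 1) - c ^ (p - 1))) := by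
  have hpq : p.HolderConjugate (p / (p - 1)) := Real.HolderConjugate.conjExponent hp
  have h1 := Real.young_inequality_of_nonneg ha (Real.rpow_nonneg hc (p - 1)) hpq
  rw [← Real.rpow_mul hc, mul_div_cancel₀ _ (by linarith : p - 1 ≠ 0)] at h1
  have h2 : a * a ^ (p - 1) = a ^ p := by
    rw [← Real.rpow_one_add' ha (by linarith)]; congr 1; ring
  have hp1 : 0 < p - 1 := by linarith
  rw [mul_sub, h2]
  have h3 : p / (p - 1) * (a * c ^ (p - 1)) ≤ p / (p - 1) * (a ^ p / p + c ^ p / (p / (p - 1))) :=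
    mul_le_mul_of_nonneg_left h1 (by positivity)
  have h4 : p / (p - 1) * (a ^ p / p + c ^ p / (p / (p - 1))) = a ^ p / (p - 1) + c ^ p := by
    field_simp
  have h5 : p / (p - 1) * a ^ p = a ^ p + a ^ p / (p - 1) := by field_simp; ring
  rw [mul_sub, h5]
  linarith

/-- Doob's maximal inequality in `L^p`. -/
lemma IsMart.sum_partialSups_rpow_le {w : Ω → ℝ} {r : ℕ → Setoid Ω} {f : ℕ → Ω → E}
    (hw : ∀ ω, 0 ≤ w ω) (hr : Antitone r) (hf : IsMart w r f) {p : ℝ} (hp : 1 < p) (L : ℕ) :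
    ∑ ω, w ω * (partialSups (fun j => ‖f j ω‖) L) ^ p
      ≤ (p / (p - 1)) ^ p * ∑ ω, w ω * ‖f L ω‖ ^ p := by
  have hp1 : 0 < p - 1 := by linarith
  set M : ℕ → Ω → ℝ := fun n ω => partialSups (fun j => ‖f j ω‖) n with hM
  have hM0 : ∀ n ω, 0 ≤ M n ω := fun n ω =>
    (norm_nonneg _).trans (le_partialSups_of_le (fun j => ‖f j ω‖) (le_refl n))
  have hMs : ∀ n ω, M (n + 1) ω = max (M n ω) ‖f (n + 1) ω‖ := fun n ω =>
    partialSups_add_one _ _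
  have hMm : ∀ n, IsMeas (r n) (M n) := by
    intro n
    induction n with
    | zero => exact fun a b hab => by simp [hM, hf.meas 0 hab]
    | succ n ih =>
      intro a b hab
      rw [hMs, hMs, ih (hr n.le_succ hab), hf.meas (n + 1) hab]
  have hMle : ∀ n ω, M n ω ≤ M (n + 1) ω := fun n ω => by rw [hMs]; exact le_max_left _ _
  have hM1 : ∀ n ω, M n ω ^ (p - 1) ≤ M (n + 1) ω ^ (p - 1) := fun n ω =>
    Real.rpow_le_rpow (hM0 n ω) (hMle n ω) hp1.le
  have key : ∀ n, n ≤ L → ∑ ω, w ω * M n ω ^ p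
      ≤ p / (p - 1) * ∑ ω, w ω * (‖f L ω‖ * M n ω ^ (p - 1)) := by
    intro n
    induction n with
    | zero =>
      intro _
      have h0 : ∀ ω, M 0 ω = ‖f 0 ω‖ := fun ω => by simp [hM]
      have h1 : ∑ ω, w ω * M 0 ω ^ p = ∑ ω, w ω * M 0 ω ^ (p - 1) * ‖f 0 ω‖ := by
        refine Finset.sum_congr rfl fun ω _ => ?_
        rw [h0, mul_assoc, ← Real.rpow_add_one' (norm_nonneg _) (by linarith)]
        congr 2; ring
      have h2 := hf.sum_norm_le hw hr (Nat.zero_le L) ((hMm 0).comp (fun x => x ^ (p - 1)))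
        (fun ω => Real.rpow_nonneg (hM0 0 ω) _)
      have h3 : ∑ ω, w ω * M 0 ω ^ (p - 1) * ‖f L ω‖
          = ∑ ω, w ω * (‖f L ω‖ * M 0 ω ^ (p - 1)) :=
        Finset.sum_congr rfl fun ω _ => by ring
      rw [h1]
      rw [h3] at h2
      have h4 : 0 ≤ ∑ ω, w ω * (‖f L ω‖ * M 0 ω ^ (p - 1)) :=
        Finset.sum_nonneg fun ω _ => mul_nonneg (hw ω)
          (mul_nonneg (norm_nonneg _) (Real.rpow_nonneg (hM0 0 ω) _))
      have h5 : 1 ≤ p / (p - 1) := by rw [le_div_iff₀ hp1]; linarith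
      exact h2.trans (le_mul_of_one_le_left h4 h5)
    | succ n ih =>
      intro hn
      have h1 : ∀ ω, w ω * M (n + 1) ω ^ p ≤ w ω * M n ω ^ p + p / (p - 1) *
          (w ω * (M (n + 1) ω ^ (p - 1) - M n ω ^ (p - 1)) * ‖f (n + 1) ω‖) := by
        intro ω
        have h : M (n + 1) ω ^ p - M n ω ^ p ≤ p / (p - 1) *
            (‖f (n + 1) ω‖ * (M (n + 1) ω ^ (p - 1) - M n ω ^ (p - 1))) := by
          rcases le_total ‖f (n + 1) ω‖ (M n ω) with h | h
          · rw [hMs, max_eq_left h]; simp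
          · rw [hMs, max_eq_right h]
            exact rpow_sub_rpow_le hp (norm_nonneg _) (hM0 n ω)
        have := mul_le_mul_of_nonneg_left h (hw ω)
        linarith
      have h2 := hf.sum_norm_le hw hr hn (u := fun ω => M (n + 1) ω ^ (p - 1) - M n ω ^ (p - 1))
        (((hMm (n + 1)).comp (fun x => x ^ (p - 1))).comp₂ (fun x y => x - y)
          (((hMm n).mono (hr n.le_succ)).comp (fun x => x ^ (p - 1))))
        (fun ω => sub_nonneg.mpr (hM1 n ω))
      have h3 := Finset.sum_le_sum fun ω (_ : ω ∈ Finset.univ) => h1 ω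
      rw [Finset.sum_add_distrib, ← Finset.mul_sum] at h3
      have h4 : ∑ ω, w ω * (‖f L ω‖ * M (n + 1) ω ^ (p - 1))
          = ∑ ω, w ω * (‖f L ω‖ * M n ω ^ (p - 1))
            + ∑ ω, w ω * (M (n + 1) ω ^ (p - 1) - M n ω ^ (p - 1)) * ‖f L ω‖ := by
        rw [← Finset.sum_add_distrib]
        exact Finset.sum_congr rfl fun ω _ => by ring
      have h5 : 0 ≤ p / (p - 1) := by positivity
      rw [h4, mul_add]
      exact h3.trans (add_le_add (ih (Nat.le_of_succ_le hn)) (mul_le_mul_of_nonneg_left h2 h5))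
  refine sum_rpow_le_of_sum_mul_rpow_le hw (hM0 L) (fun ω => norm_nonneg _) hp (by positivity)
    (key L le_rfl)

/-- The dual form of Doob's inequality: conditioning each summand of a sum of nonnegative functions
on the past does not increase the `L^p`-norm by more than the factor `p`. -/
lemma sum_condAvg_rpow_le {w : Ω → ℝ} {r : ℕ → Setoid Ω} (hw : ∀ ω, 0 ≤ w ω) (hr : Antitone r)
    {X : ℕ → Ω → ℝ} (hX : ∀ n ω, 0 ≤ X n ω) {p : ℝ} (hp : 1 < p) (L : ℕ) :
    ∑ ω, w ω * (∑ k ∈ Finset.range L, condAvg w (r k) (X k) ω) ^ p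
      ≤ p ^ p * ∑ ω, w ω * (∑ k ∈ Finset.range L, X k ω) ^ p := by
  have hp1 : 0 < p - 1 := by linarith
  set A : ℕ → Ω → ℝ := fun n ω => ∑ k ∈ Finset.range n, condAvg w (r k) (X k) ω with hA
  have hc : ∀ n ω, 0 ≤ condAvg w (r n) (X n) ω := fun n ω => condAvg_nonneg hw _ (hX n) ω
  have hA0 : ∀ n ω, 0 ≤ A n ω := fun n ω => Finset.sum_nonneg fun k _ => hc k ω
  have hAs : ∀ n ω, A (n + 1) ω = A n ω + condAvg w (r n) (X n) ω := fun n ω =>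
    Finset.sum_range_succ _ _
  have hAm : ∀ n, IsMeas (r n) (A (n + 1)) := fun n a b hab => by
    refine Finset.sum_congr rfl fun k hk => ?_
    exact isMeas_condAvg w (r k) (X k) (hr (Nat.lt_succ_iff.mp (Finset.mem_range.mp hk)) hab)
  have hAmono : ∀ ω, Monotone fun n => A n ω := fun ω =>
    monotone_nat_of_le_succ fun n => by rw [hAs]; linarith [hc n ω]
  have hstep : ∀ n ω, A (n + 1) ω ^ p
      ≤ A n ω ^ p + p * (A (n + 1) ω ^ (p - 1) * condAvg w (r n) (X n) ω) := by
    intro n ω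
    set x := A (n + 1) ω
    set y := A n ω
    have hx : 0 ≤ x := hA0 _ ω
    have hy : 0 ≤ y := hA0 _ ω
    have hpq : p.HolderConjugate (p / (p - 1)) := Real.HolderConjugate.conjExponent hp
    have h1 := Real.young_inequality_of_nonneg hy (Real.rpow_nonneg hx (p - 1)) hpq
    rw [← Real.rpow_mul hx, mul_div_cancel₀ _ (by linarith : p - 1 ≠ 0)] at h1
    have h2 : x ^ (p - 1) * x = x ^ p := by
      rw [← Real.rpow_add_one' hx (by linarith)]; congr 1; ring
    have h3 : condAvg w (r n) (X n) ω = x - y := by simp only [x, y, hAs]; ring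
    rw [h3, mul_sub, h2]
    have h4 : p * (y * x ^ (p - 1)) ≤ p * (y ^ p / p + x ^ p / (p / (p - 1))) :=
      mul_le_mul_of_nonneg_left h1 (by linarith)
    have h5 : p * (y ^ p / p + x ^ p / (p / (p - 1))) = y ^ p + (p - 1) * x ^ p := by
      field_simp
    linarith
  have key : ∀ n, n ≤ L → ∑ ω, w ω * A n ω ^ p
      ≤ p * ∑ ω, w ω * ((∑ k ∈ Finset.range n, X k ω) * A L ω ^ (p - 1)) := by
    intro n
    induction n with
    | zero =>
      intro _
      simp [hA, Real.zero_rpow (by linarith : p ≠ 0)]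
    | succ n ih =>
      intro hn
      have h1 : ∑ ω, w ω * A (n + 1) ω ^ p ≤ ∑ ω, w ω * A n ω ^ p
          + p * ∑ ω, (w ω * A (n + 1) ω ^ (p - 1)) • condAvg w (r n) (X n) ω := by
        rw [Finset.mul_sum, ← Finset.sum_add_distrib]
        refine Finset.sum_le_sum fun ω _ => ?_
        have := mul_le_mul_of_nonneg_left (hstep n ω) (hw ω)
        simp only [smul_eq_mul]
        linarith
      rw [sum_mul_condAvg hw _ _ ((hAm n).comp (fun x => x ^ (p - 1)))] at h1
      have h2 : ∑ ω, (w ω * A (n + 1) ω ^ (p - 1)) • X n ω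
          ≤ ∑ ω, w ω * (X n ω * A L ω ^ (p - 1)) := by
        refine Finset.sum_le_sum fun ω _ => ?_
        rw [smul_eq_mul, mul_assoc, mul_comm (X n ω)]
        exact mul_le_mul_of_nonneg_left (mul_le_mul_of_nonneg_right
          (Real.rpow_le_rpow (hA0 _ ω) (hAmono ω hn) hp1.le) (hX n ω)) (hw ω)
      have h3 := ih (Nat.le_of_succ_le hn)
      have h4 : ∑ ω, w ω * ((∑ k ∈ Finset.range (n + 1), X k ω) * A L ω ^ (p - 1))
          = ∑ ω, w ω * ((∑ k ∈ Finset.range n, X k ω) * A L ω ^ (p - 1))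
            + ∑ ω, w ω * (X n ω * A L ω ^ (p - 1)) := by
        rw [← Finset.sum_add_distrib]
        refine Finset.sum_congr rfl fun ω _ => ?_
        rw [Finset.sum_range_succ]; ring
      rw [h4, mul_add]
      have h5 := mul_le_mul_of_nonneg_left h2 (by linarith : 0 ≤ p)
      linarith
  exact sum_rpow_le_of_sum_mul_rpow_le hw (hA0 L)
    (fun ω => Finset.sum_nonneg fun k _ => hX k ω) hp (by linarith) (key L le_rfl)

end FiniteMartingale

/-! ### Block variation of sequences -/

section BlockVar

variable {E : Type*} [NormedAddCommGroup E]

/-- The oscillation of the sequence `a` over the time block `[t i, t (i + 1)]`. -/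
noncomputable def blockMax (t : ℕ → ℕ) (a : ℕ → E) (i : ℕ) : ℝ :=
  partialSups (fun j => ‖a (t i + j) - a (t i)‖) (t (i + 1) - t i)

/-- The `ℓ^q`-sum of the oscillations of `a` over the first `m` blocks `[t i, t (i + 1)]`. -/
noncomputable def blockVar (q : ℝ) (t : ℕ → ℕ) (m : ℕ) (a : ℕ → E) : ℝ :=
  (∑ i ∈ Finset.range m, blockMax t a i ^ q) ^ (1 / q)

lemma blockMax_nonneg (t : ℕ → ℕ) (a : ℕ → E) (i : ℕ) : 0 ≤ blockMax t a i :=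
  (norm_nonneg _).trans
    (le_partialSups_of_le (fun j => ‖a (t i + j) - a (t i)‖) (Nat.zero_le _))

lemma norm_sub_le_blockMax {t : ℕ → ℕ} (a : ℕ → E) {i n : ℕ} (h1 : t i ≤ n) (h2 : n ≤ t (i + 1)) :
    ‖a n - a (t i)‖ ≤ blockMax t a i := by
  have := le_partialSups_of_le (fun j => ‖a (t i + j) - a (t i)‖)
    (show n - t i ≤ t (i + 1) - t i by omega)
  rwa [show t i + (n - t i) = n by omega] at this

lemma blockMax_le {t : ℕ → ℕ} {a : ℕ → E} {i : ℕ} {c : ℝ} (ht : t i ≤ t (i + 1))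
    (h : ∀ n, t i ≤ n → n ≤ t (i + 1) → ‖a n - a (t i)‖ ≤ c) : blockMax t a i ≤ c :=
  partialSups_le _ _ _ fun j hj => h _ (Nat.le_add_right _ _) (by omega)

lemma blockVar_nonneg (q : ℝ) (t : ℕ → ℕ) (m : ℕ) (a : ℕ → E) : 0 ≤ blockVar q t m a :=
  Real.rpow_nonneg (Finset.sum_nonneg fun i _ => Real.rpow_nonneg (blockMax_nonneg t a i) _) _

lemma blockVar_mono {q : ℝ} (hq : 1 ≤ q) {t : ℕ → ℕ} {m : ℕ} {a : ℕ → E} {F : Type*}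
    [NormedAddCommGroup F] {b : ℕ → F}
    (h : ∀ i < m, blockMax t a i ≤ blockMax t b i) : blockVar q t m a ≤ blockVar q t m b := by
  refine Real.rpow_le_rpow
    (Finset.sum_nonneg fun i _ => Real.rpow_nonneg (blockMax_nonneg t a i) _)
    (Finset.sum_le_sum fun i hi => ?_) (by positivity)
  exact Real.rpow_le_rpow (blockMax_nonneg t a i) (h i (Finset.mem_range.mp hi)) (by linarith)

lemma blockVar_add_le {q : ℝ} (hq : 1 ≤ q) {t : ℕ → ℕ} (ht : Monotone t) (m : ℕ) (a b : ℕ → E) :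
    blockVar q t m (fun n => a n + b n) ≤ blockVar q t m a + blockVar q t m b := by
  refine le_trans ?_ (Real.Lp_add_le_of_nonneg _ hq (fun i _ => blockMax_nonneg t a i)
    (fun i _ => blockMax_nonneg t b i))
  refine Real.rpow_le_rpow
    (Finset.sum_nonneg fun i _ => Real.rpow_nonneg (blockMax_nonneg t _ i) _)
    (Finset.sum_le_sum fun i hi => ?_) (by positivity)
  refine Real.rpow_le_rpow (blockMax_nonneg t _ i) ?_ (by linarith)
  refine blockMax_le (ht i.le_succ) fun n h1 h2 => ?_
  calc ‖a n + b n - (a (t i) + b (t i))‖ = ‖(a n - a (t i)) + (b n - b (t i))‖ := by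
        congr 1; abel
    _ ≤ _ := (norm_add_le _ _).trans
        (add_le_add (norm_sub_le_blockMax a h1 h2) (norm_sub_le_blockMax b h1 h2))

lemma blockVar_eq_zero {q : ℝ} (hq : 1 ≤ q) {t : ℕ → ℕ} (ht : Monotone t) (m : ℕ) {a : ℕ → E}
    (h : ∀ n, a n = 0) : blockVar q t m a = 0 := by
  have : ∀ i, blockMax t a i = 0 := fun i =>
    le_antisymm (blockMax_le (ht i.le_succ) fun n _ _ => by simp [h]) (blockMax_nonneg t a i)
  simp only [blockVar, this]
  rw [Finset.sum_eq_zero fun i _ => Real.zero_rpow (by linarith : q ≠ 0),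
    Real.zero_rpow (by positivity)]

lemma blockVar_sub_const (q : ℝ) (t : ℕ → ℕ) (m : ℕ) (a : ℕ → E) (c : E) :
    blockVar q t m (fun n => a n - c) = blockVar q t m a := by
  simp only [blockVar, blockMax, sub_sub_sub_cancel_right]

lemma blockVar_sum_le {q : ℝ} (hq : 1 ≤ q) {t : ℕ → ℕ} (ht : Monotone t) (m : ℕ) {ι : Type*}
    (s : Finset ι) (a : ι → ℕ → E) :
    blockVar q t m (fun n => ∑ i ∈ s, a i n) ≤ ∑ i ∈ s, blockVar q t m (a i) := by
  classical
  induction s using Finset.induction_on with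
  | empty => simpa using (blockVar_eq_zero hq ht m (a := fun _ => (0 : E)) fun _ => rfl).le
  | insert i s hi ih =>
    simp only [Finset.sum_insert hi]
    exact (blockVar_add_le hq ht m _ _).trans (by gcongr)

/-- A sequence with a single jump `v` has block variation at most `‖v‖`, because only one block can
contain the jump. -/
lemma blockVar_jump_le {q : ℝ} (hq : 1 ≤ q) {t : ℕ → ℕ} (ht : Monotone t) (m k : ℕ) (v : E) :
    blockVar q t m (fun n => if k ≤ n then v else 0) ≤ ‖v‖ := by
  have h1 : ∀ i, blockMax t (fun n => if k ≤ n then v else 0) i ^ q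
      ≤ (if k ≤ t (i + 1) then ‖v‖ ^ q else 0) - (if k ≤ t i then ‖v‖ ^ q else 0) := by
    intro i
    have hm := ht i.le_succ
    by_cases h1 : k ≤ t i
    · have : blockMax t (fun n => if k ≤ n then v else 0) i ≤ 0 :=
        blockMax_le hm fun n hn _ => by simp [h1, h1.trans hn]
      rw [le_antisymm this (blockMax_nonneg _ _ _), if_pos h1, if_pos (h1.trans hm),
        Real.zero_rpow (by linarith), sub_self]
    · rw [if_neg h1, sub_zero]
      by_cases h2 : k ≤ t (i + 1)
      · rw [if_pos h2]
        refine Real.rpow_le_rpow (blockMax_nonneg _ _ _) (blockMax_le hm fun n _ _ => ?_)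
          (by linarith)
        rw [if_neg h1, sub_zero]
        split_ifs <;> simp
      · rw [if_neg h2]
        have : blockMax t (fun n => if k ≤ n then v else 0) i ≤ 0 :=
          blockMax_le hm fun n _ hn => by simp [h1, show ¬ k ≤ n by omega]
        rw [le_antisymm this (blockMax_nonneg _ _ _), Real.zero_rpow (by linarith)]
  have h2 : ∑ i ∈ Finset.range m, blockMax t (fun n => if k ≤ n then v else 0) i ^ q
      ≤ ‖v‖ ^ q := by
    refine (Finset.sum_le_sum fun i _ => h1 i).trans ?_
    rw [Finset.sum_range_sub (fun i => if k ≤ t i then ‖v‖ ^ q else 0)]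
    have h3 : (0 : ℝ) ≤ ‖v‖ ^ q := by positivity
    split_ifs <;> linarith
  calc blockVar q t m (fun n => if k ≤ n then v else 0) ≤ (‖v‖ ^ q) ^ (1 / q) :=
        Real.rpow_le_rpow (Finset.sum_nonneg fun i _ =>
          Real.rpow_nonneg (blockMax_nonneg t _ i) _) h2 (by positivity)
    _ = ‖v‖ := by
        rw [← Real.rpow_mul (norm_nonneg v), mul_one_div_cancel (by linarith), Real.rpow_one]

/-- The block variation is at most the total variation. -/
lemma blockVar_sum_jump_le {q : ℝ} (hq : 1 ≤ q) {t : ℕ → ℕ} (ht : Monotone t) {m L : ℕ}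
    (hL : t m ≤ L) (v : ℕ → E) :
    blockVar q t m (fun n => ∑ k ∈ Finset.range n, v k) ≤ ∑ k ∈ Finset.range L, ‖v k‖ := by
  have h1 : blockVar q t m (fun n => ∑ k ∈ Finset.range n, v k)
      ≤ blockVar q t m (fun n => ∑ k ∈ Finset.range L, if k + 1 ≤ n then v k else 0) := by
    have h0 : ∀ n ≤ L, (∑ k ∈ Finset.range L, if k + 1 ≤ n then v k else 0)
        = ∑ k ∈ Finset.range n, v k := by
      intro n hn
      rw [← Finset.sum_filter]
      refine Finset.sum_congr ?_ fun _ _ => rfl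
      ext k
      simp only [Finset.mem_filter, Finset.mem_range]
      omega
    refine blockVar_mono hq fun i hi => blockMax_le (ht i.le_succ) fun n hn hn' => ?_
    have h2 : t (i + 1) ≤ L := (ht hi).trans hL
    rw [← h0 n (hn'.trans h2), ← h0 (t i) (hn.trans (hn'.trans h2))]
    exact norm_sub_le_blockMax (fun n => ∑ k ∈ Finset.range L, if k + 1 ≤ n then v k else 0) hn hn'
  refine h1.trans ((blockVar_sum_le hq ht m _ _).trans (Finset.sum_le_sum fun k _ => ?_))
  exact blockVar_jump_le hq ht m (k + 1) (v k)

/-- Block variation increases with the time at which a sequence is stopped. -/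
lemma blockVar_stopped_mono {q : ℝ} (hq : 1 ≤ q) {t : ℕ → ℕ} (ht : Monotone t) (m : ℕ) (a : ℕ → E)
    {k k' : ℕ} (h : k ≤ k') :
    blockVar q t m (fun n => a (min n k)) ≤ blockVar q t m (fun n => a (min n k')) := by
  refine blockVar_mono hq fun i _ => blockMax_le (ht i.le_succ) fun n hn hn' => ?_
  rcases le_total k (t i) with h1 | h1
  · rw [min_eq_right (h1.trans hn), min_eq_right h1, sub_self, norm_zero]
    exact blockMax_nonneg _ _ _
  · have h2 := norm_sub_le_blockMax (t := t) (fun n => a (min n k')) (i := i) (n := min n k)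
      (le_min hn h1) ((min_le_left _ _).trans hn')
    rwa [min_eq_left ((min_le_right n k).trans h), min_eq_left (h1.trans h),
      ← min_eq_left h1] at h2

lemma blockVar_stopped_le_max {q : ℝ} (hq : 1 ≤ q) {t : ℕ → ℕ} (ht : Monotone t) (m : ℕ) (a : ℕ → E)
    (k : ℕ) : blockVar q t m (fun n => a (min n k)) ≤ blockVar q t m a := by
  refine (blockVar_stopped_mono hq ht m a (le_max_left k (t m))).trans ?_
  refine blockVar_mono hq fun i hi => blockMax_le (ht i.le_succ) fun n hn hn' => ?_
  have h2 : t (i + 1) ≤ max k (t m) := (ht hi).trans (le_max_right _ _)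
  rw [min_eq_left (hn'.trans h2), min_eq_left (hn.trans (hn'.trans h2))]
  exact norm_sub_le_blockMax a hn hn'

lemma blockVar_le_stopped {q : ℝ} (hq : 1 ≤ q) {t : ℕ → ℕ} (ht : Monotone t) {m : ℕ} (a : ℕ → E)
    {k : ℕ} (hk : t m ≤ k) : blockVar q t m a ≤ blockVar q t m (fun n => a (min n k)) := by
  refine blockVar_mono hq fun i hi => blockMax_le (ht i.le_succ) fun n hn hn' => ?_
  have h2 : t (i + 1) ≤ k := (ht hi).trans hk
  have := norm_sub_le_blockMax (t := t) (fun n => a (min n k)) hn hn'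
  rwa [min_eq_left (hn'.trans h2), min_eq_left (hn.trans (hn'.trans h2))] at this

/-- Summing increments while a decreasing condition holds gives the sequence stopped at the first
failure. -/
lemma exists_sum_ite_eq_sub [NormedSpace ℝ E] (g : ℕ → E) (P : ℕ → Prop) [DecidablePred P]
    (hP : ∀ k, P (k + 1) → P k) (n : ℕ) :
    ∃ s ≤ n, ∑ k ∈ Finset.range n, (if P k then (1 : ℝ) else 0) • (g (k + 1) - g k) = g s - g 0 ∧
      (∀ k < s, P k) ∧ (s = n ∨ ¬ P s) := by
  have hP' : ∀ k n, k ≤ n → P n → P k := fun k n hkn => by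
    induction n, hkn using Nat.le_induction with
    | base => exact id
    | succ n _ ih => exact fun h => ih (hP n h)
  induction n with
  | zero => exact ⟨0, le_rfl, by simp, by simp, Or.inl rfl⟩
  | succ n ih =>
    obtain ⟨s, hs, h1, h2, h3⟩ := ih
    rw [Finset.sum_range_succ, h1]
    by_cases hPn : P n
    · have hsn : s = n := h3.resolve_right fun h => h (hP' s n hs hPn)
      refine ⟨n + 1, le_rfl, ?_, fun k hk => hP' k n (Nat.lt_succ_iff.mp hk) hPn, Or.inl rfl⟩
      rw [if_pos hPn, one_smul, hsn]; abel
    · refine ⟨s, hs.trans n.le_succ, ?_, h2, Or.inr ?_⟩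
      · rw [if_neg hPn, zero_smul, add_zero]
      · rcases h3 with rfl | h3
        · exact hPn
        · exact h3

end BlockVar

/-! ### Extrapolation of martingale inequalities -/

section Extrapolation

/-- Integration of a good-`λ` inequality. -/
lemma sum_rpow_le_of_good_lambda {Ω : Type*} [Fintype Ω] {w Y X : Ω → ℝ} (hw : ∀ ω, 0 ≤ w ω)
    (hY : ∀ ω, 0 ≤ Y ω) (hX : ∀ ω, 0 ≤ X ω) {p ε δ : ℝ} (hp : 0 < p) (hε : 0 ≤ ε) (hδ : 0 < δ)
    (h : ∀ l : ℝ, 0 < l → (∑ ω, if 2 * l < Y ω ∧ X ω ≤ δ * l then w ω else 0)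
      ≤ ε * ∑ ω, if l < Y ω then w ω else 0) :
    ∑ ω, w ω * Y ω ^ p ≤ 2 ^ p * (ε * ∑ ω, w ω * Y ω ^ p + δ⁻¹ ^ p * ∑ ω, w ω * X ω ^ p) := by
  classical
  let _ : MeasurableSpace Ω := ⊤
  let μ : Measure Ω := ∑ ω, ENNReal.ofReal (w ω) • Measure.dirac ω
  have hμ : ∀ s : Set Ω, μ s = ENNReal.ofReal (∑ ω, if ω ∈ s then w ω else 0) := by
    intro s
    rw [ENNReal.ofReal_sum_of_nonneg fun ω _ => by split_ifs <;> simp [hw]]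
    simp only [μ, Measure.coe_finsetSum, Finset.sum_apply, Measure.smul_apply, smul_eq_mul]
    refine Finset.sum_congr rfl fun ω _ => ?_
    rw [Measure.dirac_apply' _ (by trivial)]
    by_cases hs : ω ∈ s <;> simp [hs]
  have hint : ∀ F : Ω → ℝ, (∀ ω, 0 ≤ F ω) →
      ∫⁻ ω, ENNReal.ofReal (F ω) ∂μ = ENNReal.ofReal (∑ ω, w ω * F ω) := by
    intro F hF
    rw [lintegral_fintype, ENNReal.ofReal_sum_of_nonneg fun ω _ => mul_nonneg (hw ω) (hF ω)]
    refine Finset.sum_congr rfl fun ω _ => ?_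
    rw [hμ, mul_comm, ENNReal.ofReal_mul (hw ω)]
    simp
  have hmeas : ∀ F : Ω → ℝ, AEMeasurable F μ := fun F => (measurable_from_top).aemeasurable
  have cake : ∀ F : Ω → ℝ, (∀ ω, 0 ≤ F ω) → ENNReal.ofReal (∑ ω, w ω * F ω ^ p)
      = ENNReal.ofReal p * ∫⁻ l in Ioi (0 : ℝ), μ {a | l < F a} * ENNReal.ofReal (l ^ (p - 1)) := by
    intro F hF
    rw [← lintegral_rpow_eq_lintegral_meas_lt_mul μ (Eventually.of_forall hF) (hmeas F) hp,
      hint _ fun ω => Real.rpow_nonneg (hF ω) p]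
  have hm1 : ∀ F : Ω → ℝ, Measurable fun l : ℝ =>
      μ {a | l < F a} * ENNReal.ofReal (l ^ (p - 1)) := by
    intro F
    refine Measurable.mul ?_ (by fun_prop)
    exact (Antitone.measurable fun a b hab => measure_mono fun x hx => lt_of_le_of_lt hab hx)
  have step : ∀ l ∈ Ioi (0 : ℝ), μ {a | l < Y a / 2} * ENNReal.ofReal (l ^ (p - 1))
      ≤ ENNReal.ofReal ε * (μ {a | l < Y a} * ENNReal.ofReal (l ^ (p - 1)))
        + μ {a | l < X a / δ} * ENNReal.ofReal (l ^ (p - 1)) := by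
    intro l hl
    rw [← mul_assoc, ← add_mul]
    refine mul_le_mul_left ?_ _
    have h1 : {a | l < Y a / 2} ⊆ {a | 2 * l < Y a ∧ X a ≤ δ * l} ∪ {a | l < X a / δ} := by
      intro a ha
      rw [mem_ofPred_eq, lt_div_iff₀ two_pos] at ha
      rcases lt_or_ge (δ * l) (X a) with h2 | h2
      · right
        rw [mem_ofPred_eq, lt_div_iff₀ hδ]; linarith
      · left
        exact ⟨by linarith, h2⟩
    refine (measure_mono h1).trans ((measure_union_le _ _).trans (add_le_add ?_ le_rfl))
    rw [hμ, hμ, ← ENNReal.ofReal_mul hε]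
    refine ENNReal.ofReal_le_ofReal ?_
    convert h l hl <;> exact mem_ofPred
  have hkey := setLIntegral_mono' (μ := volume) measurableSet_Ioi step
  rw [lintegral_add_left ((hm1 Y).const_mul _), lintegral_const_mul _ (hm1 Y)] at hkey
  have hkey' := mul_le_mul_right hkey (ENNReal.ofReal p)
  rw [mul_add, mul_left_comm, ← cake Y hY, ← cake (fun a => Y a / 2) fun ω => by
    have := hY ω; positivity, ← cake (fun a => X a / δ) fun ω => by
    have := hX ω; positivity, ← ENNReal.ofReal_mul hε] at hkey'
  have hsY : 0 ≤ ∑ ω, w ω * Y ω ^ p := Finset.sum_nonneg fun ω _ =>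
    mul_nonneg (hw ω) (Real.rpow_nonneg (hY ω) p)
  have hsX : 0 ≤ ∑ ω, w ω * (X ω / δ) ^ p := Finset.sum_nonneg fun ω _ =>
    mul_nonneg (hw ω) (Real.rpow_nonneg (div_nonneg (hX ω) hδ.le) p)
  rw [← ENNReal.ofReal_add (mul_nonneg hε hsY) hsX,
    ENNReal.ofReal_le_ofReal_iff (add_nonneg (mul_nonneg hε hsY) hsX)] at hkey'
  have e1 : ∑ ω, w ω * Y ω ^ p = 2 ^ p * ∑ ω, w ω * (Y ω / 2) ^ p := by
    rw [Finset.mul_sum]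
    refine Finset.sum_congr rfl fun ω _ => ?_
    rw [Real.div_rpow (hY ω) two_pos.le]
    field_simp
  have e2 : ∑ ω, w ω * (X ω / δ) ^ p = δ⁻¹ ^ p * ∑ ω, w ω * X ω ^ p := by
    rw [Finset.mul_sum]
    refine Finset.sum_congr rfl fun ω _ => ?_
    rw [div_eq_mul_inv, Real.mul_rpow (hX ω) (inv_nonneg.mpr hδ.le)]
    ring
  rw [← e2]
  nth_rewrite 1 [e1]
  exact mul_le_mul_of_nonneg_left hkey' (by positivity)

/-- The inequality `‖W f‖_p^p ≤ C ‖f_L‖_p^p` for the block variation `W f` of all `E`-valued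
martingales on finite weighted sets. -/
def BlockBound (E : Type*) [NormedAddCommGroup E] [NormedSpace ℝ E] (q : ℝ) (t : ℕ → ℕ) (m : ℕ)
    (p C : ℝ) : Prop :=
  ∀ (Ω : Type) [Fintype Ω] (w : Ω → ℝ) (r : ℕ → Setoid Ω) (f : ℕ → Ω → E), (∀ ω, 0 ≤ w ω) →
    Antitone r → IsMart w r f → ∀ L, t m ≤ L →
      ∑ ω, w ω * blockVar q t m (fun n => f n ω) ^ p ≤ C * ∑ ω, w ω * ‖f L ω‖ ^ p

variable {E : Type*} [NormedAddCommGroup E] [NormedSpace ℝ E]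

/-- The good-`λ` inequality between the block variation and the maximal function, for martingales
whose increments are dominated by an adapted increasing process `D`. -/
lemma BlockBound.good_lambda {q : ℝ} (hq : 1 ≤ q) {t : ℕ → ℕ} (ht : Monotone t) {m : ℕ}
    {p C : ℝ} (hp : 0 < p) (hC : 0 ≤ C) (hb : BlockBound E q t m p C)
    {Ω : Type} [Fintype Ω] {w : Ω → ℝ} {r : ℕ → Setoid Ω} {g : ℕ → Ω → E} (hw : ∀ ω, 0 ≤ w ω)
    (hr : Antitone r) (hg : IsMart w r g) {D : ℕ → Ω → ℝ} (hD : ∀ n, IsMeas (r n) (D n))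
    (hDm : ∀ ω, Monotone fun n => D n ω) (hgD : ∀ n ω, ‖g (n + 1) ω - g n ω‖ ≤ D n ω)
    {L : ℕ} (hL : t m ≤ L) {X : Ω → ℝ} (hX1 : ∀ ω, D L ω ≤ X ω)
    (hX2 : ∀ ω, ∀ j ≤ L, ‖g j ω - g 0 ω‖ ≤ X ω) {δ l : ℝ} (hδ : 0 < δ) (hδ' : δ ≤ 1 / 2)
    (hl : 0 < l) :
    (∑ ω, if 2 * l < blockVar q t m (fun n => g n ω) ∧ X ω ≤ δ * l then w ω else 0)
      ≤ C * (8 * δ) ^ p * ∑ ω, if l < blockVar q t m (fun n => g n ω) then w ω else 0 := by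
  classical
  set V : ℕ → Ω → ℝ := fun k ω => blockVar q t m (fun n => g (min n k) ω) with hV
  set W : Ω → ℝ := fun ω => blockVar q t m (fun n => g n ω) with hW
  have hVW : ∀ k ω, V k ω ≤ W ω := fun k ω => blockVar_stopped_le_max hq ht m (fun n => g n ω) k
  have hVmono : ∀ ω k, V k ω ≤ V (k + 1) ω := fun ω k =>
    blockVar_stopped_mono hq ht m (fun n => g n ω) k.le_succ
  have hVm : ∀ k, IsMeas (r k) (V k) := fun k =>
    (IsMeas.pi (X := fun n => g (min n k)) fun n =>
      (hg.meas _).mono (hr (min_le_right n k))).comp (blockVar q t m)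
  set c : ℕ → Ω → Prop := fun k ω => (∀ j ≤ k, ‖g j ω - g 0 ω‖ ≤ δ * l) ∧ D k ω ≤ δ * l with hc
  have hcs : ∀ ω k, c (k + 1) ω → c k ω := fun ω k h =>
    ⟨fun j hj => h.1 j (hj.trans k.le_succ), (hDm ω k.le_succ).trans h.2⟩
  have hcm : ∀ k, IsMeas (r k) (c k) := by
    intro k a b hab
    have h0 : g 0 a = g 0 b := hg.meas 0 (hr (Nat.zero_le k) hab)
    refine propext (and_congr (forall_congr' fun j => forall_congr' fun hj => ?_) ?_)
    · rw [hg.meas j (hr hj hab), h0]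
    · rw [hD k hab]
  set v : ℕ → Ω → ℝ := fun k ω => if l < V k ω ∧ c k ω then 1 else 0 with hv
  have hvm : ∀ k, IsMeas (r k) (v k) := fun k a b hab => by
    simp only [hv, hVm k hab, hcm k hab]
  -- `Z` starts `g` when its block variation has passed `l`, and stops it when `g` or `D` gets large
  set Z : ℕ → Ω → E := fun n ω => ∑ k ∈ Finset.range n, v k ω • (g (k + 1) ω - g k ω) with hZ
  have hZm : IsMart w r Z := hg.transform hr hvm
  have hδl : 0 < δ * l := by positivity
  -- the stopped martingale is small: before stopping by `c`, and one more jump is bounded by `D`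
  have hstopped : ∀ ω s, (∀ k < s, c k ω) → ‖g s ω - g 0 ω‖ ≤ 2 * (δ * l) := by
    intro ω s hs
    rcases s with _ | s
    · simp only [sub_self, norm_zero]; positivity
    · have h1 := hs s s.lt_succ_self
      calc ‖g (s + 1) ω - g 0 ω‖ = ‖(g (s + 1) ω - g s ω) + (g s ω - g 0 ω)‖ := by
            congr 1; abel
        _ ≤ δ * l + δ * l := (norm_add_le _ _).trans
            (add_le_add ((hgD s ω).trans h1.2) (h1.1 s le_rfl))
        _ = _ := by ring
  have hZle : ∀ n ω, ‖Z n ω‖ ≤ 4 * (δ * l) := by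
    intro n ω
    obtain ⟨s, _, h1, h2, _⟩ := exists_sum_ite_eq_sub (fun n => g n ω) (fun k => c k ω) (hcs ω) n
    obtain ⟨s', _, h1', h2', _⟩ := exists_sum_ite_eq_sub (fun n => g n ω)
      (fun k => c k ω ∧ ¬ l < V k ω)
      (fun k h => ⟨hcs ω k h.1, fun h' => h.2 (h'.trans_le (hVmono ω k))⟩) n
    have h3 : Z n ω = (g s ω - g 0 ω) - (g s' ω - g 0 ω) := by
      rw [← h1, ← h1', ← Finset.sum_sub_distrib]
      refine Finset.sum_congr rfl fun k _ => ?_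
      rw [← sub_smul]
      congr 1
      by_cases hck : c k ω <;> by_cases hVk : l < V k ω <;> simp [hv, hck, hVk]
    rw [h3]
    have h4 := hstopped ω s h2
    have h5 := hstopped ω s' fun k hk => (h2' k hk).1
    exact (norm_sub_le _ _).trans (by linarith)
  have hZ0 : ∀ n ω, ¬ l < W ω → Z n ω = 0 := by
    intro n ω h
    refine Finset.sum_eq_zero fun k _ => ?_
    have : ¬ (l < V k ω ∧ c k ω) := fun h' => h (h'.1.trans_le (hVW k ω))
    simp only [hv, if_neg this, zero_smul]
  -- on the good event the part after the first passage of `V` above `l` is still large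
  have hgood : ∀ ω, 2 * l < W ω → X ω ≤ δ * l →
      l / 2 ≤ blockVar q t m (fun n => Z n ω) := by
    intro ω h1 h2
    have hcall : ∀ k ≤ L, c k ω := fun k hk =>
      ⟨fun j hj => (hX2 ω j (hj.trans hk)).trans h2, (hDm ω hk).trans ((hX1 ω).trans h2)⟩
    have hex : ∃ k, l < V k ω :=
      ⟨L, lt_of_lt_of_le (by linarith) (blockVar_le_stopped hq ht (fun n => g n ω) hL)⟩
    have hτ := Nat.find_spec hex
    have hτ' : ∀ k < Nat.find hex, ¬ l < V k ω := fun k hk => Nat.find_min hex hk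
    set τ := Nat.find hex with hτdef
    have hτpos : τ ≠ 0 := by
      intro h0
      rw [h0] at hτ
      have : V 0 ω = 0 := by
        have := blockVar_sub_const q t m (fun n => g (min n 0) ω) (g 0 ω)
        rw [hV]; simp only
        rw [← this]
        exact blockVar_eq_zero hq ht m fun n => by simp
      rw [this] at hτ
      linarith
    obtain ⟨σ, hσ⟩ := Nat.exists_eq_succ_of_ne_zero hτpos
    have hτL : τ ≤ L := Nat.find_min' hex
      (lt_of_lt_of_le (by linarith) (blockVar_le_stopped hq ht (fun n => g n ω) hL))
    have hbefore : V σ ω ≤ l := not_lt.mp (hτ' σ (by omega))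
    have hjump : V τ ω ≤ l + δ * l := by
      have h3 : V τ ω ≤ V σ ω + blockVar q t m
          (fun n => if τ ≤ n then g (σ + 1) ω - g σ ω else 0) := by
        refine le_trans (le_of_eq ?_) (blockVar_add_le hq ht m (fun n => g (min n σ) ω) _)
        simp only [hV]
        congr 1
        funext n
        by_cases hn : τ ≤ n
        · rw [if_pos hn, min_eq_right hn, min_eq_right (by omega), hσ]; simp
        · rw [if_neg hn, min_eq_left (by omega), min_eq_left (by omega), add_zero]
      have h4 := blockVar_jump_le hq ht m τ (g (σ + 1) ω - g σ ω)
      have h5 := (hgD σ ω).trans (hcall σ (by omega)).2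
      linarith
    have hZeq : ∀ n ≤ L, Z n ω = g n ω - g (min n τ) ω := by
      intro n
      induction n with
      | zero => intro _; simp [hZ]
      | succ n ih =>
        intro hn
        have h3 : Z (n + 1) ω = Z n ω + v n ω • (g (n + 1) ω - g n ω) :=
          Finset.sum_range_succ _ _
        rw [h3, ih (Nat.le_of_succ_le hn)]
        by_cases hnτ : n < τ
        · have : v n ω = 0 := if_neg fun h => hτ' n hnτ h.1
          rw [this, min_eq_left hnτ.le, min_eq_left hnτ]; simp
        · have h4 : V τ ω ≤ V n ω :=
            blockVar_stopped_mono hq ht m (fun n => g n ω) (not_lt.mp hnτ)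
          have : v n ω = 1 := if_pos ⟨hτ.trans_le h4, hcall n (Nat.le_of_succ_le hn)⟩
          rw [this, min_eq_right (by omega), min_eq_right (by omega), one_smul]; abel
    have hWle : W ω ≤ V τ ω + blockVar q t m (fun n => Z n ω) := by
      refine le_trans ?_ (blockVar_add_le hq ht m (fun n => g (min n τ) ω) (fun n => Z n ω))
      refine blockVar_mono hq fun i hi => blockMax_le (ht i.le_succ) fun n hn hn' => ?_
      have hnL : n ≤ L := hn'.trans ((ht hi).trans hL)
      have h3 := norm_sub_le_blockMax (t := t) (fun n => g (min n τ) ω + Z n ω) hn hn'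
      rwa [hZeq n hnL, hZeq (t i) (hn.trans hnL), add_sub_cancel, add_sub_cancel] at h3
    nlinarith
  have hmain := hb Ω w r Z hw hr hZm L hL
  have hR : ∑ ω, w ω * ‖Z L ω‖ ^ p ≤ (4 * (δ * l)) ^ p * ∑ ω, if l < W ω then w ω else 0 := by
    rw [Finset.mul_sum]
    refine Finset.sum_le_sum fun ω _ => ?_
    split_ifs with h
    · rw [mul_comm]
      exact mul_le_mul_of_nonneg_right
        (Real.rpow_le_rpow (norm_nonneg _) (hZle L ω) hp.le) (hw ω)
    · rw [hZ0 L ω h, norm_zero, Real.zero_rpow hp.ne', mul_zero, mul_zero]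
  have hLft : (l / 2) ^ p * (∑ ω, if 2 * l < W ω ∧ X ω ≤ δ * l then w ω else 0)
      ≤ ∑ ω, w ω * blockVar q t m (fun n => Z n ω) ^ p := by
    rw [Finset.mul_sum]
    refine Finset.sum_le_sum fun ω _ => ?_
    split_ifs with h
    · rw [mul_comm]
      exact mul_le_mul_of_nonneg_left
        (Real.rpow_le_rpow (by positivity) (hgood ω h.1 h.2) hp.le) (hw ω)
    · rw [mul_zero]
      exact mul_nonneg (hw ω) (Real.rpow_nonneg (blockVar_nonneg _ _ _ _) _)
  have h1 := hLft.trans (hmain.trans (mul_le_mul_of_nonneg_left hR hC))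
  have h2 : (4 * (δ * l)) ^ p = (8 * δ) ^ p * (l / 2) ^ p := by
    rw [← Real.mul_rpow (by positivity) (by positivity)]; congr 1; ring
  rw [h2] at h1
  have h3 : 0 < (l / 2) ^ p := by positivity
  refine le_of_mul_le_mul_left (h1.trans (le_of_eq ?_)) h3
  ring

end Extrapolation

section BlockBoundExtrapolation

lemma Real.add_rpow_le_two_rpow_mul {x y p : ℝ} (hx : 0 ≤ x) (hy : 0 ≤ y) (hp : 0 ≤ p) :
    (x + y) ^ p ≤ 2 ^ p * (x ^ p + y ^ p) := by
  have h1 : (x + y) ^ p ≤ (2 * max x y) ^ p :=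
    Real.rpow_le_rpow (by positivity)
      (by linarith [le_max_left x y, le_max_right x y]) hp
  rw [Real.mul_rpow two_pos.le (le_max_of_le_left hx)] at h1
  refine h1.trans (mul_le_mul_of_nonneg_left ?_ (by positivity))
  have := Real.rpow_nonneg hx p
  have := Real.rpow_nonneg hy p
  rcases max_choice x y with h | h <;> rw [h] <;> linarith

lemma sum_mul_add_rpow_le {Ω : Type*} [Fintype Ω] {w X Y : Ω → ℝ} (hw : ∀ ω, 0 ≤ w ω)
    (hX : ∀ ω, 0 ≤ X ω) (hY : ∀ ω, 0 ≤ Y ω) {p : ℝ} (hp : 0 ≤ p) :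
    ∑ ω, w ω * (X ω + Y ω) ^ p ≤ 2 ^ p * (∑ ω, w ω * X ω ^ p + ∑ ω, w ω * Y ω ^ p) := by
  rw [← Finset.sum_add_distrib, Finset.mul_sum]
  refine Finset.sum_le_sum fun ω _ => ?_
  have := mul_le_mul_of_nonneg_left (Real.add_rpow_le_two_rpow_mul (hX ω) (hY ω) hp) (hw ω)
  linarith

lemma sum_mul_rpow_le_sum_mul_rpow {Ω : Type*} [Fintype Ω] {w X Y : Ω → ℝ} (hw : ∀ ω, 0 ≤ w ω)
    (hX : ∀ ω, 0 ≤ X ω) (hXY : ∀ ω, X ω ≤ Y ω) {p : ℝ} (hp : 0 ≤ p) :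
    ∑ ω, w ω * X ω ^ p ≤ ∑ ω, w ω * Y ω ^ p :=
  Finset.sum_le_sum fun ω _ =>
    mul_le_mul_of_nonneg_left (Real.rpow_le_rpow (hX ω) (hXY ω) hp) (hw ω)

variable {E : Type*} [NormedAddCommGroup E] [NormedSpace ℝ E]

/-- Burkholder–Gundy extrapolation: a bound for the block variation in one `L^p` gives bounds in all
others, with constants that do not depend on the blocks. The proof splits a martingale by Davis'
decomposition into one with predictably bounded jumps and one of integrable variation. -/
theorem BlockBound.extrapolate {p₀ C₀ p : ℝ} (hp₀ : 0 < p₀) (hC₀ : 0 ≤ C₀) (hp : 1 < p) :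
    ∃ C, 0 ≤ C ∧ ∀ (q : ℝ) (t : ℕ → ℕ) (m : ℕ), 1 ≤ q → Monotone t →
      BlockBound E q t m p₀ C₀ → BlockBound E q t m p C := by
  have hp0 : 0 < p := by linarith
  have hp1 : 0 < p - 1 := by linarith
  -- `δ` is so small that the term on the left is absorbed after integrating the good-`λ` inequality
  obtain ⟨δ, hδ, hδ', hδC⟩ : ∃ δ : ℝ, 0 < δ ∧ δ ≤ 1 / 2 ∧
      2 ^ p * (C₀ * (8 * δ) ^ p₀) ≤ 1 / 2 := by
    set η : ℝ := (2 * 2 ^ p * (C₀ + 1))⁻¹ with hη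
    have hη0 : 0 < η := by positivity
    refine ⟨min (1 / 2) (η ^ (1 / p₀) / 8), by positivity, min_le_left _ _, ?_⟩
    have h1 : (8 * min (1 / 2) (η ^ (1 / p₀) / 8)) ^ p₀ ≤ η := by
      calc (8 * min (1 / 2) (η ^ (1 / p₀) / 8)) ^ p₀ ≤ (η ^ (1 / p₀)) ^ p₀ := by
            refine Real.rpow_le_rpow (by positivity) ?_ hp₀.le
            linarith [min_le_right (1 / 2) (η ^ (1 / p₀) / 8)]
        _ = η := by
            rw [← Real.rpow_mul hη0.le, one_div_mul_cancel hp₀.ne', Real.rpow_one]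
    have h2 : C₀ * (8 * min (1 / 2) (η ^ (1 / p₀) / 8)) ^ p₀ ≤ (C₀ + 1) * η :=
      mul_le_mul (by linarith) h1 (by positivity) (by linarith)
    calc _ ≤ 2 ^ p * ((C₀ + 1) * η) := mul_le_mul_of_nonneg_left h2 (by positivity)
      _ = 1 / 2 := by rw [hη]; field_simp
  refine ⟨2 ^ p * (2 * (2 ^ p * δ⁻¹ ^ p) + 1) * (2 ^ p * (12 ^ p + p ^ p * 4 ^ p))
    * (p / (p - 1)) ^ p, by positivity, ?_⟩
  intro q t m hq ht hb Ω _ w r f hw hr hf L hL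
  classical
  -- the decomposition of Davis: `a` collects the increments at most twice the running maximum `ds`
  -- of the earlier ones, and the sum of the norms of the others, `b`, telescopes
  set d : ℕ → Ω → E := fun n ω => f (n + 1) ω - f n ω with hd
  set ds : ℕ → Ω → ℝ := fun n ω =>
    partialSups (fun j => if j = 0 then 0 else ‖d (j - 1) ω‖) n with hds
  have ds0 : ∀ n ω, 0 ≤ ds n ω := fun n ω => by
    have := le_partialSups_of_le (fun j => if j = 0 then 0 else ‖d (j - 1) ω‖) (Nat.zero_le n)
    simpa using this
  have dss : ∀ n ω, ds (n + 1) ω = max (ds n ω) ‖d n ω‖ := fun n ω => by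
    simp only [hds]
    rw [partialSups_add_one]; simp
  have dsm : ∀ n, IsMeas (r n) (ds n) := by
    intro n
    induction n with
    | zero => exact fun a b _ => by simp [hds]
    | succ n ih =>
      intro a b hab
      have hab' := hr n.le_succ hab
      simp only [dss, ih hab', hd, hf.meas (n + 1) hab, hf.meas n hab']
  have dsmono : ∀ ω, Monotone fun n => ds n ω := fun ω =>
    monotone_nat_of_le_succ fun n => by rw [dss]; exact le_max_left _ _
  set a : ℕ → Ω → E := fun n ω => if ‖d n ω‖ ≤ 2 * ds n ω then d n ω else 0 with ha
  set b : ℕ → Ω → E := fun n ω => if ‖d n ω‖ ≤ 2 * ds n ω then 0 else d n ω with hbdef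
  have hab : ∀ n ω, a n ω + b n ω = d n ω := fun n ω => by
    simp only [ha, hbdef]; split_ifs <;> simp
  have ham : ∀ n, IsMeas (r (n + 1)) (a n) := fun n x y hxy => by
    have hxy' := hr n.le_succ hxy
    simp only [ha, hd, hf.meas (n + 1) hxy, hf.meas n hxy', dsm n hxy']
  have ha_le : ∀ n ω, ‖a n ω‖ ≤ 2 * ds n ω := fun n ω => by
    simp only [ha]
    split_ifs with h
    · exact h
    · rw [norm_zero]; have := ds0 n ω; positivity
  have hb_le : ∀ n ω, ‖b n ω‖ ≤ 2 * (ds (n + 1) ω - ds n ω) := fun n ω => by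
    have h1 : ds n ω ≤ ds (n + 1) ω := dsmono ω n.le_succ
    simp only [hbdef]
    split_ifs with h
    · rw [norm_zero]; linarith
    · have : ‖d n ω‖ ≤ ds (n + 1) ω := by rw [dss]; exact le_max_right _ _
      linarith
  set g : ℕ → Ω → E := fun n ω => ∑ k ∈ Finset.range n, (a k ω - condAvg w (r k) (a k) ω)
    with hg
  set h : ℕ → Ω → E := fun n ω => ∑ k ∈ Finset.range n, (b k ω - condAvg w (r k) (b k) ω)
    with hh
  have hgm : IsMart w r g := IsMart.of_compensated hw hr ham
  have hfgh : ∀ n ω, f n ω - f 0 ω = g n ω + h n ω := by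
    intro n ω
    rw [hg, hh]
    simp only
    rw [← Finset.sum_add_distrib, ← Finset.sum_range_sub (fun n => f n ω)]
    refine Finset.sum_congr rfl fun k _ => ?_
    have h1 := hf.condAvg_sub_eq_zero k ω
    have h2 : condAvg w (r k) (fun ω => f (k + 1) ω - f k ω) ω
        = condAvg w (r k) (a k) ω + condAvg w (r k) (b k) ω := by
      rw [← condAvg_add]
      congr 1
      funext ω
      exact (hab k ω).symm
    rw [h2] at h1
    have h3 := hab k ω
    calc f (k + 1) ω - f k ω = a k ω + b k ω
          - (condAvg w (r k) (a k) ω + condAvg w (r k) (b k) ω) := by rw [h1, h3, sub_zero]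
      _ = _ := by abel
  have hca : ∀ n ω, ‖condAvg w (r n) (a n) ω‖ ≤ 2 * ds n ω := fun n ω =>
    (norm_condAvg_le hw _ _ _).trans (condAvg_le_of_forall_le hw _
      (by have := ds0 n ω; positivity) fun b' hb' => by rw [dsm n hb']; exact ha_le n b')
  have hgD : ∀ n ω, ‖g (n + 1) ω - g n ω‖ ≤ 4 * ds n ω := by
    intro n ω
    simp only [hg]
    rw [Finset.sum_range_succ, add_sub_cancel_left]
    refine (norm_sub_le _ _).trans ?_
    have := ha_le n ω
    have := hca n ω
    linarith
  set F : Ω → ℝ := fun ω => partialSups (fun j => ‖f j ω‖) L with hF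
  set G : Ω → ℝ := fun ω =>
    ∑ k ∈ Finset.range L, condAvg w (r k) (fun ω => ‖b k ω‖) ω with hG
  have hFle : ∀ ω, ∀ j ≤ L, ‖f j ω‖ ≤ F ω := fun ω j hj =>
    le_partialSups_of_le (fun j => ‖f j ω‖) hj
  have hF0 : ∀ ω, 0 ≤ F ω := fun ω => (norm_nonneg _).trans (hFle ω 0 (Nat.zero_le L))
  have hcb0 : ∀ k ω, 0 ≤ condAvg w (r k) (fun ω => ‖b k ω‖) ω := fun k ω =>
    condAvg_nonneg hw _ (fun _ => norm_nonneg _) ω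
  have hG0 : ∀ ω, 0 ≤ G ω := fun ω => Finset.sum_nonneg fun k _ => hcb0 k ω
  have hdsF : ∀ ω, ds L ω ≤ 2 * F ω := by
    intro ω
    refine partialSups_le _ _ _ fun j hj => ?_
    split_ifs with h0
    · have := hF0 ω; positivity
    · have h1 := hFle ω j hj
      have h2 := hFle ω (j - 1) (by omega)
      have h3 : ‖d (j - 1) ω‖ ≤ ‖f (j - 1 + 1) ω‖ + ‖f (j - 1) ω‖ := norm_sub_le _ _
      rw [Nat.sub_add_cancel (by omega)] at h3
      linarith
  have hbsum : ∀ ω, ∑ k ∈ Finset.range L, ‖b k ω‖ ≤ 4 * F ω := by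
    intro ω
    refine (Finset.sum_le_sum fun k _ => hb_le k ω).trans ?_
    rw [← Finset.mul_sum, Finset.sum_range_sub (fun k => ds k ω)]
    have := hdsF ω
    have := ds0 0 ω
    linarith
  have hhsum : ∀ ω, ∑ k ∈ Finset.range L, ‖b k ω - condAvg w (r k) (b k) ω‖ ≤ 4 * F ω + G ω := by
    intro ω
    refine (Finset.sum_le_sum fun k _ => (norm_sub_le _ _).trans (add_le_add le_rfl
      (norm_condAvg_le hw (r k) (b k) ω))).trans ?_
    rw [Finset.sum_add_distrib]
    exact add_le_add (hbsum ω) le_rfl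
  have hhle : ∀ ω, ∀ j ≤ L, ‖h j ω‖ ≤ 4 * F ω + G ω := by
    intro ω j hj
    refine (norm_sum_le _ _).trans (le_trans ?_ (hhsum ω))
    exact Finset.sum_le_sum_of_subset_of_nonneg (Finset.range_mono hj)
      fun _ _ _ => norm_nonneg _
  set X : Ω → ℝ := fun ω => 12 * F ω + G ω with hX
  have hX0 : ∀ ω, 0 ≤ X ω := fun ω => by
    have := hF0 ω
    have := hG0 ω
    simp only [hX]; positivity
  have hgood := fun l (hl : (0 : ℝ) < l) => hb.good_lambda hq ht hp₀ hC₀ hw hr hgm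
    (D := fun n ω => 4 * ds n ω) (fun n => (dsm n).comp (fun x => 4 * x))
    (fun ω => (dsmono ω).const_mul (by norm_num)) hgD hL (X := X)
    (fun ω => by
      have := hdsF ω
      have := hF0 ω
      have := hG0 ω
      simp only [hX]; linarith)
    (fun ω j hj => by
      have h1 : g j ω - g 0 ω = (f j ω - f 0 ω) - h j ω := by rw [hfgh]; simp [hg]
      rw [h1]
      have h2 := norm_sub_le (f j ω - f 0 ω) (h j ω)
      have h3 := norm_sub_le (f j ω) (f 0 ω)
      have h4 := hFle ω j hj
      have h5 := hFle ω 0 (Nat.zero_le L)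
      have h6 := hhle ω j hj
      have h7 := hF0 ω
      simp only [hX]; linarith)
    hδ hδ' hl
  set Wg : Ω → ℝ := fun ω => blockVar q t m (fun n => g n ω) with hWg
  have hWg0 : ∀ ω, 0 ≤ Wg ω := fun ω => blockVar_nonneg _ _ _ _
  have h1 := sum_rpow_le_of_good_lambda hw hWg0 hX0 hp0 (ε := C₀ * (8 * δ) ^ p₀)
    (by positivity) hδ (fun l hl => hgood l hl)
  have hSg : 0 ≤ ∑ ω, w ω * Wg ω ^ p := Finset.sum_nonneg fun ω _ =>
    mul_nonneg (hw ω) (Real.rpow_nonneg (hWg0 ω) p)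
  have h2 : ∑ ω, w ω * Wg ω ^ p ≤ 2 * (2 ^ p * δ⁻¹ ^ p) * ∑ ω, w ω * X ω ^ p := by
    have := mul_le_mul_of_nonneg_right hδC hSg
    nlinarith
  have hWf : ∀ ω, blockVar q t m (fun n => f n ω) ≤ Wg ω + X ω := by
    intro ω
    have e1 : blockVar q t m (fun n => f n ω) = blockVar q t m (fun n => g n ω + h n ω) := by
      rw [← blockVar_sub_const q t m (fun n => f n ω) (f 0 ω)]
      simp only [hfgh]
    rw [e1]
    refine (blockVar_add_le hq ht m _ _).trans (add_le_add le_rfl ?_)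
    refine (blockVar_sum_jump_le hq ht hL _).trans ((hhsum ω).trans ?_)
    have := hF0 ω
    simp only [hX]; linarith
  have h3 : ∑ ω, w ω * blockVar q t m (fun n => f n ω) ^ p
      ≤ 2 ^ p * (∑ ω, w ω * Wg ω ^ p + ∑ ω, w ω * X ω ^ p) :=
    (sum_mul_rpow_le_sum_mul_rpow hw (fun ω => blockVar_nonneg _ _ _ _) hWf hp0.le).trans
      (sum_mul_add_rpow_le hw hWg0 hX0 hp0.le)
  have h4 : ∑ ω, w ω * G ω ^ p ≤ p ^ p * (4 ^ p * ∑ ω, w ω * F ω ^ p) := by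
    refine (sum_condAvg_rpow_le hw hr (X := fun k ω => ‖b k ω‖) (fun _ _ => norm_nonneg _)
      hp L).trans (mul_le_mul_of_nonneg_left ?_ (by positivity))
    refine (sum_mul_rpow_le_sum_mul_rpow hw
      (fun ω => Finset.sum_nonneg fun _ _ => norm_nonneg _) hbsum hp0.le).trans (le_of_eq ?_)
    rw [Finset.mul_sum]
    refine Finset.sum_congr rfl fun ω _ => ?_
    rw [Real.mul_rpow (by norm_num) (hF0 ω)]; ring
  have h5 : ∑ ω, w ω * (12 * F ω) ^ p = 12 ^ p * ∑ ω, w ω * F ω ^ p := by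
    rw [Finset.mul_sum]
    refine Finset.sum_congr rfl fun ω _ => ?_
    rw [Real.mul_rpow (by norm_num) (hF0 ω)]; ring
  have h6 : ∑ ω, w ω * X ω ^ p
      ≤ 2 ^ p * (12 ^ p + p ^ p * 4 ^ p) * ∑ ω, w ω * F ω ^ p := by
    refine (sum_mul_add_rpow_le hw (fun ω => by have := hF0 ω; positivity) hG0 hp0.le).trans ?_
    rw [h5, mul_assoc, add_mul]
    exact mul_le_mul_of_nonneg_left (by linarith) (by positivity)
  have h7 := hf.sum_partialSups_rpow_le hw hr hp L
  calc ∑ ω, w ω * blockVar q t m (fun n => f n ω) ^ p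
      ≤ 2 ^ p * (2 * (2 ^ p * δ⁻¹ ^ p) + 1) * ∑ ω, w ω * X ω ^ p := by
        refine h3.trans ?_
        rw [mul_assoc]
        exact mul_le_mul_of_nonneg_left (by linarith) (by positivity)
    _ ≤ 2 ^ p * (2 * (2 ^ p * δ⁻¹ ^ p) + 1)
        * (2 ^ p * (12 ^ p + p ^ p * 4 ^ p) * ∑ ω, w ω * F ω ^ p) :=
        mul_le_mul_of_nonneg_left h6 (by positivity)
    _ ≤ 2 ^ p * (2 * (2 ^ p * δ⁻¹ ^ p) + 1)
        * (2 ^ p * (12 ^ p + p ^ p * 4 ^ p) * ((p / (p - 1)) ^ p * ∑ ω, w ω * ‖f L ω‖ ^ p)) :=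
        mul_le_mul_of_nonneg_left (mul_le_mul_of_nonneg_left h7 (by positivity)) (by positivity)
    _ = _ := by ring

/-- For `p = q`, Doob's inequality on each block reduces arbitrary blocks to increments. -/
lemma BlockBound.of_id {q C : ℝ} (hq : 1 < q) {m : ℕ}
    (hb : BlockBound E q id m q C) {t : ℕ → ℕ} (ht : Monotone t) :
    BlockBound E q t m q ((q / (q - 1)) ^ q * C) := by
  intro Ω _ w r f hw hr hf L hL
  have hq0 : 0 < q := by linarith
  have hq1 : 0 < q - 1 := by linarith
  have hpow : ∀ (t : ℕ → ℕ) (a : ℕ → E),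
      blockVar q t m a ^ q = ∑ i ∈ Finset.range m, blockMax t a i ^ q := fun t a => by
    unfold blockVar
    rw [← Real.rpow_mul (Finset.sum_nonneg fun i _ => Real.rpow_nonneg (blockMax_nonneg _ _ _) _),
      one_div_mul_cancel hq0.ne', Real.rpow_one]
  -- the martingale is sampled at the block times, and at `L` afterwards, so that its last value
  -- is `f_L`
  set t' : ℕ → ℕ := fun n => if n ≤ m then t n else L with ht'
  have ht'm : Monotone t' := by
    intro i j hij
    simp only [ht']
    split_ifs with h1 h2 h2
    · exact ht hij
    · exact (ht h1).trans hL
    · omega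
    · exact le_rfl
  have key := hb Ω w _ _ hw (hr.comp_monotone ht'm) (hf.comp_monotone hr ht'm) (m + 1)
    (Nat.le_succ m)
  have ht'L : t' (m + 1) = L := if_neg (by omega)
  rw [ht'L] at key
  simp_rw [hpow] at key ⊢
  rw [mul_assoc]
  refine le_trans ?_ (mul_le_mul_of_nonneg_left key (by positivity))
  simp_rw [Finset.mul_sum]
  rw [Finset.sum_comm]
  nth_rewrite 2 [Finset.sum_comm]
  refine Finset.sum_le_sum fun i hi => ?_
  have hi' := Finset.mem_range.mp hi
  have hdoob := ((hf.shift (t i)).sub_const (g := f (t i)) (hf.meas (t i))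
    (fun x y hxy => hr (Nat.add_le_add_left hxy _))).sum_partialSups_rpow_le hw
    (fun x y hxy => hr (Nat.add_le_add_left hxy _)) hq (t (i + 1) - t i)
  refine hdoob.trans ?_
  rw [Finset.mul_sum]
  refine Finset.sum_le_sum fun ω _ => mul_le_mul_of_nonneg_left
    (mul_le_mul_of_nonneg_left ?_ (hw ω)) (by positivity)
  refine Real.rpow_le_rpow (norm_nonneg _) ?_ hq0.le
  have h1 := norm_sub_le_blockMax (t := id) (fun n => f (t' n) ω) (i := i) (n := i + 1)
    i.le_succ le_rfl
  have h2 : t' (i + 1) = t (i + 1) := if_pos hi'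
  have h3 : t' i = t i := if_pos hi'.le
  simp only [id, h2, h3] at h1
  rwa [Nat.add_sub_cancel' (ht i.le_succ)]

end BlockBoundExtrapolation

/-! ### From martingale cotype to block variation -/

section Cotype

/-- The weighted counting measure, on the discrete σ-algebra. -/
noncomputable def finMeasure {Ω : Type*} [Fintype Ω] (w : Ω → ℝ) : @Measure Ω ⊤ :=
  @Finset.sum Ω (@Measure Ω ⊤) _ Finset.univ
    fun ω => ENNReal.ofReal (w ω) • @Measure.dirac Ω ⊤ ω

lemma finMeasure_singleton {Ω : Type*} [Fintype Ω] (w : Ω → ℝ) (ω : Ω) :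
    finMeasure w {ω} = ENNReal.ofReal (w ω) := by
  classical
  let _ : MeasurableSpace Ω := ⊤
  simp only [finMeasure, Measure.coe_finsetSum, Finset.sum_apply, Measure.smul_apply, smul_eq_mul]
  rw [Finset.sum_eq_single ω]
  · rw [Measure.dirac_apply' _ (by trivial)]; simp
  · intro b _ hb
    rw [Measure.dirac_apply' _ (by trivial)]; simp [hb]
  · simp

/-- The filtration on a finite set whose `n`-th σ-algebra has the classes of `r n` as atoms. -/
def setoidFiltration {Ω : Type*} (r : ℕ → Setoid Ω) (hr : Antitone r) :
    @Filtration Ω ℕ _ ⊤ :=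
  @Filtration.mk Ω ℕ _ ⊤
    (fun n => MeasurableSpace.comap (Quotient.mk (r n)) ⊤)
    (fun i j hij => by
      rintro s ⟨u, -, rfl⟩
      refine ⟨Quotient.mk (r j) '' (Quotient.mk (r i) ⁻¹' u), trivial, ?_⟩
      ext x
      constructor
      · rintro ⟨y, hy, hxy⟩
        have h1 : r i y x := hr hij (Quotient.exact hxy)
        have h2 : Quotient.mk (r i) y = Quotient.mk (r i) x := Quotient.sound h1
        simpa [mem_preimage, h2] using hy
      · exact fun hx => ⟨x, hx, rfl⟩)
    (fun _ => le_top)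

lemma IsMeas.stronglyMeasurable {Ω : Type*} [Finite Ω] {E : Type*} [TopologicalSpace E]
    {r : ℕ → Setoid Ω} (hr : Antitone r) {n : ℕ} {X : Ω → E} (hX : IsMeas (r n) X) :
    StronglyMeasurable[setoidFiltration r hr n] X := by
  let _ : MeasurableSpace (Quotient (r n)) := ⊤
  have h1 : Measurable[setoidFiltration r hr n] (Quotient.mk (r n)) :=
    Measurable.of_comap_le le_rfl
  have h2 : StronglyMeasurable (Quotient.lift X hX) := StronglyMeasurable.of_discrete
  exact h2.comp_measurable h1

lemma isMeas_of_measurableSet {Ω : Type*} {r : ℕ → Setoid Ω} (hr : Antitone r) {n : ℕ}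
    {s : Set Ω} (hs : MeasurableSet[setoidFiltration r hr n] s) :
    IsMeas (r n) (fun ω => ω ∈ s) := by
  obtain ⟨u, -, rfl⟩ := hs
  intro a b hab
  have : Quotient.mk (r n) a = Quotient.mk (r n) b := Quotient.sound hab
  simp only [mem_preimage, this]

lemma lintegral_finMeasure {Ω : Type*} [Fintype Ω] (w : Ω → ℝ) (F : Ω → ℝ≥0∞) :
    (@lintegral Ω ⊤ (finMeasure w) F) = ∑ ω, F ω * ENNReal.ofReal (w ω) := by
  let _ : MeasurableSpace Ω := ⊤
  rw [lintegral_fintype]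
  simp_rw [finMeasure_singleton]

instance {Ω : Type*} [Fintype Ω] (w : Ω → ℝ) : @IsFiniteMeasure Ω ⊤ (finMeasure w) := by
  let _ : MeasurableSpace Ω := ⊤
  refine ⟨?_⟩
  rw [← setLIntegral_one, Measure.restrict_univ, lintegral_finMeasure]
  exact ENNReal.sum_lt_top.mpr fun ω _ => by simp

variable {B : Type*} [NormedAddCommGroup B] [NormedSpace ℝ B]

lemma integral_finMeasure [CompleteSpace B] {Ω : Type*} [Fintype Ω] {w : Ω → ℝ}
    (hw : ∀ ω, 0 ≤ w ω) (F : Ω → B) :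
    (@integral Ω B _ _ ⊤ (finMeasure w) F) = ∑ ω, w ω • F ω := by
  let _ : MeasurableSpace Ω := ⊤
  have : Integrable F (finMeasure w) := Integrable.of_finite
  rw [integral_fintype this]
  refine Finset.sum_congr rfl fun ω _ => ?_
  rw [measureReal_def, finMeasure_singleton, ENNReal.toReal_ofReal (hw ω)]

lemma IsMart.martingale [CompleteSpace B] {Ω : Type*} [Fintype Ω] {w : Ω → ℝ}
    (hw : ∀ ω, 0 ≤ w ω) {r : ℕ → Setoid Ω} (hr : Antitone r) {f : ℕ → Ω → B}
    (hf : IsMart w r f) :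
    @Martingale Ω B ℕ _ ⊤ _ _ f (setoidFiltration r hr) (finMeasure w) := by
  classical
  let _ : MeasurableSpace Ω := ⊤
  refine martingale_nat (fun n => (hf.meas n).stronglyMeasurable hr)
    (fun n => Integrable.of_finite) fun n => ?_
  refine ae_eq_condExp_of_forall_setIntegral_eq ((setoidFiltration r hr).le n)
    Integrable.of_finite (fun s _ _ => Integrable.of_finite) (fun s hs _ => ?_)
    ((hf.meas n).stronglyMeasurable hr).aestronglyMeasurable
  rw [← integral_indicator ((setoidFiltration r hr).le n s hs),
    ← integral_indicator ((setoidFiltration r hr).le n s hs),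
    integral_finMeasure hw, integral_finMeasure hw, eq_comm, ← sub_eq_zero,
    ← Finset.sum_sub_distrib]
  refine Eq.trans (Finset.sum_congr rfl fun ω _ => ?_)
    (hf.sum_eq n (fun ω => if ω ∈ s then 1 else 0)
    (fun a b hab => by
      have := isMeas_of_measurableSet hr hs hab
      simp only [this]))
  by_cases h : ω ∈ s
  · simp [h, smul_sub]
  · simp [h]

lemma eLpNorm_finMeasure {Ω : Type*} [Fintype Ω] {w : Ω → ℝ} (hw : ∀ ω, 0 ≤ w ω) {p : ℝ≥0∞}
    (hp : p ≠ 0) (hp' : p ≠ ∞) {F : Type*} [ENorm F] (X : Ω → F) (Y : Ω → ℝ)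
    (hY : ∀ ω, 0 ≤ Y ω) (hXY : ∀ ω, ‖X ω‖ₑ = ENNReal.ofReal (Y ω)) :
    (@eLpNorm Ω F _ ⊤ X p (finMeasure w)) ^ p.toReal
      = ENNReal.ofReal (∑ ω, w ω * Y ω ^ p.toReal) := by
  let _ : MeasurableSpace Ω := ⊤
  have hp0 : 0 < p.toReal := ENNReal.toReal_pos hp hp'
  rw [eLpNorm_eq_lintegral_rpow_enorm_toReal hp hp', ← ENNReal.rpow_mul,
    one_div_mul_cancel hp0.ne', ENNReal.rpow_one, lintegral_finMeasure,
    ENNReal.ofReal_sum_of_nonneg fun ω _ => mul_nonneg (hw ω) (Real.rpow_nonneg (hY ω) _)]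
  refine Finset.sum_congr rfl fun ω _ => ?_
  rw [hXY, ENNReal.ofReal_rpow_of_nonneg (hY ω) hp0.le, ENNReal.ofReal_mul (hw ω), mul_comm]

lemma blockMax_id {F : Type*} [NormedAddCommGroup F] (a : ℕ → F) (i : ℕ) :
    blockMax id a i = ‖a (i + 1) - a i‖ := by
  refine le_antisymm (blockMax_le i.le_succ fun n h1 h2 => ?_)
    (norm_sub_le_blockMax (t := id) a i.le_succ le_rfl)
  simp only [id] at h1 h2
  rcases Nat.eq_or_lt_of_le h1 with rfl | h3
  · simp
  · rw [show n = i + 1 by omega]; rfl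

lemma IsMart.stopped {Ω : Type*} [Fintype Ω] {w : Ω → ℝ} {r : ℕ → Setoid Ω} (hr : Antitone r)
    {f : ℕ → Ω → B} (hf : IsMart w r f) (L : ℕ) : IsMart w r (fun n => f (min n L)) where
  meas n := (hf.meas _).mono (hr (min_le_left n L))
  sum_eq n u hu := by
    rcases lt_or_ge n L with h | h
    · rw [min_eq_left h.le, min_eq_left (Nat.succ_le_of_lt h)]
      exact hf.sum_eq n u hu
    · rw [min_eq_right h, min_eq_right (h.trans n.le_succ)]
      simp

/-- Conditional expectations are contractions of `L^p`. -/
lemma IsMart.sum_norm_rpow_le {Ω : Type*} [Fintype Ω] {w : Ω → ℝ} {r : ℕ → Setoid Ω}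
    (hw : ∀ ω, 0 ≤ w ω) (hr : Antitone r) {f : ℕ → Ω → B} (hf : IsMart w r f) {p : ℝ}
    (hp : 1 < p) {n L : ℕ} (hnL : n ≤ L) :
    ∑ ω, w ω * ‖f n ω‖ ^ p ≤ ∑ ω, w ω * ‖f L ω‖ ^ p := by
  have h1 := hf.sum_norm_le hw hr hnL (u := fun ω => ‖f n ω‖ ^ (p - 1))
    ((hf.meas n).comp (fun x => ‖x‖ ^ (p - 1))) (fun ω => by positivity)
  have h2 := sum_rpow_le_of_sum_mul_rpow_le hw (fun ω => norm_nonneg (f n ω))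
    (fun ω => norm_nonneg (f L ω)) hp zero_le_one (by
      rw [one_mul]
      convert h1 using 2 with ω _ ω _
      · rw [mul_assoc, ← Real.rpow_add_one' (norm_nonneg _) (by linarith)]
        congr 2; ring
      · ring)
  simpa using h2

/-- Martingale cotype bounds the increments of martingales on finite weighted sets. -/
lemma HasMartingaleCotype.exists_blockBound_id [CompleteSpace B] {q : ℝ} (hq : 1 ≤ q)
    (hB : HasMartingaleCotype B q) :
    ∃ p C : ℝ, 1 < p ∧ 0 ≤ C ∧ ∀ m, BlockBound B q id m p C := by
  obtain ⟨p, hp1, hp, C, h⟩ := hB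
  have hp0 : p ≠ 0 := (zero_lt_one.trans hp1).ne'
  have hpr : 1 < p.toReal := by
    have := (ENNReal.toReal_lt_toReal ENNReal.one_ne_top hp.ne).mpr hp1
    simpa using this
  refine ⟨p.toReal, (C : ℝ) ^ p.toReal, hpr, by positivity, ?_⟩
  intro m Ω _ w r f hw hr hf L hL
  by_cases hW : ∑ ω, w ω = 0
  · have h0 := fun ω => (Finset.sum_eq_zero_iff_of_nonneg (fun ω _ => hw ω)).mp hW ω
      (Finset.mem_univ ω)
    simp [h0]
  have hW0 : 0 < ∑ ω, w ω := lt_of_le_of_ne (Finset.sum_nonneg fun ω _ => hw ω) (Ne.symm hW)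
  set W := ∑ ω, w ω with hWdef
  -- the weights are normalised to a probability measure
  set v : Ω → ℝ := fun ω => w ω / W with hv
  have hv0 : ∀ ω, 0 ≤ v ω := fun ω => div_nonneg (hw ω) hW0.le
  have hfv : IsMart v r f := ⟨hf.meas, fun n u hu => by
    have := congrArg (fun x => W⁻¹ • x) (hf.sum_eq n u hu)
    simp only [Finset.smul_sum, smul_smul, smul_zero] at this
    rw [← this]
    refine Finset.sum_congr rfl fun ω _ => ?_
    congr 1
    simp only [hv]; ring⟩
  have hfs := hfv.stopped hr m
  let _ : MeasurableSpace Ω := ⊤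
  have hprob : IsProbabilityMeasure (finMeasure v) := by
    refine ⟨?_⟩
    rw [← setLIntegral_one, Measure.restrict_univ, lintegral_finMeasure]
    simp_rw [one_mul]
    rw [← ENNReal.ofReal_sum_of_nonneg fun ω _ => hv0 ω, ← Finset.sum_div, div_self hW,
      ENNReal.ofReal_one]
  have hn : ∀ n, (eLpNorm (f n) p (finMeasure v)) ^ p.toReal
      = ENNReal.ofReal (∑ ω, v ω * ‖f n ω‖ ^ p.toReal) := fun n =>
    eLpNorm_finMeasure hv0 hp0 hp.ne _ _ (fun ω => norm_nonneg _) fun ω => (ofReal_norm _).symm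
  have hsup : (⨆ n, eLpNorm (f (min n m)) p (finMeasure v)) ≤ eLpNorm (f L) p (finMeasure v) := by
    refine iSup_le fun n => ?_
    rw [← ENNReal.rpow_le_rpow_iff (z := p.toReal) (by linarith), hn, hn]
    exact ENNReal.ofReal_le_ofReal
      (hfv.sum_norm_rpow_le hv0 hr hpr ((min_le_right n m).trans hL))
  have hfin : eLpNorm (f L) p (finMeasure v) < ∞ := by
    have h1 : (eLpNorm (f L) p (finMeasure v)) ^ p.toReal < ∞ := by
      rw [hn]; exact ENNReal.ofReal_lt_top
    exact (ENNReal.rpow_lt_top_iff_of_pos (by linarith)).mp h1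
  have key := h Ω ⊤ (finMeasure v) (setoidFiltration r hr) (fun n => f (min n m))
    (hfs.martingale hv0 hr) (hsup.trans_lt hfin)
  have hS : ∀ ω, ‖(∑' n, ‖f (min (n + 1) m) ω - f (min n m) ω‖ₑ ^ q) ^ (1 / q)‖ₑ
      = ENNReal.ofReal (blockVar q id m (fun n => f n ω)) := by
    intro ω
    have hq0 : 0 < q := by linarith
    rw [enorm_eq_self, tsum_eq_sum (s := Finset.range m), blockVar,
      ← ENNReal.ofReal_rpow_of_nonneg (Finset.sum_nonneg fun i _ =>
        Real.rpow_nonneg (blockMax_nonneg _ _ _) _) (by positivity),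
      ENNReal.ofReal_sum_of_nonneg fun i _ => Real.rpow_nonneg (blockMax_nonneg _ _ _) _]
    · congr 1
      refine Finset.sum_congr rfl fun n hn => ?_
      have hn' := Finset.mem_range.mp hn
      rw [min_eq_left hn'.le, min_eq_left (Nat.succ_le_of_lt hn'), blockMax_id,
        ← ENNReal.ofReal_rpow_of_nonneg (norm_nonneg _) hq0.le, ofReal_norm]
    · intro n hn
      have hn' : m ≤ n := by simpa using hn
      rw [min_eq_right hn', min_eq_right (hn'.trans n.le_succ), sub_self, enorm_zero,
        ENNReal.zero_rpow_of_pos hq0]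
  have h1 := ENNReal.rpow_le_rpow (key.trans (mul_le_mul_right hsup _))
    (ENNReal.toReal_nonneg (a := p))
  rw [ENNReal.mul_rpow_of_nonneg _ _ ENNReal.toReal_nonneg, hn,
    eLpNorm_finMeasure hv0 hp0 hp.ne _ _ (fun ω => blockVar_nonneg q id m (fun n => f n ω)) hS,
    ← ENNReal.ofReal_coe_nnreal, ENNReal.ofReal_rpow_of_nonneg C.coe_nonneg ENNReal.toReal_nonneg,
    ← ENNReal.ofReal_mul (by positivity), ENNReal.ofReal_le_ofReal_iff (mul_nonneg (by positivity)
      (Finset.sum_nonneg fun ω _ => mul_nonneg (hv0 ω) (by positivity)))] at h1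
  have e : ∀ X : Ω → ℝ, ∑ ω, w ω * X ω = W * ∑ ω, v ω * X ω := fun X => by
    rw [Finset.mul_sum]
    refine Finset.sum_congr rfl fun ω _ => ?_
    simp only [hv]; field_simp
  rw [e, e, mul_left_comm]
  exact mul_le_mul_of_nonneg_left h1 hW0.le

/-- Martingale cotype `q` bounds the block variation in every `L^p`, `1 < p < ∞`, uniformly over
all choices of blocks. -/
theorem HasMartingaleCotype.exists_blockBound [CompleteSpace B] {q : ℝ} (hq : 1 < q)
    (hB : HasMartingaleCotype B q) {p : ℝ} (hp : 1 < p) :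
    ∃ C : ℝ, 0 ≤ C ∧ ∀ (t : ℕ → ℕ) (m : ℕ), Monotone t → BlockBound B q t m p C := by
  obtain ⟨p₀, C₀, hp₀, hC₀, h₀⟩ := hB.exists_blockBound_id hq.le
  have hq1 : 0 < q - 1 := by linarith
  obtain ⟨C₁, hC₁, h₁⟩ := BlockBound.extrapolate (E := B) (zero_lt_one.trans hp₀) hC₀ hq
  obtain ⟨C₂, hC₂, h₂⟩ := BlockBound.extrapolate (E := B) (zero_lt_one.trans hq)
    (show 0 ≤ (q / (q - 1)) ^ q * C₁ by positivity) hp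
  exact ⟨C₂, hC₂, fun t m ht => h₂ q t m hq.le ht
    ((h₁ q id m hq.le monotone_id (h₀ m)).of_id hq ht)⟩

end Cotype

/-! ### Deviations from Cesàro means -/

section Cesaro

variable {E : Type*} [NormedAddCommGroup E] [NormedSpace ℝ E]

/-- The deviation `e_n - (1/n) ∑_{k = 1}^n e_k` of a sequence from its Cesàro mean. -/
noncomputable def avgDev (e : ℕ → E) (n : ℕ) : E :=
  e n - (n : ℝ)⁻¹ • ∑ k ∈ Finset.range n, e (k + 1)

/-- The discrete square function `(∑_{n = 1}^N (1/n) ‖e_n - (1/n) ∑_{k = 1}^n e_k‖^q)^{1/q}`. -/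
noncomputable def sqSum (q : ℝ) (N : ℕ) (e : ℕ → E) : ℝ :=
  (∑ n ∈ Finset.range N, ((n : ℝ) + 1)⁻¹ * ‖avgDev e (n + 1)‖ ^ q) ^ (1 / q)

lemma avgDev_add (e e' : ℕ → E) (n : ℕ) :
    avgDev (fun k => e k + e' k) n = avgDev e n + avgDev e' n := by
  simp only [avgDev, Finset.sum_add_distrib, smul_add]
  abel

lemma avgDev_smul (c : ℝ) (e : ℕ → E) (n : ℕ) :
    avgDev (fun k => c • e k) n = c • avgDev e n := by
  simp only [avgDev, ← Finset.smul_sum, smul_sub, smul_comm c]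

lemma avgDev_one (e : ℕ → E) : avgDev e 1 = 0 := by simp [avgDev]

lemma sqSum_nonneg (q : ℝ) (N : ℕ) (e : ℕ → E) : 0 ≤ sqSum q N e :=
  Real.rpow_nonneg (Finset.sum_nonneg fun _ _ => by positivity) _

lemma sqSum_eq (q : ℝ) (hq : 1 ≤ q) (N : ℕ) (e : ℕ → E) : sqSum q N e
    = (∑ n ∈ Finset.range N, (((n : ℝ) + 1)⁻¹ ^ (1 / q) * ‖avgDev e (n + 1)‖) ^ q) ^ (1 / q) := by
  unfold sqSum
  congr 1
  refine Finset.sum_congr rfl fun n _ => ?_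
  rw [Real.mul_rpow (by positivity) (norm_nonneg _), ← Real.rpow_mul (by positivity),
    one_div_mul_cancel (by linarith), Real.rpow_one]

lemma sqSum_add_le {q : ℝ} (hq : 1 ≤ q) (N : ℕ) (e e' : ℕ → E) :
    sqSum q N (fun k => e k + e' k) ≤ sqSum q N e + sqSum q N e' := by
  simp_rw [sqSum_eq q hq]
  refine le_trans ?_ (Real.Lp_add_le_of_nonneg _
    (f := fun n : ℕ => ((n : ℝ) + 1)⁻¹ ^ (1 / q) * ‖avgDev e (n + 1)‖)
    (g := fun n : ℕ => ((n : ℝ) + 1)⁻¹ ^ (1 / q) * ‖avgDev e' (n + 1)‖) hq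
    (fun n _ => mul_nonneg (by positivity) (norm_nonneg _))
    (fun n _ => mul_nonneg (by positivity) (norm_nonneg _)))
  refine Real.rpow_le_rpow (Finset.sum_nonneg fun _ _ => by positivity)
    (Finset.sum_le_sum fun n _ => ?_) (by positivity)
  refine Real.rpow_le_rpow (by positivity) ?_ (by linarith)
  rw [avgDev_add, ← mul_add]
  exact mul_le_mul_of_nonneg_left (norm_add_le _ _) (by positivity)

lemma sqSum_smul {q : ℝ} (hq : 1 ≤ q) (N : ℕ) {c : ℝ} (hc : 0 ≤ c) (e : ℕ → E) :
    sqSum q N (fun k => c • e k) = c * sqSum q N e := by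
  have h1 : ∀ n : ℕ, ((n : ℝ) + 1)⁻¹ * ‖avgDev (fun k => c • e k) (n + 1)‖ ^ q
      = c ^ q * (((n : ℝ) + 1)⁻¹ * ‖avgDev e (n + 1)‖ ^ q) := fun n => by
    rw [avgDev_smul, norm_smul, Real.norm_of_nonneg hc, Real.mul_rpow hc (norm_nonneg _)]; ring
  unfold sqSum
  simp_rw [h1]
  rw [← Finset.mul_sum, Real.mul_rpow (by positivity)
    (Finset.sum_nonneg fun _ _ => by positivity), ← Real.rpow_mul hc,
    mul_one_div_cancel (by linarith), Real.rpow_one]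

lemma sqSum_zero {q : ℝ} (hq : 1 ≤ q) (N : ℕ) : sqSum q N (fun _ => (0 : E)) = 0 := by
  have := sqSum_smul hq N le_rfl (fun _ => (0 : E))
  simpa using this

lemma sqSum_sum_smul_le {q : ℝ} (hq : 1 ≤ q) (N : ℕ) {ι : Type*} (s : Finset ι) {c : ι → ℝ}
    (hc : ∀ i, 0 ≤ c i) (e : ι → ℕ → E) :
    sqSum q N (fun k => ∑ i ∈ s, c i • e i k) ≤ ∑ i ∈ s, c i * sqSum q N (e i) := by
  classical
  induction s using Finset.induction_on with
  | empty => simp [sqSum_zero hq]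
  | insert i s hi ih =>
    simp only [Finset.sum_insert hi]
    refine (sqSum_add_le hq N _ _).trans ?_
    rw [sqSum_smul hq N (hc i)]
    gcongr

/-- The deviations from Cesàro means are controlled by the oscillations over dyadic blocks. With
`Y_i` the average of `‖e_k - e_{2^i}‖` over `k ≤ 2^i` one has `Y_{i + 1} ≤ Y_i / 2 + D_i`, and on
the block `2^i < n ≤ 2^{i + 1}` the deviation is at most `D_i + 2 Y_{i + 1}`. -/
lemma sum_avgDev_rpow_le {q : ℝ} (hq : 1 ≤ q) (e : ℕ → E) (D : ℕ → ℝ) (M : ℕ)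
    (hD0 : ∀ i < M, 0 ≤ D i)
    (hD : ∀ i < M, ∀ n, 2 ^ i ≤ n → n ≤ 2 ^ (i + 1) → ‖e n - e (2 ^ (i + 1))‖ ≤ D i) :
    ∑ n ∈ Finset.range (2 ^ M), ((n : ℝ) + 1)⁻¹ * ‖avgDev e (n + 1)‖ ^ q
      ≤ 2 ^ q * (1 + 2 ^ q * 2 ^ q) * ∑ i ∈ Finset.range M, D i ^ q := by
  have hq0 : 0 < q := by linarith
  set Y : ℕ → ℝ := fun i => ((2 : ℝ) ^ i)⁻¹ * ∑ k ∈ Finset.range (2 ^ i), ‖e (k + 1) - e (2 ^ i)‖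
    with hY
  have hY0 : ∀ i, 0 ≤ Y i := fun i => by simp only [hY]; positivity
  have hYs : ∀ i < M, Y (i + 1) ≤ (Y i + 2 * D i) / 2 := by
    intro i hi
    have h1 : ∑ k ∈ Finset.range (2 ^ (i + 1)), ‖e (k + 1) - e (2 ^ (i + 1))‖
        ≤ (∑ k ∈ Finset.range (2 ^ i), ‖e (k + 1) - e (2 ^ i)‖) + 2 ^ i * D i + 2 ^ i * D i := by
      have h2 : (2 : ℕ) ^ (i + 1) = 2 ^ i + 2 ^ i := by ring
      rw [show Finset.range (2 ^ (i + 1)) = Finset.range (2 ^ i + 2 ^ i) by rw [h2],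
        Finset.sum_range_add]
      refine add_le_add ?_ ?_
      · have : (2 : ℝ) ^ i * D i = ∑ k ∈ Finset.range (2 ^ i), D i := by simp
        rw [this, ← Finset.sum_add_distrib]
        refine Finset.sum_le_sum fun k _ => ?_
        refine (norm_sub_le_norm_sub_add_norm_sub _ (e (2 ^ i)) _).trans (add_le_add le_rfl ?_)
        exact hD i hi _ le_rfl (Nat.pow_le_pow_right two_pos i.le_succ)
      · have : (2 : ℝ) ^ i * D i = ∑ k ∈ Finset.range (2 ^ i), D i := by simp
        rw [this]
        refine Finset.sum_le_sum fun k hk => ?_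
        have := Finset.mem_range.mp hk
        have h3 : (2 : ℕ) ^ (i + 1) = 2 ^ i + 2 ^ i := by ring
        exact hD i hi _ (by omega) (by omega)
    have h3 : (0 : ℝ) < 2 ^ i := by positivity
    have h4 := mul_le_mul_of_nonneg_left h1 (show (0 : ℝ) ≤ ((2 : ℝ) ^ (i + 1))⁻¹ by positivity)
    refine h4.trans (le_of_eq ?_)
    simp only [hY]
    rw [pow_succ]
    field_simp
    ring
  -- convexity of `x ^ q` turns the recursion into one which telescopes after summation
  have hYq : ∀ i < M, 2 * Y (i + 1) ^ q ≤ Y i ^ q + 2 ^ q * D i ^ q := by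
    intro i hi
    have h1 := Real.rpow_le_rpow (hY0 _) (hYs i hi) hq0.le
    have h2 := (convexOn_rpow hq).2 (mem_Ici.mpr (hY0 i))
      (mem_Ici.mpr (mul_nonneg two_pos.le (hD0 i hi))) (show (0 : ℝ) ≤ 1 / 2 by norm_num)
      (show (0 : ℝ) ≤ 1 / 2 by norm_num) (by norm_num)
    simp only [smul_eq_mul] at h2
    rw [Real.mul_rpow two_pos.le (hD0 i hi)] at h2
    have h3 : (Y i + 2 * D i) / 2 = 1 / 2 * Y i + 1 / 2 * (2 * D i) := by ring
    rw [h3] at h1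
    linarith
  have hstep : ∀ i < M, ∑ n ∈ Finset.range (2 ^ i),
      (((2 ^ i + n : ℕ) : ℝ) + 1)⁻¹ * ‖avgDev e (2 ^ i + n + 1)‖ ^ q
        ≤ 2 ^ q * (D i ^ q + 2 ^ q * Y (i + 1) ^ q) := by
    intro i hi
    have h0 : (0 : ℝ) < 2 ^ i := by positivity
    have h1 : ∀ n ∈ Finset.range (2 ^ i), ‖avgDev e (2 ^ i + n + 1)‖ ≤ D i + 2 * Y (i + 1) := by
      intro n hn
      have hn' := Finset.mem_range.mp hn
      set k := 2 ^ i + n + 1 with hk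
      have hk2 : k ≤ 2 ^ (i + 1) := by rw [pow_succ]; omega
      have hk0 : (k : ℝ) ≠ 0 := by rw [hk]; positivity
      have e1 : avgDev e k = (e k - e (2 ^ (i + 1)))
          - (k : ℝ)⁻¹ • ∑ l ∈ Finset.range k, (e (l + 1) - e (2 ^ (i + 1))) := by
        rw [Finset.sum_sub_distrib, smul_sub, Finset.sum_const, Finset.card_range,
          ← Nat.cast_smul_eq_nsmul ℝ, smul_smul, inv_mul_cancel₀ hk0, one_smul, avgDev]
        abel
      rw [e1]
      refine (norm_sub_le _ _).trans (add_le_add (hD i hi k (by omega) hk2) ?_)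
      rw [norm_smul, Real.norm_of_nonneg (by positivity)]
      have e2 : ‖∑ l ∈ Finset.range k, (e (l + 1) - e (2 ^ (i + 1)))‖
          ≤ ∑ l ∈ Finset.range (2 ^ (i + 1)), ‖e (l + 1) - e (2 ^ (i + 1))‖ :=
        (norm_sum_le _ _).trans (Finset.sum_le_sum_of_subset_of_nonneg (Finset.range_mono hk2)
          fun _ _ _ => norm_nonneg _)
      have e3 : (k : ℝ)⁻¹ ≤ ((2 : ℝ) ^ i)⁻¹ := by
        refine inv_anti₀ h0 ?_
        rw [hk]; push_cast
        linarith [(n.cast_nonneg : (0 : ℝ) ≤ n)]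
      calc _ ≤ ((2 : ℝ) ^ i)⁻¹ * ∑ l ∈ Finset.range (2 ^ (i + 1)), ‖e (l + 1) - e (2 ^ (i + 1))‖ :=
            mul_le_mul e3 e2 (norm_nonneg _) (by positivity)
        _ = 2 * Y (i + 1) := by
            simp only [hY]
            rw [pow_succ (2 : ℝ)]
            field_simp
    have h2 : ∀ n ∈ Finset.range (2 ^ i),
        (((2 ^ i + n : ℕ) : ℝ) + 1)⁻¹ * ‖avgDev e (2 ^ i + n + 1)‖ ^ q
          ≤ ((2 : ℝ) ^ i)⁻¹ * (2 ^ q * (D i ^ q + 2 ^ q * Y (i + 1) ^ q)) := by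
      intro n hn
      refine mul_le_mul ?_ ?_ (by positivity) (by positivity)
      · refine inv_anti₀ h0 ?_
        push_cast
        linarith [(n.cast_nonneg : (0 : ℝ) ≤ n)]
      · refine (Real.rpow_le_rpow (norm_nonneg _) (h1 n hn) hq0.le).trans ?_
        rw [← Real.mul_rpow two_pos.le (hY0 _)]
        exact Real.add_rpow_le_two_rpow_mul (hD0 i hi) (mul_nonneg two_pos.le (hY0 _)) hq0.le
    refine (Finset.sum_le_sum h2).trans (le_of_eq ?_)
    rw [Finset.sum_const, Finset.card_range, nsmul_eq_mul]
    push_cast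
    field_simp
  have hYsum : ∀ m ≤ M, ∑ i ∈ Finset.range m, Y (i + 1) ^ q + Y m ^ q
      ≤ 2 ^ q * ∑ i ∈ Finset.range m, D i ^ q := by
    intro m
    induction m with
    | zero => intro _; simp [hY, Real.zero_rpow hq0.ne']
    | succ m ih =>
      intro hm
      have h1 := ih (Nat.le_of_succ_le hm)
      have h2 := hYq m hm
      rw [Finset.sum_range_succ, Finset.sum_range_succ, mul_add]
      linarith
  have htotal : ∀ m ≤ M, ∑ n ∈ Finset.range (2 ^ m), ((n : ℝ) + 1)⁻¹ * ‖avgDev e (n + 1)‖ ^ q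
      ≤ 2 ^ q * ∑ i ∈ Finset.range m, (D i ^ q + 2 ^ q * Y (i + 1) ^ q) := by
    intro m
    induction m with
    | zero => intro _; simp [avgDev_one, Real.zero_rpow hq0.ne']
    | succ m ih =>
      intro hm
      have h2 : (2 : ℕ) ^ (m + 1) = 2 ^ m + 2 ^ m := by ring
      rw [h2, Finset.sum_range_add, Finset.sum_range_succ, mul_add]
      exact add_le_add (ih (Nat.le_of_succ_le hm)) (hstep m hm)
  refine (htotal M le_rfl).trans ?_
  rw [Finset.sum_add_distrib, ← Finset.mul_sum, mul_assoc]
  refine mul_le_mul_of_nonneg_left ?_ (by positivity)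
  have h1 := hYsum M le_rfl
  have h2 : 0 ≤ Y M ^ q := Real.rpow_nonneg (hY0 M) q
  have h3 : ∑ i ∈ Finset.range M, Y (i + 1) ^ q ≤ 2 ^ q * ∑ i ∈ Finset.range M, D i ^ q := by
    linarith
  have h4 := mul_le_mul_of_nonneg_left h3 (show (0 : ℝ) ≤ 2 ^ q by positivity)
  linarith

end Cesaro

/-! ### Finite reversible Markov chains -/

section Chain

variable {I : Type*} [Fintype I] {E : Type*} [NormedAddCommGroup E] [NormedSpace ℝ E]

/-- The operator with kernel `K` on vector-valued functions on a finite set. -/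
def chainOp (K : I → I → ℝ) (b : I → E) (i : I) : E := ∑ j, K i j • b j

/-- The weight of the path `y` of a Markov chain with initial weights `w` and transition
probabilities `K`. -/
def pathWeight (w : I → ℝ) (K : I → I → ℝ) {N : ℕ} (y : Fin (N + 1) → I) : ℝ :=
  w (y 0) * ∏ k : Fin N, K (y k.castSucc) (y k.succ)

/-- Two paths are equivalent at time `n` if they agree up to time `n`. -/
def historySetoid (I : Type*) (N : ℕ) (n : ℕ) : Setoid (Fin (N + 1) → I) where
  r y z := ∀ j : Fin (N + 1), j.val ≤ n → y j = z j
  iseqv := ⟨fun _ _ _ => rfl, fun h j hj => (h j hj).symm,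
    fun h h' j hj => (h j hj).trans (h' j hj)⟩

lemma antitone_historySetoid (I : Type*) (N : ℕ) : Antitone (historySetoid I N) :=
  fun _ _ hmn _ _ h j hj => h j (hj.trans hmn)

/-- The position of a path at time `k`, the time being cut off at `N`. -/
def pathAt {N : ℕ} (k : ℕ) (y : Fin (N + 1) → I) : I :=
  y ⟨min k N, Nat.lt_succ_of_le (min_le_right k N)⟩

omit [Fintype I] in
lemma pathAt_snoc_of_le {N k : ℕ} (hk : k ≤ N) (y : Fin (N + 1) → I) (j : I) :
    pathAt (N := N + 1) k (Fin.snoc y j : Fin (N + 2) → I) = pathAt k y := by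
  unfold pathAt
  have : (⟨min k (N + 1), Nat.lt_succ_of_le (min_le_right k (N + 1))⟩ : Fin (N + 2))
      = Fin.castSucc ⟨min k N, Nat.lt_succ_of_le (min_le_right k N)⟩ := by
    ext; simp; omega
  rw [this, Fin.snoc_castSucc (α := fun _ => I)]

omit [Fintype I] in
lemma pathAt_snoc_self {N k : ℕ} (hk : N < k) (y : Fin (N + 1) → I) (j : I) :
    pathAt (N := N + 1) k (Fin.snoc y j : Fin (N + 2) → I) = j := by
  unfold pathAt
  have : (⟨min k (N + 1), Nat.lt_succ_of_le (min_le_right k (N + 1))⟩ : Fin (N + 2))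
      = Fin.last (N + 1) := by
    ext; simp; omega
  rw [this, Fin.snoc_last (α := fun _ => I)]

omit [Fintype I] in
lemma pathWeight_snoc (w : I → ℝ) (K : I → I → ℝ) {N : ℕ} (y : Fin (N + 1) → I) (j : I) :
    pathWeight (N := N + 1) w K (Fin.snoc y j : Fin (N + 2) → I)
      = pathWeight w K y * K (pathAt N y) j := by
  unfold pathWeight
  rw [Fin.prod_univ_castSucc, ← mul_assoc]
  congr 2
  · congr 1
    funext k
    rw [Fin.snoc_castSucc (α := fun _ => I), Fin.succ_castSucc,
      Fin.snoc_castSucc (α := fun _ => I)]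
  · rw [Fin.snoc_castSucc (α := fun _ => I)]
    unfold pathAt
    congr 1
    ext; simp
  · rw [Fin.succ_last, Fin.snoc_last (α := fun _ => I)]

lemma sum_path_succ {F : Type*} [AddCommMonoid F] {N : ℕ} (G : (Fin (N + 2) → I) → F) :
    ∑ y, G y = ∑ y : Fin (N + 1) → I, ∑ j, G (Fin.snoc y j : Fin (N + 2) → I) := by
  rw [← (Fin.snocEquiv (fun _ : Fin (N + 2) => I)).sum_comp, Fintype.sum_prod_type,
    Finset.sum_comm]
  rfl

lemma sum_path_zero {F : Type*} [AddCommMonoid F] (G : (Fin 1 → I) → F) :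
    ∑ y, G y = ∑ i, G (fun _ => i) := by
  rw [← (Equiv.funUnique (Fin 1) I).symm.sum_comp]
  rfl

omit [Fintype I] in
lemma pathWeight_nonneg {w : I → ℝ} {K : I → I → ℝ} (hw : ∀ i, 0 ≤ w i) (hK : ∀ i j, 0 ≤ K i j)
    {N : ℕ} (y : Fin (N + 1) → I) : 0 ≤ pathWeight w K y :=
  mul_nonneg (hw _) (Finset.prod_nonneg fun _ _ => hK _ _)

/-- The Markov property. -/
lemma sum_pathWeight_smul_sub {K : I → I → ℝ} (hK1 : ∀ i, ∑ j, K i j = 1) (w : I → ℝ) (g : I → E)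
    (k : ℕ) {N : ℕ} (hk : k < N) {u : (Fin (N + 1) → I) → ℝ} (hu : IsMeas (historySetoid I N k) u) :
    ∑ y, (pathWeight w K y * u y) • (g (pathAt (k + 1) y) - chainOp K g (pathAt k y)) = 0 := by
  induction N with
  | zero => omega
  | succ N ih =>
    -- the value of `u` does not depend on the last position
    have hu' : ∀ (y : Fin (N + 1) → I) (j : I), u (Fin.snoc y j : Fin (N + 2) → I)
        = u (Fin.snoc y (pathAt N y) : Fin (N + 2) → I) := by
      intro y j
      refine hu fun l hl => ?_
      have hlN : l.val < N + 1 := by omega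
      have : l = Fin.castSucc ⟨l.val, hlN⟩ := rfl
      rw [this, Fin.snoc_castSucc (α := fun _ => I), Fin.snoc_castSucc (α := fun _ => I)]
    rw [sum_path_succ]
    rcases Nat.lt_or_ge k N with h | h
    · have h1 := ih h (u := fun y => u (Fin.snoc y (pathAt N y) : Fin (N + 2) → I))
        (fun y z hyz => by
          simp only
          rw [← hu' y (pathAt N z)]
          refine hu fun l hl => ?_
          have hlN : l.val < N + 1 := by omega
          have : l = Fin.castSucc ⟨l.val, hlN⟩ := rfl
          rw [this, Fin.snoc_castSucc (α := fun _ => I), Fin.snoc_castSucc (α := fun _ => I)]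
          exact hyz _ hl)
      rw [← h1]
      refine Finset.sum_congr rfl fun y _ => ?_
      simp_rw [pathWeight_snoc, hu', pathAt_snoc_of_le h.le,
        pathAt_snoc_of_le (show k + 1 ≤ N from h)]
      rw [← Finset.sum_smul]
      congr 1
      simp_rw [mul_assoc]
      rw [← Finset.mul_sum, ← Finset.sum_mul, hK1, one_mul]
    · have hkN : k = N := by omega
      subst hkN
      refine Finset.sum_eq_zero fun y _ => ?_
      simp_rw [pathWeight_snoc, hu', pathAt_snoc_of_le le_rfl, pathAt_snoc_self k.lt_succ_self,
        smul_sub]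
      rw [Finset.sum_sub_distrib, ← Finset.sum_smul]
      have h1 : ∑ j, pathWeight w K y * K (pathAt k y) j
          * u (Fin.snoc y (pathAt k y) : Fin (k + 2) → I)
          = pathWeight w K y * u (Fin.snoc y (pathAt k y) : Fin (k + 2) → I) := by
        simp_rw [mul_assoc]
        rw [← Finset.mul_sum, ← Finset.sum_mul, hK1, one_mul]
      rw [h1, chainOp, Finset.smul_sum, sub_eq_zero]
      refine Finset.sum_congr rfl fun j _ => ?_
      rw [smul_smul]
      congr 1
      ring

/-- By reversibility the weights `w` are stationary: they are the distribution of the final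
position. -/
lemma sum_pathWeight_last {K : I → I → ℝ} {w : I → ℝ} (hwK : ∀ i j, w i * K i j = w j * K j i)
    (hK1 : ∀ i, ∑ j, K i j = 1) (N : ℕ) (g : I → E) :
    ∑ y : Fin (N + 1) → I, pathWeight w K y • g (pathAt N y) = ∑ i, w i • g i := by
  induction N generalizing g with
  | zero =>
    rw [sum_path_zero]
    simp [pathWeight, pathAt]
  | succ N ih =>
    rw [sum_path_succ]
    simp_rw [pathWeight_snoc, pathAt_snoc_self N.lt_succ_self, mul_smul, ← Finset.smul_sum]
    rw [ih (fun i => ∑ j, K i j • g j)]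
    simp_rw [Finset.smul_sum, smul_smul]
    rw [Finset.sum_comm]
    refine Finset.sum_congr rfl fun j _ => ?_
    simp_rw [hwK _ j]
    rw [← Finset.sum_smul, ← Finset.mul_sum, hK1, mul_one]

/-- Reversibility says that the transition operator is symmetric. -/
lemma sum_smul_chainOp {K : I → I → ℝ} {w : I → ℝ} (hwK : ∀ i j, w i * K i j = w j * K j i)
    (φ : I → ℝ) (g : I → E) :
    ∑ i, (w i * φ i) • chainOp K g i = ∑ i, (w i * chainOp K φ i) • g i := by
  simp_rw [chainOp, Finset.smul_sum, smul_smul, Finset.mul_sum, Finset.sum_smul]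
  rw [Finset.sum_comm]
  refine Finset.sum_congr rfl fun j _ => Finset.sum_congr rfl fun i _ => ?_
  congr 1
  rw [smul_eq_mul]
  linear_combination φ i * hwK i j

/-- By reversibility, conditioning on the final position is a power of the transition operator. -/
lemma sum_pathWeight_last_mul {K : I → I → ℝ} {w : I → ℝ}
    (hwK : ∀ i j, w i * K i j = w j * K j i) (hK1 : ∀ i, ∑ j, K i j = 1) {k N : ℕ} (hk : k ≤ N)
    (φ : I → ℝ) (g : I → E) :
    ∑ y : Fin (N + 1) → I, (pathWeight w K y * φ (pathAt N y)) • g (pathAt k y)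
      = ∑ i, (w i * φ i) • ((chainOp K)^[N - k] g) i := by
  induction N, hk using Nat.le_induction generalizing φ with
  | base =>
    simp_rw [mul_smul, Nat.sub_self, Function.iterate_zero, id]
    exact sum_pathWeight_last hwK hK1 k (fun i => φ i • g i)
  | succ N hkN ih =>
    rw [sum_path_succ]
    simp_rw [pathWeight_snoc, pathAt_snoc_self N.lt_succ_self, pathAt_snoc_of_le hkN,
      ← Finset.sum_smul, mul_assoc, ← Finset.mul_sum]
    rw [show N + 1 - k = (N - k) + 1 by omega, Function.iterate_succ_apply',
      sum_smul_chainOp hwK, ← ih (chainOp K φ)]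
    rfl

end Chain

/-! ### The square function inequality for Markov chains -/

section ChainBound

variable {E : Type*} [NormedAddCommGroup E] [NormedSpace ℝ E]

lemma sqSum_congr {q : ℝ} {N : ℕ} {e e' : ℕ → E} (h : ∀ n ≤ N, e n = e' n) :
    sqSum q N e = sqSum q N e' := by
  unfold sqSum
  congr 1
  refine Finset.sum_congr rfl fun n hn => ?_
  have hn' := Finset.mem_range.mp hn
  unfold avgDev
  rw [h _ hn', Finset.sum_congr rfl fun k hk => h (k + 1) (by
    have := Finset.mem_range.mp hk
    omega)]

/-- The values `K^{N - k} b` along the path of a Markov chain form a martingale. -/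
lemma isMart_chain {I : Type*} [Fintype I] {K : I → I → ℝ} (hK1 : ∀ i, ∑ j, K i j = 1)
    (w : I → ℝ) (b : I → E) (N : ℕ) :
    IsMart (pathWeight w K) (historySetoid I N)
      (fun k (y : Fin (N + 1) → I) => ((chainOp K)^[N - k] b) (pathAt k y)) where
  meas n y z hyz := by
    have : pathAt n y = pathAt n z := hyz _ (min_le_left n N)
    simp only [this]
  sum_eq n u hu := by
    rcases Nat.lt_or_ge n N with h | h
    · have := sum_pathWeight_smul_sub hK1 w ((chainOp K)^[N - (n + 1)] b) n h hu
      rw [← this]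
      refine Finset.sum_congr rfl fun y _ => ?_
      rw [show N - n = N - (n + 1) + 1 by omega, Function.iterate_succ_apply']
    · refine Finset.sum_eq_zero fun y _ => ?_
      have h1 : N - (n + 1) = N - n := by omega
      have h2 : pathAt (n + 1) y = pathAt n y := by
        unfold pathAt
        congr 1
        ext
        simp only
        omega
      rw [h1, h2, sub_self, smul_zero]

/-- The dyadic block times `N - 2^{M - j}`, `N = 2^M`, seen from the end of the path. -/
lemma sqSum_reverse_le {q : ℝ} (hq : 1 ≤ q) (M : ℕ) (a : ℕ → E) :
    sqSum q (2 ^ M) (fun n => a (2 ^ M - n))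
      ≤ (2 ^ q * (1 + 2 ^ q * 2 ^ q)) ^ (1 / q)
        * blockVar q (fun j => 2 ^ M - 2 ^ (M - j)) M a := by
  set t : ℕ → ℕ := fun j => 2 ^ M - 2 ^ (M - j) with ht
  have h1 := sum_avgDev_rpow_le hq (fun n => a (2 ^ M - n)) (fun i => blockMax t a (M - 1 - i)) M
    (fun i _ => blockMax_nonneg t a _) (fun i hi n hn hn' => by
      have e1 : t (M - 1 - i) = 2 ^ M - 2 ^ (i + 1) := by
        simp only [ht]; congr 2; omega
      have e2 : t (M - 1 - i + 1) = 2 ^ M - 2 ^ i := by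
        simp only [ht]; congr 2; omega
      have := norm_sub_le_blockMax (t := t) a (i := M - 1 - i) (n := 2 ^ M - n)
        (by rw [e1]; omega) (by rw [e2]; omega)
      rwa [e1] at this)
  rw [Finset.sum_range_reflect (fun i => blockMax t a i ^ q)] at h1
  unfold sqSum blockVar
  rw [← Real.mul_rpow (by positivity)
    (Finset.sum_nonneg fun i _ => Real.rpow_nonneg (blockMax_nonneg _ _ _) _)]
  exact Real.rpow_le_rpow (Finset.sum_nonneg fun _ _ => by positivity) h1 (by positivity)

/-- A form of Jensen's inequality for weights `c` of total mass `a`, which may be zero. -/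
lemma mul_rpow_le_sum_mul_rpow {ι : Type*} [Fintype ι] {c U : ι → ℝ} (hc : ∀ y, 0 ≤ c y)
    (hU : ∀ y, 0 ≤ U y) {a S p : ℝ} (hp : 1 ≤ p) (hS : 0 ≤ S) (ha : ∑ y, c y = a)
    (h : a * S ≤ ∑ y, c y * U y) : a * S ^ p ≤ ∑ y, c y * U y ^ p := by
  have ha0 : 0 ≤ a := ha ▸ Finset.sum_nonneg fun y _ => hc y
  rcases ha0.eq_or_lt with h0 | h0
  · rw [← h0, zero_mul]
    exact Finset.sum_nonneg fun y _ => mul_nonneg (hc y) (Real.rpow_nonneg (hU y) _)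
  have h1 := Real.rpow_arith_mean_le_arith_mean_rpow Finset.univ (fun y => c y / a) U
    (fun y _ => div_nonneg (hc y) h0.le) (by rw [← Finset.sum_div, ha, div_self h0.ne'])
    (fun y _ => hU y) hp
  have e : ∀ V : ι → ℝ, ∑ y, c y / a * V y = (∑ y, c y * V y) / a := fun V => by
    rw [Finset.sum_div]
    exact Finset.sum_congr rfl fun y _ => by ring
  rw [e, e] at h1
  have h2 : S ≤ (∑ y, c y * U y) / a := by rw [le_div_iff₀ h0]; linarith
  have h3 := (Real.rpow_le_rpow hS h2 (by linarith)).trans h1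
  rw [le_div_iff₀ h0] at h3
  linarith

variable {B : Type*} [NormedAddCommGroup B] [NormedSpace ℝ B]

/-- The square function inequality for reversible Markov chains, via Rota's dilation: `K^{2n} b` is
the conditional expectation, given the final position, of the martingale `(K^n b)(y_{N - n})`. -/
theorem HasMartingaleCotype.exists_markov_bound [CompleteSpace B] {q : ℝ} (hq : 1 < q)
    (hB : HasMartingaleCotype B q) {p : ℝ} (hp : 1 < p) :
    ∃ C : ℝ, 0 ≤ C ∧ ∀ (I : Type) [Fintype I] (w : I → ℝ) (K : I → I → ℝ), (∀ i, 0 ≤ w i) →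
      (∀ i j, 0 ≤ K i j) → (∀ i j, w i * K i j = w j * K j i) → (∀ i, ∑ j, K i j = 1) →
      ∀ (b : I → B) (M : ℕ),
        ∑ i, w i * sqSum q (2 ^ M) (fun n => ((chainOp K)^[2 * n] b) i) ^ p
          ≤ C * ∑ i, w i * ‖b i‖ ^ p := by
  classical
  obtain ⟨C, hC, h⟩ := hB.exists_blockBound hq hp
  set c : ℝ := (2 ^ q * (1 + 2 ^ q * 2 ^ q)) ^ (1 / q) with hc
  have hc0 : 0 ≤ c := by positivity
  refine ⟨c ^ p * C, by positivity, ?_⟩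
  intro I _ w K hw hK hwK hK1 b M
  set N := 2 ^ M with hN
  set f : ℕ → (Fin (N + 1) → I) → B := fun k y => ((chainOp K)^[N - k] b) (pathAt k y) with hf
  have hfm : IsMart (pathWeight w K) (historySetoid I N) f := isMart_chain hK1 w b N
  have hW0 : ∀ y : Fin (N + 1) → I, 0 ≤ pathWeight w K y := pathWeight_nonneg hw hK
  set U : (Fin (N + 1) → I) → ℝ := fun y => sqSum q N (fun n => f (N - n) y) with hU
  have hU0 : ∀ y, 0 ≤ U y := fun y => sqSum_nonneg _ _ _
  set t : ℕ → ℕ := fun j => 2 ^ M - 2 ^ (M - j) with ht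
  have htm : Monotone t := fun i j hij => by
    have : 2 ^ (M - j) ≤ 2 ^ (M - i) := Nat.pow_le_pow_right two_pos (by omega)
    simp only [ht]
    omega
  have h1 := h t M htm (Fin (N + 1) → I) (pathWeight w K) (historySetoid I N) f hW0
    (antitone_historySetoid I N) hfm N (by simp only [ht]; exact Nat.sub_le _ _)
  have hfN : ∑ y, pathWeight w K y * ‖f N y‖ ^ p = ∑ i, w i * ‖b i‖ ^ p := by
    have := sum_pathWeight_last hwK hK1 N (fun i => ‖b i‖ ^ p)
    simp only [smul_eq_mul] at this
    rw [← this]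
    simp [hf]
  rw [hfN] at h1
  have h2 : ∑ y, pathWeight w K y * U y ^ p ≤ c ^ p * (C * ∑ i, w i * ‖b i‖ ^ p) := by
    refine le_trans ?_ (mul_le_mul_of_nonneg_left h1 (by positivity))
    rw [Finset.mul_sum]
    refine Finset.sum_le_sum fun y _ => ?_
    rw [mul_left_comm, ← Real.mul_rpow hc0 (blockVar_nonneg _ _ _ _)]
    exact mul_le_mul_of_nonneg_left (Real.rpow_le_rpow (hU0 y)
      (sqSum_reverse_le hq.le M (fun n => f n y)) (by linarith)) (hW0 y)
  -- conditional expectation given the final position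
  have h3 : ∀ i, w i * sqSum q N (fun n => ((chainOp K)^[2 * n] b) i) ^ p
      ≤ ∑ y : Fin (N + 1) → I, (pathWeight w K y * if pathAt N y = i then 1 else 0) * U y ^ p := by
    intro i
    have hind : ∀ (v : I → B), ∑ j, (w j * if j = i then 1 else 0) • v j = w i • v i := fun v => by
      rw [Finset.sum_eq_single i] <;> simp +contextual
    have hmass : ∑ y : Fin (N + 1) → I, (pathWeight w K y * if pathAt N y = i then 1 else 0)
        = w i := by
      have := sum_pathWeight_last hwK hK1 N (fun j => if j = i then (1 : ℝ) else 0)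
      simp only [smul_eq_mul] at this
      rw [this, Finset.sum_eq_single i] <;> simp +contextual
    refine mul_rpow_le_sum_mul_rpow (fun y => mul_nonneg (hW0 y) (by split_ifs <;> simp)) hU0
      hp.le (sqSum_nonneg _ _ _) hmass ?_
    rw [← sqSum_smul hq.le N (hw i)]
    refine le_trans (le_of_eq (sqSum_congr fun n hn => ?_)) (sqSum_sum_smul_le hq.le N Finset.univ
      (fun y => mul_nonneg (hW0 y) (by split_ifs <;> simp)) (fun y n => f (N - n) y))
    have := sum_pathWeight_last_mul hwK hK1 (Nat.sub_le N n) (fun j => if j = i then (1 : ℝ) else 0)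
      ((chainOp K)^[n] b)
    rw [hind, Nat.sub_sub_self hn, ← Function.iterate_add_apply, ← two_mul] at this
    rw [← this]
    simp only [hf, Nat.sub_sub_self hn]
  refine (Finset.sum_le_sum fun i _ => h3 i).trans ?_
  rw [Finset.sum_comm, mul_assoc]
  refine le_trans (le_of_eq (Finset.sum_congr rfl fun y _ => ?_)) h2
  simp_rw [← Finset.sum_mul, ← Finset.mul_sum]
  simp

/-- The square function inequality for reversible chains that may lose mass. The chain is extended
by a cemetery of large weight `1/ε`, from which it returns with small probability. -/
theorem HasMartingaleCotype.exists_subMarkov_bound [CompleteSpace B] {q : ℝ} (hq : 1 < q)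
    (hB : HasMartingaleCotype B q) {p : ℝ} (hp : 1 < p) :
    ∃ C : ℝ, 0 ≤ C ∧ ∀ (I : Type) [Fintype I] (w : I → ℝ) (K : I → I → ℝ), (∀ i, 0 ≤ w i) →
      (∀ i j, 0 ≤ K i j) → (∀ i j, w i * K i j = w j * K j i) → (∀ i, ∑ j, K i j ≤ 1) →
      ∀ (b : I → B) (M : ℕ),
        ∑ i, w i * sqSum q (2 ^ M) (fun n => ((chainOp K)^[2 * n] b) i) ^ p
          ≤ C * ∑ i, w i * ‖b i‖ ^ p := by
  obtain ⟨C, hC, h⟩ := hB.exists_markov_bound hq hp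
  refine ⟨C, hC, ?_⟩
  intro I _ w K hw hK hwK hK1 b M
  set κ : I → ℝ := fun i => 1 - ∑ j, K i j with hκ
  have hκ0 : ∀ i, 0 ≤ κ i := fun i => by have := hK1 i; simp only [hκ]; linarith
  set Kε : ℝ → Option I → Option I → ℝ := fun ε x y =>
    match x, y with
    | some i, some j => K i j
    | some i, none => κ i
    | none, some j => ε * (w j * κ j)
    | none, none => 1 - ε * ∑ j, w j * κ j with hKε
  set bo : Option I → B := fun x => x.elim 0 b with hbo
  set S : ℝ := ∑ j, w j * κ j with hS
  have hS0 : 0 ≤ S := Finset.sum_nonneg fun j _ => mul_nonneg (hw j) (hκ0 j)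
  have hbound : ∀ ε : ℝ, 0 < ε → ε * S ≤ 1 →
      ∑ i, w i * sqSum q (2 ^ M) (fun n => ((chainOp (Kε ε))^[2 * n] bo) (some i)) ^ p
        ≤ C * ∑ i, w i * ‖b i‖ ^ p := by
    intro ε hε hεS
    have h1 := h (Option I) (fun x => x.elim ε⁻¹ w) (Kε ε)
      (fun x => by cases x <;> simp [hw, hε.le])
      (fun x y => by
        rcases x with _ | i <;> rcases y with _ | j <;> simp only [hKε]
        · linarith
        · exact mul_nonneg hε.le (mul_nonneg (hw j) (hκ0 j))
        · exact hκ0 i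
        · exact hK i j)
      (fun x y => by
        rcases x with _ | i <;> rcases y with _ | j <;> simp only [hKε, Option.elim]
        · field_simp
        · field_simp
        · exact hwK i j)
      (fun x => by
        rcases x with _ | i <;> rw [Fintype.sum_option] <;> simp only [hKε]
        · rw [← Finset.mul_sum]; ring
        · simp [hκ])
      bo M
    rw [Fintype.sum_option, Fintype.sum_option] at h1
    simp only [Option.elim, hbo, norm_zero, Real.zero_rpow (by linarith : p ≠ 0), mul_zero,
      zero_add] at h1
    refine le_trans (le_add_of_nonneg_left ?_) h1
    exact mul_nonneg (inv_nonneg.mpr hε.le) (Real.rpow_nonneg (sqSum_nonneg _ _ _) _)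
  -- continuity in `ε`, and the value at `ε = 0`
  have hcontK : ∀ x y, Continuous fun ε => Kε ε x y := by
    intro x y
    rcases x with _ | i <;> rcases y with _ | j <;> simp only [hKε] <;> fun_prop
  have hcont : ∀ n x, Continuous fun ε => ((chainOp (Kε ε))^[n] bo) x := by
    intro n
    induction n with
    | zero => intro x; simp only [Function.iterate_zero, id]; exact continuous_const
    | succ n ih =>
      intro x
      simp only [Function.iterate_succ_apply', chainOp]
      exact continuous_finsetSum _ fun y _ => (hcontK x y).smul (ih y)
  have hzero : ∀ n, ((chainOp (Kε 0))^[n] bo) none = 0 ∧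
      ∀ i, ((chainOp (Kε 0))^[n] bo) (some i) = ((chainOp K)^[n] b) i := by
    intro n
    induction n with
    | zero => simp [hbo]
    | succ n ih =>
      simp only [Function.iterate_succ_apply', chainOp, Fintype.sum_option, ih.1, ih.2]
      simp [hKε]
  have hlim : Continuous fun ε =>
      ∑ i, w i * sqSum q (2 ^ M) (fun n => ((chainOp (Kε ε))^[2 * n] bo) (some i)) ^ p := by
    unfold sqSum avgDev
    refine continuous_finsetSum _ fun i _ => continuous_const.mul
      (Continuous.rpow_const (Continuous.rpow_const (continuous_finsetSum _ fun n _ =>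
        continuous_const.mul (Continuous.rpow_const (Continuous.norm (Continuous.sub (hcont _ _)
          (continuous_const.smul (continuous_finsetSum _ fun k _ => hcont _ _)))) ?_)) ?_) ?_)
    · exact fun _ => Or.inr (by linarith)
    · exact fun _ => Or.inr (by positivity)
    · exact fun _ => Or.inr (by linarith)
  have h0 := (hlim.tendsto 0).mono_left (nhdsWithin_le_nhds (s := Ioi 0))
  simp only [hzero] at h0
  refine le_of_tendsto h0 ?_
  have hsmall : ∀ᶠ ε in 𝓝[>] (0 : ℝ), ε * S ≤ 1 := by
    have : Tendsto (fun ε : ℝ => ε * S) (𝓝[>] 0) (𝓝 (0 * S)) :=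
      ((continuous_id.mul continuous_const).tendsto 0).mono_left nhdsWithin_le_nhds
    rw [zero_mul] at this
    exact this.eventually_le_const one_pos
  filter_upwards [hsmall, self_mem_nhdsWithin] with ε h1 h2
  exact hbound ε h2 h1

end ChainBound

/-! ### Averaging over finite partitions -/

section Partition

/-- Finitely many disjoint measurable sets of finite measure. -/
structure FinPart {Ω : Type*} [MeasurableSpace Ω] (μ : Measure Ω) (k : ℕ) where
  /-- the sets -/
  set : Fin k → Set Ω
  meas : ∀ i, MeasurableSet (set i)
  ne_top : ∀ i, μ (set i) ≠ ∞
  disj : Pairwise (Function.onFun Disjoint set)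

namespace FinPart

variable {Ω : Type*} [MeasurableSpace Ω] {μ : Measure Ω} {k : ℕ} (A : FinPart μ k)

/-- The function with value `b i` on `A i`, and `0` off the union of the `A i`. -/
noncomputable def stepFun {F : Type*} [AddCommMonoid F] (b : Fin k → F) (x : Ω) : F :=
  ∑ i, (A.set i).indicator (fun _ => b i) x

lemma stepFun_of_mem {F : Type*} [AddCommMonoid F] (b : Fin k → F) {x : Ω} {i : Fin k}
    (hx : x ∈ A.set i) : A.stepFun b x = b i := by
  unfold stepFun
  rw [Finset.sum_eq_single i, indicator_of_mem hx]
  · intro j _ hj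
    exact indicator_of_notMem (fun h => disjoint_left.mp (A.disj hj) h hx) _
  · simp

lemma stepFun_of_notMem {F : Type*} [AddCommMonoid F] (b : Fin k → F) {x : Ω}
    (hx : ∀ i, x ∉ A.set i) : A.stepFun b x = 0 :=
  Finset.sum_eq_zero fun i _ => indicator_of_notMem (hx i) _

lemma map_stepFun {F G : Type*} [AddCommMonoid F] [AddCommMonoid G] (Ψ : F → G) (h0 : Ψ 0 = 0)
    (b : Fin k → F) (x : Ω) : Ψ (A.stepFun b x) = A.stepFun (fun i => Ψ (b i)) x := by
  by_cases h : ∃ i, x ∈ A.set i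
  · obtain ⟨i, hi⟩ := h
    rw [A.stepFun_of_mem b hi, A.stepFun_of_mem _ hi]
  · push Not at h
    rw [A.stepFun_of_notMem b h, A.stepFun_of_notMem _ h, h0]

lemma stronglyMeasurable_stepFun {F : Type*} [NormedAddCommGroup F] (b : Fin k → F) :
    StronglyMeasurable (A.stepFun b) :=
  Finset.stronglyMeasurable_fun_sum _ fun i _ => stronglyMeasurable_const.indicator (A.meas i)

lemma lintegral_stepFun (b : Fin k → ℝ≥0∞) :
    ∫⁻ x, A.stepFun b x ∂μ = ∑ i, b i * μ (A.set i) := by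
  unfold stepFun
  rw [lintegral_finsetSum _ fun i _ => measurable_const.indicator (A.meas i)]
  refine Finset.sum_congr rfl fun i _ => ?_
  rw [lintegral_indicator_const (A.meas i)]

lemma eLpNorm_stepFun {p : ℝ≥0∞} (hp0 : p ≠ 0) (hp : p ≠ ∞) {F : Type*} [NormedAddCommGroup F]
    (b : Fin k → F) :
    eLpNorm (A.stepFun b) p μ ^ p.toReal = ∑ i, ‖b i‖ₑ ^ p.toReal * μ (A.set i) := by
  have hpr : 0 < p.toReal := ENNReal.toReal_pos hp0 hp
  rw [eLpNorm_eq_lintegral_rpow_enorm_toReal hp0 hp, ← ENNReal.rpow_mul,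
    one_div_mul_cancel hpr.ne', ENNReal.rpow_one, ← A.lintegral_stepFun]
  refine lintegral_congr fun x => ?_
  exact A.map_stepFun (fun y : F => ‖y‖ₑ ^ p.toReal)
    (by simp [ENNReal.zero_rpow_of_pos hpr]) b x

variable {p : ℝ≥0∞} {B : Type*} [NormedAddCommGroup B] [NormedSpace ℝ B]

/-- The class of a step function in `L^p`. -/
noncomputable def embed (p : ℝ≥0∞) (b : Fin k → B) : Lp B p μ :=
  ∑ i, indicatorConstLp p (A.meas i) (A.ne_top i) (b i)

omit [NormedSpace ℝ B] in
lemma coeFn_embed (b : Fin k → B) : A.embed p b =ᵐ[μ] A.stepFun b := by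
  have h : ∀ᵐ x ∂μ, ∀ i, indicatorConstLp p (A.meas i) (A.ne_top i) (b i) x
      = (A.set i).indicator (fun _ => b i) x := ae_all_iff.mpr fun i => indicatorConstLp_coeFn
  filter_upwards [h, Lp.coeFn_finsetSum Finset.univ
    fun i => indicatorConstLp p (A.meas i) (A.ne_top i) (b i)] with x h1 h2
  rw [embed, h2, Finset.sum_apply]
  exact Finset.sum_congr rfl fun i _ => h1 i

/-- The averages of `F` over the sets of the partition. -/
noncomputable def avg (F : Ω → B) (i : Fin k) : B := (μ.real (A.set i))⁻¹ • ∫ x in A.set i, F x ∂μ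

omit [NormedSpace ℝ B] in
lemma integrableOn_Lp [Fact (1 ≤ p)] (F : Lp B p μ) (i : Fin k) :
    IntegrableOn F (A.set i) μ := by
  have : IsFiniteMeasure (μ.restrict (A.set i)) :=
    ⟨by rw [Measure.restrict_apply_univ]; exact (A.ne_top i).lt_top⟩
  exact ((Lp.memLp F).restrict (A.set i)).integrable Fact.out

lemma enorm_avg_rpow_mul_le [Fact (1 ≤ p)] (hp : p ≠ ∞) (F : Lp B p μ) (i : Fin k) :
    ‖A.avg F i‖ₑ ^ p.toReal * μ (A.set i) ≤ ∫⁻ x in A.set i, ‖F x‖ₑ ^ p.toReal ∂μ := by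
  have hp1 : (1 : ℝ≥0∞) ≤ p := Fact.out
  have hp0 : p ≠ 0 := (zero_lt_one.trans_le hp1).ne'
  have hpr : 0 < p.toReal := ENNReal.toReal_pos hp0 hp
  by_cases h0 : μ (A.set i) = 0
  · rw [h0, mul_zero]; exact zero_le
  set m := μ (A.set i) with hm
  have h1 : ‖A.avg F i‖ₑ ≤ m⁻¹ * eLpNorm F 1 (μ.restrict (A.set i)) := by
    rw [avg, enorm_smul, measureReal_def, ← hm, Real.enorm_eq_ofReal (by positivity),
      ← ENNReal.toReal_inv, ENNReal.ofReal_toReal (ENNReal.inv_ne_top.mpr h0),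
      eLpNorm_one_eq_lintegral_enorm]
    exact mul_le_mul_right (enorm_integral_le_lintegral_enorm _) _
  have h2 := eLpNorm_le_eLpNorm_mul_rpow_measure_univ (μ := μ.restrict (A.set i)) hp1
    (Lp.aestronglyMeasurable F).restrict
  rw [Measure.restrict_apply_univ, ← hm, ENNReal.toReal_one] at h2
  have h3 := h1.trans (mul_le_mul_right h2 _)
  have h4 := ENNReal.rpow_le_rpow h3 hpr.le
  rw [ENNReal.mul_rpow_of_nonneg _ _ hpr.le, ENNReal.mul_rpow_of_nonneg _ _ hpr.le] at h4
  have h5 : eLpNorm F p (μ.restrict (A.set i)) ^ p.toReal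
      = ∫⁻ x in A.set i, ‖F x‖ₑ ^ p.toReal ∂μ := by
    rw [eLpNorm_eq_lintegral_rpow_enorm_toReal hp0 hp, ← ENNReal.rpow_mul,
      one_div_mul_cancel hpr.ne', ENNReal.rpow_one]
  rw [h5, ← ENNReal.rpow_mul, ENNReal.inv_rpow, ← ENNReal.rpow_neg] at h4
  refine (mul_le_mul_left h4 m).trans (le_of_eq ?_)
  calc m ^ (-p.toReal) * ((∫⁻ x in A.set i, ‖F x‖ₑ ^ p.toReal ∂μ)
        * m ^ ((1 / 1 - 1 / p.toReal) * p.toReal)) * m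
      = (∫⁻ x in A.set i, ‖F x‖ₑ ^ p.toReal ∂μ)
        * (m ^ (-p.toReal) * m ^ ((1 / 1 - 1 / p.toReal) * p.toReal) * m ^ (1 : ℝ)) := by
        rw [ENNReal.rpow_one]; ring
    _ = _ := by
        rw [← ENNReal.rpow_add _ _ h0 (A.ne_top i), ← ENNReal.rpow_add _ _ h0 (A.ne_top i)]
        have : -p.toReal + (1 / 1 - 1 / p.toReal) * p.toReal + 1 = 0 := by field_simp; ring
        rw [this, ENNReal.rpow_zero, mul_one]

/-- Averaging over a partition is a contraction of `L^p`. -/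
lemma norm_embed_avg_le [Fact (1 ≤ p)] (hp : p ≠ ∞) (F : Lp B p μ) :
    ‖A.embed p (A.avg F)‖ ≤ ‖F‖ := by
  have hp1 : (1 : ℝ≥0∞) ≤ p := Fact.out
  have hp0 : p ≠ 0 := (zero_lt_one.trans_le hp1).ne'
  have hpr : 0 < p.toReal := ENNReal.toReal_pos hp0 hp
  rw [Lp.norm_def, Lp.norm_def]
  refine ENNReal.toReal_mono (Lp.eLpNorm_ne_top F) ?_
  rw [eLpNorm_congr_ae (A.coeFn_embed _), ← ENNReal.rpow_le_rpow_iff hpr,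
    A.eLpNorm_stepFun hp0 hp, eLpNorm_eq_lintegral_rpow_enorm_toReal hp0 hp, ← ENNReal.rpow_mul,
    one_div_mul_cancel hpr.ne', ENNReal.rpow_one]
  refine (Finset.sum_le_sum fun i _ => A.enorm_avg_rpow_mul_le hp F i).trans ?_
  rw [← tsum_fintype (L := .unconditional _), ← lintegral_iUnion A.meas A.disj]
  exact setLIntegral_le_lintegral _ _

lemma avg_sub [Fact (1 ≤ p)] (F G : Lp B p μ) :
    A.avg (F - G : Lp B p μ) = A.avg F - A.avg G := by
  funext i
  simp only [avg, Pi.sub_apply]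
  rw [← smul_sub, ← integral_sub (A.integrableOn_Lp F i) (A.integrableOn_Lp G i)]
  congr 1
  refine integral_congr_ae (ae_restrict_of_ae ?_)
  filter_upwards [Lp.coeFn_sub F G] with x hx
  rw [hx, Pi.sub_apply]

omit [NormedSpace ℝ B] in
lemma embed_sub (b b' : Fin k → B) : A.embed p (b - b') = A.embed p b - A.embed p b' := by
  refine Lp.ext ?_
  filter_upwards [A.coeFn_embed (p := p) (b - b'), A.coeFn_embed (p := p) b,
    A.coeFn_embed (p := p) b', Lp.coeFn_sub (A.embed p b) (A.embed p b')] with x h1 h2 h3 h4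
  rw [h1, h4, Pi.sub_apply, h2, h3]
  by_cases h : ∃ i, x ∈ A.set i
  · obtain ⟨i, hi⟩ := h
    simp only [A.stepFun_of_mem _ hi, Pi.sub_apply]
  · push Not at h
    simp only [A.stepFun_of_notMem _ h, sub_zero]

lemma embed_avg_embed [CompleteSpace B] [Fact (1 ≤ p)] (b : Fin k → B) :
    A.embed p (A.avg (A.embed p b)) = A.embed p b := by
  refine Finset.sum_congr rfl fun i _ => ?_
  by_cases h0 : μ (A.set i) = 0
  · have : ∀ c : B, indicatorConstLp p (A.meas i) (A.ne_top i) c = 0 := fun c => by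
      refine Lp.ext ?_
      have h1 : ∀ᵐ x ∂μ, x ∉ A.set i := measure_eq_zero_iff_ae_notMem.mp h0
      filter_upwards [h1, indicatorConstLp_coeFn (p := p) (hs := A.meas i) (hμs := A.ne_top i)
        (c := c), Lp.coeFn_zero B p μ] with x h1 h2 h3
      rw [h2, h3, indicator_of_notMem h1]; rfl
    rw [this, this]
  · congr 1
    unfold avg
    have h1 : ∫ x in A.set i, A.embed p b x ∂μ = ∫ x in A.set i, b i ∂μ := by
      refine setIntegral_congr_ae (A.meas i) ?_
      filter_upwards [A.coeFn_embed (p := p) b] with x hx hxi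
      rw [hx, A.stepFun_of_mem b hxi]
    rw [h1, setIntegral_const, smul_smul, inv_mul_cancel₀, one_smul]
    rw [measureReal_def]
    exact ENNReal.toReal_ne_zero.mpr ⟨h0, A.ne_top i⟩

/-- The matrix, with respect to the indicator functions of the sets, of the compression of an
operator to step functions. Sets of measure zero give zero rows. -/
noncomputable def kernel (p : ℝ≥0∞) [Fact (1 ≤ p)] (S : Lp ℝ p μ →L[ℝ] Lp ℝ p μ)
    (i j : Fin k) : ℝ :=
  A.avg (S (indicatorConstLp p (A.meas j) (A.ne_top j) 1)) i

/-- Compressing `S ⊗ Id_B` to step functions gives the matrix of the compression of `S`, acting on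
`B`-valued vectors. -/
lemma avg_vectorExtension_embed [CompleteSpace B] [Fact (1 ≤ p)] (hp : p ≠ ∞)
    (S : Lp ℝ p μ →L[ℝ] Lp ℝ p μ) (hS : ∀ f : Lp ℝ p μ, 0 ≤ f → 0 ≤ S f) (b : Fin k → B) :
    A.avg (vectorExtension B S (A.embed p b)) = chainOp (A.kernel p S) b := by
  have h1 : ∀ j, indicatorConstLp p (A.meas j) (A.ne_top j) (b j)
      = tensorToLp μ p B (indicatorConstLp p (A.meas j) (A.ne_top j) 1 ⊗ₜ b j) := by
    intro j
    refine Lp.ext ?_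
    filter_upwards [tensorToLp_tmul (indicatorConstLp p (A.meas j) (A.ne_top j) (1 : ℝ)) (b j),
      indicatorConstLp_coeFn (p := p) (hs := A.meas j) (hμs := A.ne_top j) (c := (1 : ℝ)),
      indicatorConstLp_coeFn (p := p) (hs := A.meas j) (hμs := A.ne_top j) (c := b j)]
      with x h1 h2 h3
    rw [h1, h2, h3]
    by_cases hx : x ∈ A.set j <;> simp [hx]
  have h2 : ∀ᵐ x ∂μ, vectorExtension B S (A.embed p b) x
      = ∑ j, S (indicatorConstLp p (A.meas j) (A.ne_top j) 1) x • b j := by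
    have h3 : vectorExtension B S (A.embed p b) = ∑ j, tensorToLp μ p B
        (S (indicatorConstLp p (A.meas j) (A.ne_top j) 1) ⊗ₜ b j) := by
      rw [embed, map_sum]
      refine Finset.sum_congr rfl fun j _ => ?_
      rw [h1, vectorExtension_tensor hp S hS, LinearMap.rTensor_tmul]
      rfl
    rw [h3]
    filter_upwards [Lp.coeFn_finsetSum Finset.univ fun j => tensorToLp μ p B
        (S (indicatorConstLp p (A.meas j) (A.ne_top j) 1) ⊗ₜ b j),
      ae_all_iff.mpr fun j => tensorToLp_tmul
        (S (indicatorConstLp p (A.meas j) (A.ne_top j) 1)) (b j)] with x h4 h5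
    rw [h4, Finset.sum_apply]
    exact Finset.sum_congr rfl fun j _ => h5 j
  funext i
  unfold chainOp kernel avg
  rw [integral_congr_ae (ae_restrict_of_ae h2), integral_finsetSum, Finset.smul_sum]
  · refine Finset.sum_congr rfl fun j _ => ?_
    rw [integral_smul_const, smul_smul, smul_eq_mul]
  · intro j _
    have := A.integrableOn_Lp (S (indicatorConstLp p (A.meas j) (A.ne_top j) 1)) i
    exact Integrable.smul_const this _

end FinPart

/-- Finitely many elements of `L^p` are approximated by step functions on a common partition. -/
lemma exists_finPart_approx {Ω : Type*} [MeasurableSpace Ω] {μ : Measure Ω} {p : ℝ≥0∞}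
    [Fact (1 ≤ p)] (hp : p ≠ ∞) {B : Type*} [NormedAddCommGroup B] [NormedSpace ℝ B] {N : ℕ}
    (F : Fin N → Lp B p μ) {δ : ℝ} (hδ : 0 < δ) :
    ∃ (k : ℕ) (A : FinPart μ k) (b : Fin N → Fin k → B),
      ∀ n, ‖F n - A.embed p (b n)‖ ≤ δ := by
  classical
  have hp1 : (1 : ℝ≥0∞) ≤ p := Fact.out
  have hp0 : p ≠ 0 := (zero_lt_one.trans_le hp1).ne'
  have hF : MemLp (fun x n => F n x) p μ := memLp_pi_iff.mpr fun n => Lp.memLp (F n)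
  obtain ⟨g, hg, hgm⟩ := hF.exists_simpleFunc_eLpNorm_sub_lt hp
    (ENNReal.ofReal_pos.mpr hδ).ne'
  set R := g.range.filter (fun y => y ≠ 0) with hR
  let e := R.equivFin
  let A : FinPart μ R.card := ⟨fun i => g ⁻¹' {(e.symm i : Fin N → B)},
    fun i => g.measurableSet_fiber _,
    fun i => (SimpleFunc.measure_preimage_lt_top_of_memLp hp0 hp g hgm _
      (Finset.mem_filter.mp (e.symm i).2).2).ne, fun i j hij =>
    disjoint_left.mpr fun x hx hx' => hij (e.symm.injective (Subtype.ext
      ((mem_singleton_iff.mp hx).symm.trans (mem_singleton_iff.mp hx'))))⟩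
  have hA : ∀ x i, x ∈ A.set i ↔ g x = e.symm i := fun x i => Iff.rfl
  refine ⟨R.card, A, fun n i => (e.symm i : Fin N → B) n, fun n => ?_⟩
  have h1 : ∀ x, A.stepFun (fun i => (e.symm i : Fin N → B) n) x = g x n := by
    intro x
    by_cases hx : g x = 0
    · rw [A.stepFun_of_notMem, hx]
      · rfl
      · intro i hi
        exact (Finset.mem_filter.mp (e.symm i).2).2 (((hA x i).mp hi).symm.trans hx)
    · have hxR : g x ∈ R := Finset.mem_filter.mpr ⟨g.mem_range_self x, hx⟩
      rw [A.stepFun_of_mem (i := e ⟨g x, hxR⟩)]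
      · simp
      · rw [hA]; simp
  rw [Lp.norm_def]
  refine ENNReal.toReal_le_of_le_ofReal hδ.le (le_trans (eLpNorm_mono_ae ?_) hg.le)
  filter_upwards [Lp.coeFn_sub (F n) (A.embed p fun i => (e.symm i : Fin N → B) n),
    A.coeFn_embed (p := p) fun i => (e.symm i : Fin N → B) n] with x h2 h3
  rw [h2, Pi.sub_apply, h3, h1]
  exact norm_le_pi_norm ((fun n => F n x) - g x) n

end Partition

/-! ### The discrete square function on `L^p` -/

section Discrete

/-- A crude bound, with a constant depending on `N`, which suffices for approximation errors. -/
lemma sqSum_le_sum_norm {E : Type*} [NormedAddCommGroup E] [NormedSpace ℝ E] {q : ℝ} (hq : 1 ≤ q)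
    (N : ℕ) (z : ℕ → E) :
    sqSum q N z ≤ (N : ℝ) ^ (1 / q) * 2 * ∑ k ∈ Finset.range (N + 1), ‖z k‖ := by
  set R := ∑ k ∈ Finset.range (N + 1), ‖z k‖ with hR
  have hR0 : 0 ≤ R := Finset.sum_nonneg fun _ _ => norm_nonneg _
  have h1 : ∀ n ∈ Finset.range N, ((n : ℝ) + 1)⁻¹ * ‖avgDev z (n + 1)‖ ^ q ≤ (2 * R) ^ q := by
    intro n hn
    have hn' := Finset.mem_range.mp hn
    have h2 : ‖z (n + 1)‖ ≤ R := Finset.single_le_sum (f := fun k => ‖z k‖)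
      (fun _ _ => norm_nonneg _) (Finset.mem_range.mpr (by omega))
    have h3 : ‖∑ k ∈ Finset.range (n + 1), z (k + 1)‖ ≤ R := by
      refine (norm_sum_le _ _).trans ?_
      have h4 : ∑ k ∈ Finset.range (N + 1), ‖z k‖
          = ∑ k ∈ Finset.range N, ‖z (k + 1)‖ + ‖z 0‖ := Finset.sum_range_succ' _ _
      rw [hR, h4]
      exact (Finset.sum_le_sum_of_subset_of_nonneg (Finset.range_mono hn')
        fun _ _ _ => norm_nonneg _).trans (le_add_of_nonneg_right (norm_nonneg _))
    have h5 : (((n + 1 : ℕ) : ℝ))⁻¹ ≤ 1 :=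
      inv_le_one_of_one_le₀ (by push_cast; linarith [(n.cast_nonneg : (0 : ℝ) ≤ n)])
    have h6 : ‖avgDev z (n + 1)‖ ≤ 2 * R := by
      unfold avgDev
      refine (norm_sub_le _ _).trans ?_
      rw [norm_smul, Real.norm_of_nonneg (by positivity)]
      have := mul_le_mul h5 h3 (norm_nonneg _) zero_le_one
      linarith
    have h7 := Real.rpow_le_rpow (norm_nonneg _) h6 (by linarith : 0 ≤ q)
    push_cast at h5
    have := mul_le_mul h5 h7 (by positivity) zero_le_one
    linarith
  calc sqSum q N z ≤ (N * (2 * R) ^ q) ^ (1 / q) := by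
        refine Real.rpow_le_rpow (Finset.sum_nonneg fun _ _ => by positivity)
          ((Finset.sum_le_sum h1).trans (by simp)) (by positivity)
    _ = _ := by
        rw [Real.mul_rpow (by positivity) (by positivity), ← Real.rpow_mul (by positivity),
          mul_one_div_cancel (by linarith), Real.rpow_one, mul_assoc]

variable {B : Type*} [NormedAddCommGroup B] [NormedSpace ℝ B]

/-- The square function inequality for iterates of a symmetric sub-Markovian operator on `L^p`. The
finitely many iterates involved are approximated by those of a compression of `S` to step functions,
which is a reversible chain that may lose mass outside the partition. -/
theorem HasMartingaleCotype.exists_discrete_bound [CompleteSpace B] {q : ℝ} (hq : 1 < q)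
    (hB : HasMartingaleCotype B q) {p : ℝ≥0∞} [Fact (1 ≤ p)] (hp : 1 < p) (hp' : p ≠ ∞) :
    ∃ C : ℝ, 0 ≤ C ∧ ∀ (Ω : Type*) [MeasurableSpace Ω] (μ : Measure Ω)
      (S : Lp ℝ p μ →L[ℝ] Lp ℝ p μ), (∀ f, 0 ≤ f → 0 ≤ S f) → ‖S‖ ≤ 1 →
      (∀ f : Lp ℝ p μ, 0 ≤ f → (∀ᵐ x ∂μ, f x ≤ 1) → ∀ᵐ x ∂μ, S f x ≤ 1) →
      (∀ (s t : Set Ω) (hs : MeasurableSet s) (ht : MeasurableSet t) (hμs : μ s ≠ ∞)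
        (hμt : μ t ≠ ∞), ∫ x in s, S (indicatorConstLp p ht hμt 1) x ∂μ
          = ∫ x in t, S (indicatorConstLp p hs hμs 1) x ∂μ) →
      ∀ (F : Lp B p μ) (M : ℕ),
        eLpNorm (fun x => sqSum q (2 ^ M) (fun n => ((vectorExtension B S)^[2 * n] F) x)) p μ
          ≤ ENNReal.ofReal (C * ‖F‖) := by
  have hp0 : p ≠ 0 := (zero_lt_one.trans hp).ne'
  have hpr : 1 < p.toReal := by
    have := (ENNReal.toReal_lt_toReal ENNReal.one_ne_top hp').mpr hp
    simpa using this
  have hpr0 : 0 < p.toReal := by linarith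
  obtain ⟨C, hC, hbound⟩ := hB.exists_subMarkov_bound hq hpr
  refine ⟨C ^ (1 / p.toReal), by positivity, ?_⟩
  intro Ω _ μ S hS hS1 hsub hsymm F M
  set V := vectorExtension B S with hV
  have hV1 : ‖V‖ ≤ 1 := (norm_vectorExtension_le hp' S hS).trans hS1
  set c : ℝ := (((2 ^ M : ℕ) : ℝ)) ^ (1 / q) * 2 with hc
  have hc0 : 0 ≤ c := by positivity
  set N := 2 * 2 ^ M + 1 with hN
  have main : ∀ δ : ℝ, 0 < δ →
      eLpNorm (fun x => sqSum q (2 ^ M) (fun n => (V^[2 * n] F) x)) p μ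
        ≤ ENNReal.ofReal (C ^ (1 / p.toReal) * (‖F‖ + δ)
          + c * ((2 ^ M + 1) * ((2 * N + 1) * δ))) := by
    intro δ hδ
    obtain ⟨k, A, b, hb⟩ := exists_finPart_approx hp' (fun n : Fin N => V^[n] F) hδ
    set K := A.kernel p S with hK
    set b₀ := b ⟨0, by omega⟩ with hb₀
    set g : ℕ → Lp B p μ := fun n => A.embed p ((chainOp K)^[n] b₀) with hg
    have hg0 : ‖F - g 0‖ ≤ δ := hb ⟨0, by omega⟩
    -- the compressed iterates approximate the true ones
    have hgF : ∀ n < N, ‖V^[n] F - g n‖ ≤ (2 * n + 1) * δ := by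
      intro n
      induction n with
      | zero => intro _; simpa using hg0
      | succ n ih =>
        intro hn
        have h1 := ih (by omega)
        have h2 : g (n + 1) = A.embed p (A.avg (V (g n))) := by
          simp only [hg, hV]
          rw [A.avg_vectorExtension_embed hp' S hS, Function.iterate_succ_apply']
        set G := V^[n + 1] F with hG
        have hG' : G = V (V^[n] F) := Function.iterate_succ_apply' _ _ _
        have hbG : ‖G - A.embed p (b ⟨n + 1, hn⟩)‖ ≤ δ := hb ⟨n + 1, hn⟩
        have h3 : G - g (n + 1) = (G - A.embed p (b ⟨n + 1, hn⟩))
            - A.embed p (A.avg (G - A.embed p (b ⟨n + 1, hn⟩) : Lp B p μ))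
            + A.embed p (A.avg (V (V^[n] F - g n) : Lp B p μ)) := by
          rw [map_sub, ← hG', A.avg_sub, A.avg_sub, A.embed_sub, A.embed_sub, A.embed_avg_embed,
            h2]
          abel
        have h4 : ‖A.embed p (A.avg (V (V^[n] F - g n) : Lp B p μ))‖ ≤ (2 * n + 1) * δ := by
          refine (A.norm_embed_avg_le hp' _).trans ((V.le_opNorm _).trans ?_)
          exact (mul_le_of_le_one_left (norm_nonneg _) hV1).trans h1
        have h5 := A.norm_embed_avg_le hp' (G - A.embed p (b ⟨n + 1, hn⟩))
        rw [h3]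
        refine (norm_add_le _ _).trans ((add_le_add (norm_sub_le _ _) le_rfl).trans ?_)
        rw [Nat.cast_succ]
        linarith
    -- the kernel is reversible and sub-Markovian
    have hind0 : ∀ j, 0 ≤ indicatorConstLp p (A.meas j) (A.ne_top j) (1 : ℝ) := by
      intro j
      rw [← Lp.coeFn_nonneg]
      filter_upwards [indicatorConstLp_coeFn (p := p) (hs := A.meas j) (hμs := A.ne_top j)
        (c := (1 : ℝ))] with x hx
      rw [hx]
      exact indicator_nonneg (fun _ _ => zero_le_one) x
    have hKint : ∀ i j, μ.real (A.set i) * K i j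
        = ∫ x in A.set i, S (indicatorConstLp p (A.meas j) (A.ne_top j) 1) x ∂μ := by
      intro i j
      simp only [hK, FinPart.kernel, FinPart.avg, smul_eq_mul]
      by_cases h0 : μ.real (A.set i) = 0
      · have h1 : μ (A.set i) = 0 := by
          rw [measureReal_def, ENNReal.toReal_eq_zero_iff] at h0
          exact h0.resolve_right (A.ne_top i)
        rw [h0, zero_mul, setIntegral_measure_zero _ h1]
      · rw [mul_inv_cancel_left₀ h0]
    have hKnonneg : ∀ i j, 0 ≤ K i j := by
      intro i j
      refine mul_nonneg (inv_nonneg.mpr measureReal_nonneg) (integral_nonneg_of_ae ?_)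
      exact ae_restrict_of_ae ((Lp.coeFn_nonneg _).mpr (hS _ (hind0 j)))
    have hKsymm : ∀ i j, μ.real (A.set i) * K i j = μ.real (A.set j) * K j i := fun i j => by
      rw [hKint, hKint]
      exact hsymm _ _ _ _ _ _
    have hKrow : ∀ i, ∑ j, K i j ≤ 1 := by
      intro i
      have h1 : ∑ j, K i j = (μ.real (A.set i))⁻¹ * ∫ x in A.set i,
          S (A.embed p fun _ => (1 : ℝ)) x ∂μ := by
        simp only [hK, FinPart.kernel, FinPart.avg, smul_eq_mul]
        rw [← Finset.mul_sum, ← integral_finsetSum _ fun j _ => A.integrableOn_Lp _ i]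
        congr 1
        refine integral_congr_ae (ae_restrict_of_ae ?_)
        rw [FinPart.embed, map_sum]
        filter_upwards [Lp.coeFn_finsetSum Finset.univ fun j =>
          S (indicatorConstLp p (A.meas j) (A.ne_top j) 1)] with x hx
        rw [hx, Finset.sum_apply]
      have h2 : ∫ x in A.set i, S (A.embed p fun _ => (1 : ℝ)) x ∂μ ≤ μ.real (A.set i) := by
        have h3 : ∀ᵐ x ∂μ, S (A.embed p fun _ => (1 : ℝ)) x ≤ 1 := by
          refine hsub _ (Finset.sum_nonneg fun j _ => hind0 j) ?_
          filter_upwards [A.coeFn_embed (p := p) fun _ => (1 : ℝ)] with x hx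
          rw [hx]
          by_cases h : ∃ i, x ∈ A.set i
          · obtain ⟨i, hi⟩ := h
            rw [A.stepFun_of_mem _ hi]
          · push Not at h
            rw [A.stepFun_of_notMem _ h]; exact zero_le_one
        have h4 := setIntegral_mono_ae (s := A.set i) (A.integrableOn_Lp _ i)
          (integrableOn_const (A.ne_top i) (C := (1 : ℝ))) h3
        simpa using h4
      rw [h1]
      by_cases h0 : μ.real (A.set i) = 0
      · rw [h0, inv_zero, zero_mul]; exact zero_le_one
      · have hpos : 0 < μ.real (A.set i) := lt_of_le_of_ne measureReal_nonneg (Ne.symm h0)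
        rw [inv_mul_le_iff₀ hpos, mul_one]; exact h2
    -- the inequality for the chain
    set Φ : Fin k → ℝ := fun i => sqSum q (2 ^ M) (fun n => ((chainOp K)^[2 * n] b₀) i) with hΦ
    have hΦ0 : ∀ i, 0 ≤ Φ i := fun i => sqSum_nonneg _ _ _
    have hμA : ∀ i, μ (A.set i) = ENNReal.ofReal (μ.real (A.set i)) := fun i =>
      (ENNReal.ofReal_toReal (A.ne_top i)).symm
    have hpowsum : ∀ {G : Type _} [NormedAddCommGroup G] (v : Fin k → G),
        eLpNorm (A.stepFun v) p μ ^ p.toReal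
          = ENNReal.ofReal (∑ i, μ.real (A.set i) * ‖v i‖ ^ p.toReal) := by
      intro G _ v
      rw [A.eLpNorm_stepFun hp0 hp', ENNReal.ofReal_sum_of_nonneg fun i _ => by positivity]
      refine Finset.sum_congr rfl fun i _ => ?_
      rw [hμA, ENNReal.ofReal_mul measureReal_nonneg, mul_comm, ← ofReal_norm,
        ENNReal.ofReal_rpow_of_nonneg (norm_nonneg _) hpr0.le]
    have hchain : eLpNorm (A.stepFun Φ) p μ ≤ ENNReal.ofReal (C ^ (1 / p.toReal) * (‖F‖ + δ)) := by
      have hg0' : ‖g 0‖ ≤ ‖F‖ + δ := by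
        calc ‖g 0‖ = ‖F - (F - g 0)‖ := by rw [sub_sub_cancel]
          _ ≤ _ := (norm_sub_le _ _).trans (by linarith)
      have h1 : eLpNorm (A.stepFun Φ) p μ ^ p.toReal
          ≤ ENNReal.ofReal (C ^ (1 / p.toReal) * (‖F‖ + δ)) ^ p.toReal := by
        calc eLpNorm (A.stepFun Φ) p μ ^ p.toReal
            = ENNReal.ofReal (∑ i, μ.real (A.set i) * Φ i ^ p.toReal) := by
              rw [A.eLpNorm_stepFun hp0 hp', ENNReal.ofReal_sum_of_nonneg fun i _ =>
                mul_nonneg measureReal_nonneg (Real.rpow_nonneg (hΦ0 i) _)]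
              refine Finset.sum_congr rfl fun i _ => ?_
              rw [hμA, ENNReal.ofReal_mul measureReal_nonneg, mul_comm,
                Real.enorm_eq_ofReal (hΦ0 i), ENNReal.ofReal_rpow_of_nonneg (hΦ0 i) hpr0.le]
          _ ≤ ENNReal.ofReal (C * ∑ i, μ.real (A.set i) * ‖b₀ i‖ ^ p.toReal) :=
              ENNReal.ofReal_le_ofReal (hbound (Fin k) (fun i => μ.real (A.set i)) K
                (fun _ => measureReal_nonneg) hKnonneg hKsymm hKrow b₀ M)
          _ = ENNReal.ofReal C * eLpNorm (A.stepFun b₀) p μ ^ p.toReal := by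
              rw [hpowsum, ENNReal.ofReal_mul hC]
          _ = ENNReal.ofReal C * ENNReal.ofReal ‖g 0‖ ^ p.toReal := by
              rw [Lp.norm_def, ENNReal.ofReal_toReal (Lp.eLpNorm_ne_top _)]
              congr 2
              exact (eLpNorm_congr_ae (A.coeFn_embed b₀)).symm
          _ ≤ ENNReal.ofReal C * ENNReal.ofReal (‖F‖ + δ) ^ p.toReal := by
              gcongr
          _ = _ := by
              rw [ENNReal.ofReal_mul (by positivity), ENNReal.mul_rpow_of_nonneg _ _ hpr0.le,
                ENNReal.ofReal_rpow_of_nonneg (x := C ^ (1 / p.toReal)) (by positivity) hpr0.le,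
                ← Real.rpow_mul hC,
                one_div_mul_cancel hpr0.ne', Real.rpow_one]
      exact (ENNReal.rpow_le_rpow_iff hpr0).mp h1
    -- comparison of the square functions
    set Z : ℕ → Lp B p μ := fun n => V^[2 * n] F - g (2 * n) with hZ
    set R : Ω → ℝ := fun x => ∑ n ∈ Finset.range (2 ^ M + 1), ‖Z n x‖ with hR
    have hle : ∀ᵐ x ∂μ, ‖sqSum q (2 ^ M) (fun n => (V^[2 * n] F) x)‖
        ≤ A.stepFun Φ x + c * R x := by
      filter_upwards [ae_all_iff.mpr fun n => Lp.coeFn_sub (V^[2 * n] F) (g (2 * n)),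
        ae_all_iff.mpr fun n => A.coeFn_embed (p := p) ((chainOp K)^[2 * n] b₀)] with x h1 h2
      rw [Real.norm_of_nonneg (sqSum_nonneg _ _ _)]
      have h3 : ∀ n, (V^[2 * n] F) x = A.stepFun ((chainOp K)^[2 * n] b₀) x + Z n x := by
        intro n
        rw [hZ, ← h2 n]
        simp only
        rw [h1 n, Pi.sub_apply]
        simp only [hg]
        abel
      simp_rw [h3]
      refine (sqSum_add_le hq.le _ _ _).trans (add_le_add (le_of_eq ?_)
        (sqSum_le_sum_norm hq.le _ _))
      have h4 := A.map_stepFun (fun v : ℕ → B => sqSum q (2 ^ M) v) (sqSum_zero hq.le _)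
        (fun i n => ((chainOp K)^[2 * n] b₀) i) x
      rw [hΦ, ← h4]
      congr 1
      funext n
      exact (A.map_stepFun (fun v : ℕ → B => v n) rfl
        (fun i n => ((chainOp K)^[2 * n] b₀) i) x).symm
    have hRm : ∀ n, AEStronglyMeasurable (fun x => ‖Z n x‖) μ := fun n =>
      (Lp.aestronglyMeasurable _).norm
    have hRle : eLpNorm R p μ ≤ ENNReal.ofReal ((2 ^ M + 1) * ((2 * N + 1) * δ)) := by
      have h1 : R = ∑ n ∈ Finset.range (2 ^ M + 1), fun x => ‖Z n x‖ := by
        funext x; simp [hR]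
      rw [h1]
      refine (eLpNorm_sum_le (fun n _ => hRm n) Fact.out).trans ?_
      have h2 : ∀ n ∈ Finset.range (2 ^ M + 1),
          eLpNorm (fun x => ‖Z n x‖) p μ ≤ ENNReal.ofReal ((2 * N + 1) * δ) := by
        intro n hn
        have hn' := Finset.mem_range.mp hn
        rw [eLpNorm_norm]
        have h3 := hgF (2 * n) (by omega)
        have h4 : ENNReal.ofReal ‖Z n‖ = eLpNorm (Z n) p μ := by
          rw [Lp.norm_def, ENNReal.ofReal_toReal (Lp.eLpNorm_ne_top _)]
        rw [← h4]
        refine ENNReal.ofReal_le_ofReal (h3.trans ?_)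
        have : ((2 * n : ℕ) : ℝ) ≤ N := by exact_mod_cast (by omega : 2 * n ≤ N)
        gcongr
      refine (Finset.sum_le_sum h2).trans (le_of_eq ?_)
      rw [Finset.sum_const, Finset.card_range, nsmul_eq_mul, ← ENNReal.ofReal_natCast,
        ← ENNReal.ofReal_mul (Nat.cast_nonneg _)]
      push_cast
      rfl
    have hRm' : AEStronglyMeasurable R μ := by
      have h1 : R = ∑ n ∈ Finset.range (2 ^ M + 1), fun x => ‖Z n x‖ := by
        funext x; simp [hR]
      rw [h1]
      exact Finset.aestronglyMeasurable_sum _ fun n _ => hRm n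
    refine (eLpNorm_mono_ae_real hle).trans ((eLpNorm_add_le
      (A.stronglyMeasurable_stepFun Φ).aestronglyMeasurable (hRm'.const_mul c) Fact.out).trans ?_)
    rw [ENNReal.ofReal_add (by positivity) (by positivity)]
    refine add_le_add hchain ?_
    have h5 : eLpNorm (fun x => c * R x) p μ = ENNReal.ofReal c * eLpNorm R p μ := by
      have := eLpNorm_const_smul c R p μ
      rw [Real.enorm_eq_ofReal hc0] at this
      exact this
    rw [h5, ENNReal.ofReal_mul hc0]
    exact mul_le_mul_right hRle _
  have hlim : Tendsto (fun δ : ℝ => ENNReal.ofReal (C ^ (1 / p.toReal) * (‖F‖ + δ)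
      + c * ((2 ^ M + 1) * ((2 * N + 1) * δ)))) (𝓝[>] 0)
      (𝓝 (ENNReal.ofReal (C ^ (1 / p.toReal) * (‖F‖ + 0)
      + c * ((2 ^ M + 1) * ((2 * N + 1) * 0))))) := by
    refine Tendsto.mono_left ?_ nhdsWithin_le_nhds
    refine (ENNReal.continuous_ofReal.comp ?_).tendsto 0
    fun_prop
  rw [mul_zero, mul_zero, mul_zero, add_zero, add_zero] at hlim
  refine ge_of_tendsto hlim ?_
  filter_upwards [self_mem_nhdsWithin] with δ hδ
  exact main δ hδ

end Discrete

/-! ### Diffusion semigroups on `L^p_B` -/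

section VectorExtensionComp

variable {Ω : Type*} [MeasurableSpace Ω] {μ : Measure Ω} {p : ℝ≥0∞} [Fact (1 ≤ p)]
  {B : Type*} [NormedAddCommGroup B] [NormedSpace ℝ B] [CompleteSpace B]

lemma vectorExtension_id (hp : p ≠ ∞) (f : Lp B p μ) :
    vectorExtension B (ContinuousLinearMap.id ℝ (Lp ℝ p μ)) f = f := by
  refine congrFun ((denseRange_tensorToLp hp).equalizer (ContinuousLinearMap.continuous _)
    continuous_id (funext fun z => ?_)) f
  simp only [Function.comp_apply, id]
  rw [vectorExtension_tensor hp _ fun _ h => h]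
  simp

lemma vectorExtension_comp (hp : p ≠ ∞) {Q R : Lp ℝ p μ →L[ℝ] Lp ℝ p μ}
    (hQ : ∀ f, 0 ≤ f → 0 ≤ Q f) (hR : ∀ f, 0 ≤ f → 0 ≤ R f) (f : Lp B p μ) :
    vectorExtension B (Q.comp R) f = vectorExtension B Q (vectorExtension B R f) := by
  refine congrFun ((denseRange_tensorToLp hp).equalizer (ContinuousLinearMap.continuous _)
    ((vectorExtension B Q).continuous.comp (vectorExtension B R).continuous)
    (funext fun z => ?_)) f
  simp only [Function.comp_apply]
  rw [vectorExtension_tensor hp _ fun g hg => hQ (R g) (hR g hg), vectorExtension_tensor hp _ hR,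
    vectorExtension_tensor hp _ hQ, ContinuousLinearMap.toLinearMap_comp, LinearMap.rTensor_comp,
    LinearMap.comp_apply]

lemma isClosed_tendsto_id {ι E : Type*} [NormedAddCommGroup E] [NormedSpace ℝ E] {l : Filter ι}
    {V : ι → E →L[ℝ] E} (hV : ∀ i, ‖V i‖ ≤ 1) : IsClosed {f | Tendsto (V · f) l (𝓝 f)} := by
  refine Equicontinuous.isClosed_setOfPred_tendsto (F := fun i f => V i f) (f := id)
    (UniformEquicontinuous.equicontinuous (LipschitzWith.uniformEquicontinuous _ 1 fun i => ?_))
    continuous_id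
  exact (V i).lipschitz.weaken (by exact_mod_cast hV i)

/-- Strong continuity passes from a family `Q` of positive contractions to `Q ⊗ Id_B`. -/
lemma tendsto_vectorExtension (hp : p ≠ ∞) {ι : Type*} {l : Filter ι}
    {Q : ι → Lp ℝ p μ →L[ℝ] Lp ℝ p μ} (hQ : ∀ i f, 0 ≤ f → 0 ≤ Q i f) (hQ1 : ∀ i, ‖Q i‖ ≤ 1)
    (hlim : ∀ f, Tendsto (Q · f) l (𝓝 f)) (f : Lp B p μ) :
    Tendsto (fun i => vectorExtension B (Q i) f) l (𝓝 f) := by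
  have hcl := isClosed_tendsto_id (l := l)
    fun i => (norm_vectorExtension_le (B := B) hp (Q i) (hQ i)).trans (hQ1 i)
  refine (denseRange_tensorToLp hp).induction_on (p := fun f =>
    Tendsto (fun i => vectorExtension B (Q i) f) l (𝓝 f)) f hcl fun z => ?_
  simp_rw [vectorExtension_tensor hp _ (hQ _)]
  induction z using TensorProduct.induction_on with
  | zero => simpa using tendsto_const_nhds
  | tmul φ b =>
    simp only [LinearMap.rTensor_tmul]
    exact (((ContinuousLinearMap.toSpanSingleton ℝ b).compLpL p μ).continuous.tendsto φ).comp
      (hlim φ)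
  | add x y hx hy =>
    simp only [map_add]
    exact hx.add hy

end VectorExtensionComp

namespace SymmetricDiffusionSemigroup

variable {Ω : Type*} [MeasurableSpace Ω] {μ : Measure Ω} (T : SymmetricDiffusionSemigroup μ)
  {p : ℝ≥0∞} [Fact (1 ≤ p)]

lemma norm_op_le_one (t : ℝ≥0) : ‖T.op p t‖ ≤ 1 :=
  ContinuousLinearMap.opNorm_le_bound _ zero_le_one fun f => by
    rw [one_mul]; exact T.norm_op_le p t f

/-- The sub-Markov property is contractivity on `L^∞`. -/
lemma op_le_one (t : ℝ≥0) {f : Lp ℝ p μ} (hf : 0 ≤ f) (hf1 : ∀ᵐ x ∂μ, f x ≤ 1) :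
    ∀ᵐ x ∂μ, T.op p t f x ≤ 1 := by
  have hb : ∀ᵐ x ∂μ, ‖f x‖ ≤ 1 := by
    filter_upwards [(Lp.coeFn_nonneg f).mpr hf, hf1] with x h1 h2
    rwa [Real.norm_of_nonneg h1]
  have hm : MemLp f ∞ μ := memLp_top_of_bound (Lp.aestronglyMeasurable f) 1 hb
  have h1 : ‖hm.toLp‖ ≤ 1 := by
    rw [Lp.norm_toLp]
    refine ENNReal.toReal_le_of_le_ofReal zero_le_one ?_
    rw [eLpNorm_exponent_top]
    exact eLpNormEssSup_le_of_ae_bound hb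
  have h2 := (T.norm_op_le ∞ t hm.toLp).trans h1
  have h3 : eLpNormEssSup (T.op ∞ t hm.toLp) μ ≤ 1 := by
    rw [Lp.norm_def, eLpNorm_exponent_top] at h2
    have h4 := Lp.eLpNorm_ne_top (T.op ∞ t hm.toLp)
    rw [eLpNorm_exponent_top] at h4
    exact (ENNReal.toReal_le_toReal h4 ENNReal.one_ne_top).mp (by simpa using h2)
  filter_upwards [T.op_compat p ∞ t f hm.toLp hm.coeFn_toLp.symm,
    enorm_ae_le_eLpNormEssSup (T.op ∞ t hm.toLp) μ] with x h5 h6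
  rw [h5]
  have h7 := h6.trans h3
  rw [← ofReal_norm, ENNReal.ofReal_le_one] at h7
  exact (Real.le_norm_self _).trans h7

lemma indicatorConstLp_ae_eq (p r : ℝ≥0∞) {s : Set Ω} (hs : MeasurableSet s) (hμs : μ s ≠ ∞)
    (c : ℝ) : indicatorConstLp p hs hμs c =ᵐ[μ] indicatorConstLp r hs hμs c :=
  indicatorConstLp_coeFn.trans indicatorConstLp_coeFn.symm

/-- Symmetry of the semigroup, transferred from `L^2` to `L^p` by consistency. -/
lemma setIntegral_op_indicator_comm (t : ℝ≥0) (s u : Set Ω) (hs : MeasurableSet s)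
    (hu : MeasurableSet u) (hμs : μ s ≠ ∞) (hμu : μ u ≠ ∞) :
    ∫ x in s, T.op p t (indicatorConstLp p hu hμu 1) x ∂μ
      = ∫ x in u, T.op p t (indicatorConstLp p hs hμs 1) x ∂μ := by
  have key : ∀ {v w : Set Ω} (hv : MeasurableSet v) (hw : MeasurableSet w) (hμv : μ v ≠ ∞)
      (hμw : μ w ≠ ∞), ∫ x in v, T.op p t (indicatorConstLp p hw hμw 1) x ∂μ
        = inner ℝ (indicatorConstLp 2 hv hμv (1 : ℝ)) (T.op 2 t (indicatorConstLp 2 hw hμw 1)) := by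
    intro v w hv hw hμv hμw
    rw [L2.inner_indicatorConstLp_one hv hμv]
    exact integral_congr_ae (ae_restrict_of_ae
      (T.op_compat p 2 t _ _ (indicatorConstLp_ae_eq p 2 hw hμw 1)))
  rw [key hs hu hμs hμu, key hu hs hμu hμs, ← T.op_symm, real_inner_comm]

omit [Fact (1 ≤ p)] in
lemma zero_le_indicatorConstLp_one {s : Set Ω} (hs : MeasurableSet s) (hμs : μ s ≠ ∞) :
    0 ≤ indicatorConstLp p hs hμs (1 : ℝ) := by
  rw [← Lp.coeFn_nonneg]
  filter_upwards [indicatorConstLp_coeFn (p := p) (hs := hs) (hμs := hμs) (c := (1 : ℝ))]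
    with x hx
  rw [hx]
  exact indicator_nonneg (fun _ _ => zero_le_one) x

/-- Strong continuity of the semigroup at indicator functions. Since `u = T_t 1_s - 1_s` satisfies
`|u| ≤ 1` and `‖u‖_1 ≤ 2 μ(s)`, the bound `|u|^p ≤ l^(p-1) |u| + l^(-2) |u|^2` reduces the claim
to the continuity on `L^2`. -/
lemma tendsto_op_indicator (hp : 1 < p) (hp' : p ≠ ∞) {s : Set Ω} (hs : MeasurableSet s)
    (hμs : μ s ≠ ∞) :
    Tendsto (fun t => T.op p t (indicatorConstLp p hs hμs 1)) (𝓝 0)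
      (𝓝 (indicatorConstLp p hs hμs 1)) := by
  have hp0 : p ≠ 0 := (zero_lt_one.trans hp).ne'
  have hpr : 1 < p.toReal := by
    have := (ENNReal.toReal_lt_toReal ENNReal.one_ne_top hp').mpr hp
    simpa using this
  have hpr0 : 0 < p.toReal := by linarith
  set φ : ∀ r : ℝ≥0∞, Lp ℝ r μ := fun r => indicatorConstLp r hs hμs 1 with hφ
  set u : ∀ (r : ℝ≥0∞) [Fact (1 ≤ r)], ℝ≥0 → Lp ℝ r μ := fun r _ t => T.op r t (φ r) - φ r with hu
  have hu_eq : ∀ (r : ℝ≥0∞) [Fact (1 ≤ r)] (t : ℝ≥0), u p t =ᵐ[μ] u r t := by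
    intro r _ t
    filter_upwards [Lp.coeFn_sub (T.op p t (φ p)) (φ p), Lp.coeFn_sub (T.op r t (φ r)) (φ r),
      T.op_compat p r t _ _ (indicatorConstLp_ae_eq p r hs hμs 1),
      indicatorConstLp_ae_eq p r hs hμs 1] with x h1 h2 h3 h4
    rw [hu, h1, h2, Pi.sub_apply, Pi.sub_apply, h3, h4]
  have hu1 : ∀ t, ∀ᵐ x ∂μ, ‖u p t x‖ₑ ≤ 1 := by
    intro t
    have h0 : 0 ≤ φ p := zero_le_indicatorConstLp_one hs hμs
    have hle : ∀ᵐ x ∂μ, φ p x ≤ 1 := by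
      filter_upwards [indicatorConstLp_coeFn (p := p) (hs := hs) (hμs := hμs) (c := (1 : ℝ))]
        with x hx
      rw [hφ, hx]
      exact indicator_le' (fun _ _ => le_rfl) (fun _ _ => zero_le_one) x
    filter_upwards [Lp.coeFn_sub (T.op p t (φ p)) (φ p), (Lp.coeFn_nonneg _).mpr h0, hle,
      (Lp.coeFn_nonneg _).mpr (T.op_nonneg p t _ h0), T.op_le_one t h0 hle] with x h1 h2 h3 h4 h5
    rw [hu, h1, Pi.sub_apply, ← ofReal_norm, ENNReal.ofReal_le_one, Real.norm_eq_abs, abs_le]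
    simp only [Pi.zero_apply] at h2 h4
    constructor <;> linarith
  have hL1 : ∀ t, ∫⁻ x, ‖u p t x‖ₑ ∂μ ≤ 2 * μ s := by
    intro t
    have h1 : ‖u 1 t‖ ≤ 2 * μ.real s := by
      have h2 : ‖φ 1‖ = μ.real s := by
        simp [hφ, norm_indicatorConstLp one_ne_zero ENNReal.one_ne_top]
      have := T.norm_op_le 1 t (φ 1)
      refine (norm_sub_le _ _).trans ?_
      linarith
    calc ∫⁻ x, ‖u p t x‖ₑ ∂μ = eLpNorm (u 1 t) 1 μ := by
          rw [eLpNorm_one_eq_lintegral_enorm]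
          refine lintegral_congr_ae ?_
          filter_upwards [hu_eq 1 t] with x hx
          rw [hx]
      _ = ENNReal.ofReal ‖u 1 t‖ := by
          rw [Lp.norm_def, ENNReal.ofReal_toReal (Lp.eLpNorm_ne_top _)]
      _ ≤ ENNReal.ofReal (2 * μ.real s) := ENNReal.ofReal_le_ofReal h1
      _ = 2 * μ s := by
          rw [ENNReal.ofReal_mul zero_le_two, measureReal_def, ENNReal.ofReal_toReal hμs]
          simp
  have hL2 : Tendsto (fun t => ∫⁻ x, ‖u p t x‖ₑ ^ (2 : ℝ) ∂μ) (𝓝 0) (𝓝 0) := by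
    have h1 := (Lp.tendsto_Lp_iff_tendsto_eLpNorm' _ _).mp (T.tendsto_op (φ 2))
    have h2 := (ENNReal.continuous_rpow_const (y := 2)).tendsto 0 |>.comp h1
    rw [ENNReal.zero_rpow_of_pos two_pos] at h2
    refine h2.congr fun t => ?_
    simp only [Function.comp_apply]
    have h3 : eLpNorm (⇑(T.op 2 t (φ 2)) - ⇑(φ 2)) 2 μ = eLpNorm (u p t) 2 μ :=
      eLpNorm_congr_ae ((Lp.coeFn_sub _ _).symm.trans (hu_eq 2 t).symm)
    rw [h3, eLpNorm_eq_lintegral_rpow_enorm_toReal two_ne_zero ENNReal.ofNat_ne_top,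
      ← ENNReal.rpow_mul]
    simp
  have hbound : ∀ l : ℝ≥0∞, l ≠ 0 → l ≠ ∞ → ∀ t, ∫⁻ x, ‖u p t x‖ₑ ^ p.toReal ∂μ
      ≤ l ^ (p.toReal - 1) * (2 * μ s) + l⁻¹ ^ (2 : ℝ) * ∫⁻ x, ‖u p t x‖ₑ ^ (2 : ℝ) ∂μ := by
    intro l hl0 hl t
    have hpt : ∀ a : ℝ≥0∞, a ≤ 1 →
        a ^ p.toReal ≤ l ^ (p.toReal - 1) * a + l⁻¹ ^ (2 : ℝ) * a ^ (2 : ℝ) := by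
      intro a ha
      rcases le_total a l with h | h
      · refine le_trans ?_ le_self_add
        calc a ^ p.toReal = a ^ (p.toReal - 1 + 1) := by rw [sub_add_cancel]
          _ = a ^ (p.toReal - 1) * a := by
            rw [ENNReal.rpow_add_of_nonneg _ _ (by linarith) zero_le_one, ENNReal.rpow_one]
          _ ≤ _ := by
            gcongr
      · refine le_trans ?_ le_add_self
        calc a ^ p.toReal ≤ 1 := ENNReal.rpow_le_one ha hpr0.le
          _ = l⁻¹ ^ (2 : ℝ) * l ^ (2 : ℝ) := by
            rw [← ENNReal.mul_rpow_of_nonneg _ _ zero_le_two, ENNReal.inv_mul_cancel hl0 hl,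
              ENNReal.one_rpow]
          _ ≤ _ := by gcongr
    have hm : AEMeasurable (fun x => ‖u p t x‖ₑ) μ := (Lp.aestronglyMeasurable _).enorm
    calc ∫⁻ x, ‖u p t x‖ₑ ^ p.toReal ∂μ
        ≤ ∫⁻ x, (l ^ (p.toReal - 1) * ‖u p t x‖ₑ + l⁻¹ ^ (2 : ℝ) * ‖u p t x‖ₑ ^ (2 : ℝ)) ∂μ := by
          refine lintegral_mono_ae ?_
          filter_upwards [hu1 t] with x hx
          exact hpt _ hx
      _ = l ^ (p.toReal - 1) * ∫⁻ x, ‖u p t x‖ₑ ∂μ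
          + l⁻¹ ^ (2 : ℝ) * ∫⁻ x, ‖u p t x‖ₑ ^ (2 : ℝ) ∂μ := by
          rw [lintegral_add_left' (hm.const_mul _), lintegral_const_mul'' _ hm,
            lintegral_const_mul'' _ (hm.pow_const _)]
      _ ≤ _ := by
          gcongr
          exact hL1 t
  have hLp : Tendsto (fun t => ∫⁻ x, ‖u p t x‖ₑ ^ p.toReal ∂μ) (𝓝 0) (𝓝 0) := by
    rw [ENNReal.tendsto_nhds_zero]
    intro ε hε
    have h1 : Tendsto (fun l : ℝ≥0∞ => l ^ (p.toReal - 1) * (2 * μ s)) (𝓝[>] 0) (𝓝 0) := by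
      have h2 : Tendsto (fun l : ℝ≥0∞ => l ^ (p.toReal - 1)) (𝓝[>] 0) (𝓝 0) := by
        have := (ENNReal.continuous_rpow_const (y := p.toReal - 1)).tendsto 0
        rw [ENNReal.zero_rpow_of_pos (by linarith)] at this
        exact this.mono_left nhdsWithin_le_nhds
      have h3 := ENNReal.Tendsto.mul_const (b := 2 * μ s) h2
        (Or.inr (ENNReal.mul_ne_top ENNReal.ofNat_ne_top hμs))
      rwa [zero_mul] at h3
    have hε2 : 0 < ε / 2 := ENNReal.half_pos hε.ne'
    obtain ⟨l, hl1, hl2, hl3⟩ := ((ENNReal.tendsto_nhds_zero.mp h1 _ hε2).and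
      (Ioo_mem_nhdsGT (zero_lt_one' ℝ≥0∞))).exists
    have hl0 : l ≠ 0 := hl2.ne'
    have h4 : Tendsto (fun t => l⁻¹ ^ (2 : ℝ) * ∫⁻ x, ‖u p t x‖ₑ ^ (2 : ℝ) ∂μ) (𝓝 0) (𝓝 0) := by
      have := ENNReal.Tendsto.const_mul (a := l⁻¹ ^ (2 : ℝ)) hL2
        (Or.inr (ENNReal.rpow_ne_top_of_nonneg zero_le_two (ENNReal.inv_ne_top.mpr hl0)))
      rwa [mul_zero] at this
    filter_upwards [ENNReal.tendsto_nhds_zero.mp h4 _ hε2] with t ht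
    calc _ ≤ _ := hbound l hl0 (hl3.trans ENNReal.one_lt_top).ne t
      _ ≤ ε / 2 + ε / 2 := add_le_add hl1 ht
      _ = ε := ENNReal.add_halves ε
  rw [Lp.tendsto_Lp_iff_tendsto_eLpNorm']
  have h1 := (ENNReal.continuous_rpow_const (y := 1 / p.toReal)).tendsto 0 |>.comp hLp
  rw [ENNReal.zero_rpow_of_pos (by positivity)] at h1
  refine h1.congr fun t => ?_
  simp only [Function.comp_apply]
  rw [← eLpNorm_eq_lintegral_rpow_enorm_toReal hp0 hp']
  exact eLpNorm_congr_ae (Lp.coeFn_sub _ _)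

lemma tendsto_op_Lp (hp : 1 < p) (hp' : p ≠ ∞) (f : Lp ℝ p μ) :
    Tendsto (fun t => T.op p t f) (𝓝 0) (𝓝 f) := by
  refine Lp.induction hp' (motive := fun f => Tendsto (fun t => T.op p t f) (𝓝 0) (𝓝 f)) ?_ ?_
    ?_ f
  · intro c s hs hμs
    rw [Lp.simpleFunc.coe_indicatorConst]
    have h1 : indicatorConstLp p hs hμs.ne c = c • indicatorConstLp p hs hμs.ne (1 : ℝ) := by
      refine Lp.ext ?_
      filter_upwards [Lp.coeFn_smul c (indicatorConstLp p hs hμs.ne (1 : ℝ)),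
        indicatorConstLp_coeFn (p := p) (hs := hs) (hμs := hμs.ne) (c := (1 : ℝ)),
        indicatorConstLp_coeFn (p := p) (hs := hs) (hμs := hμs.ne) (c := c)] with x h1 h2 h3
      rw [h1, Pi.smul_apply, h2, h3]
      by_cases hx : x ∈ s <;> simp [hx]
    rw [h1]
    simp only [map_smul]
    exact (T.tendsto_op_indicator hp hp' hs hμs.ne).const_smul c
  · intro f g hf hg _ h1 h2
    simp only [map_add]
    exact h1.add h2
  · exact isClosed_tendsto_id fun t => T.norm_op_le_one t

section Vector

variable {B : Type*} [NormedAddCommGroup B] [NormedSpace ℝ B] [CompleteSpace B]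

lemma norm_vectorOp_le_one (hp' : p ≠ ∞) (s : ℝ) : ‖T.vectorOp (p := p) (B := B) s‖ ≤ 1 :=
  (norm_vectorExtension_le hp' _ (T.op_nonneg p _)).trans (T.norm_op_le_one _)

lemma vectorOp_zero (hp' : p ≠ ∞) (f : Lp B p μ) : T.vectorOp 0 f = f := by
  have : T.op p (0 : ℝ).toNNReal = ContinuousLinearMap.id ℝ _ := by
    ext1 g
    rw [Real.toNNReal_zero, T.op_zero]
    rfl
  rw [vectorOp, this, vectorExtension_id hp']

lemma vectorOp_add (hp' : p ≠ ∞) {s t : ℝ} (hs : 0 ≤ s) (ht : 0 ≤ t) (f : Lp B p μ) :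
    T.vectorOp (s + t) f = T.vectorOp s (T.vectorOp t f) := by
  have : T.op p (s + t).toNNReal = (T.op p s.toNNReal).comp (T.op p t.toNNReal) := by
    ext1 g
    rw [Real.toNNReal_add hs ht, T.op_add]
    rfl
  rw [vectorOp, this, vectorExtension_comp hp' (T.op_nonneg p _) (T.op_nonneg p _)]
  rfl

lemma vectorOp_natCast_mul (hp' : p ≠ ∞) {s : ℝ} (hs : 0 ≤ s) (n : ℕ) (f : Lp B p μ) :
    T.vectorOp (n * s) f = (vectorExtension B (T.op p s.toNNReal))^[n] f := by
  induction n with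
  | zero => simpa using T.vectorOp_zero hp' f
  | succ n ih =>
    rw [Nat.cast_succ, add_mul, one_mul, add_comm, T.vectorOp_add hp' hs (by positivity), ih,
      Function.iterate_succ_apply']
    rfl

lemma vectorOp_max_zero (s : ℝ) (f : Lp B p μ) : T.vectorOp (max s 0) f = T.vectorOp s f := by
  rw [vectorOp, vectorOp]
  congr 3
  simp [Real.toNNReal]

/-- Uniform continuity on the whole line; for negative times the curve is constant. -/
lemma uniformContinuous_vectorOp (hp : 1 < p) (hp' : p ≠ ∞) (f : Lp B p μ) :
    UniformContinuous fun s => T.vectorOp s f := by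
  rw [Metric.uniformContinuous_iff]
  intro ε hε
  have h1 : Tendsto (fun t : ℝ≥0 => vectorExtension B (T.op p t) f) (𝓝 0) (𝓝 f) :=
    tendsto_vectorExtension hp' (T.op_nonneg p) T.norm_op_le_one (T.tendsto_op_Lp hp hp') f
  obtain ⟨δ, hδ, h2⟩ := (Metric.tendsto_nhds_nhds.mp h1) ε hε
  refine ⟨δ, hδ, ?_⟩
  have key : ∀ s t : ℝ, 0 ≤ s → s ≤ t → t - s < δ →
      dist (T.vectorOp t f) (T.vectorOp s f) < ε := by
    intro s t hs hst h
    have h3 : T.vectorOp t f = T.vectorOp s (T.vectorOp (t - s) f) := by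
      rw [← T.vectorOp_add hp' hs (sub_nonneg.mpr hst), add_sub_cancel]
    have h4 : dist (T.vectorOp (t - s) f) f < ε := by
      refine h2 (x := (t - s).toNNReal) ?_
      rw [NNReal.dist_eq, NNReal.coe_zero, sub_zero, Real.coe_toNNReal _ (sub_nonneg.mpr hst),
        abs_of_nonneg (sub_nonneg.mpr hst)]
      exact h
    rw [dist_eq_norm] at h4 ⊢
    rw [h3, ← map_sub]
    refine lt_of_le_of_lt ((ContinuousLinearMap.le_opNorm _ _).trans ?_) h4
    exact mul_le_of_le_one_left (norm_nonneg _) (T.norm_vectorOp_le_one hp' s)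
  intro a b hab
  rw [← T.vectorOp_max_zero a, ← T.vectorOp_max_zero b]
  have h5 : |max a 0 - max b 0| < δ := lt_of_le_of_lt (abs_max_sub_max_le_abs a b 0) hab
  rcases le_total (max a 0) (max b 0) with h | h
  · rw [dist_comm]
    refine key _ _ (le_max_right _ _) h (lt_of_le_of_lt (le_abs_self _) ?_)
    rwa [abs_sub_comm]
  · exact key _ _ (le_max_right _ _) h (lt_of_le_of_lt (le_abs_self _) h5)

end Vector

end SymmetricDiffusionSemigroup

/-- The square function inequality along the discrete skeleton `T_{nε}`, `n ≥ 0`, of a symmetric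
diffusion semigroup. -/
theorem HasMartingaleCotype.exists_skeleton_bound {B : Type*} [NormedAddCommGroup B]
    [NormedSpace ℝ B] [CompleteSpace B] {q : ℝ} (hq : 1 < q) (hB : HasMartingaleCotype B q)
    {p : ℝ≥0∞} [Fact (1 ≤ p)] (hp : 1 < p) (hp' : p ≠ ∞) :
    ∃ C : ℝ, 0 ≤ C ∧ ∀ (Ω : Type*) [MeasurableSpace Ω] (μ : Measure Ω)
      (T : SymmetricDiffusionSemigroup μ) (f : Lp B p μ) (ε : ℝ), 0 ≤ ε → ∀ M : ℕ,
        eLpNorm (fun x => sqSum q (2 ^ M) (fun n => T.vectorOp (n * ε) f x)) p μ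
          ≤ ENNReal.ofReal (C * ‖f‖) := by
  obtain ⟨C, hC, h⟩ := hB.exists_discrete_bound hq hp hp'
  refine ⟨C, hC, fun Ω _ μ T f ε hε M => ?_⟩
  have h1 := h Ω μ (T.op p (ε / 2).toNNReal) (T.op_nonneg p _) (T.norm_op_le_one _)
    (fun f hf hf1 => T.op_le_one _ hf hf1)
    (fun s t hs ht hμs hμt => T.setIntegral_op_indicator_comm _ s t hs ht hμs hμt) f M
  have h2 : ∀ n : ℕ, T.vectorOp (n * ε) f
      = (vectorExtension B (T.op p (ε / 2).toNNReal))^[2 * n] f := fun n => by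
    rw [← T.vectorOp_natCast_mul hp' (by positivity)]
    congr 2
    push_cast
    ring
  simp_rw [h2]
  exact h1

/-! ### Averages of trajectories and their step approximations -/

section Trajectory

variable {E : Type*} [NormedAddCommGroup E] [NormedSpace ℝ E]

omit [NormedSpace ℝ E] in
lemma stronglyMeasurable_comp_natCeil_div (g : ℕ → E) (ε : ℝ) :
    StronglyMeasurable fun s : ℝ => g ⌈s / ε⌉₊ :=
  (StronglyMeasurable.of_discrete (f := g)).comp_measurable
    (Nat.measurable_ceil.comp (measurable_id.div_const ε))

omit [NormedSpace ℝ E] in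
lemma integrableOn_comp_natCeil_div (g : ℕ → E) {ε : ℝ} (hε : 0 < ε) (R : ℝ) :
    IntegrableOn (fun s : ℝ => g ⌈s / ε⌉₊) (Ioc 0 R) := by
  refine Measure.integrableOn_of_bounded (M := ∑ j ∈ Finset.range (⌈R / ε⌉₊ + 1), ‖g j‖)
    measure_Ioc_lt_top.ne (stronglyMeasurable_comp_natCeil_div g ε).aestronglyMeasurable ?_
  refine (ae_restrict_iff' measurableSet_Ioc).mpr (Eventually.of_forall fun s hs => ?_)
  refine Finset.single_le_sum (f := fun j => ‖g j‖) (fun _ _ => norm_nonneg _)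
    (Finset.mem_range.mpr (Nat.lt_succ_of_le (Nat.ceil_le_ceil ?_)))
  exact div_le_div_of_nonneg_right hs.2 hε.le

lemma natCeil_div_eq {ε s : ℝ} (hε : 0 < ε) {n : ℕ} (h1 : n * ε < s) (h2 : s ≤ (n + 1 : ℕ) * ε) :
    ⌈s / ε⌉₊ = n + 1 := by
  rw [Nat.ceil_eq_iff n.succ_ne_zero]
  exact ⟨(lt_div_iff₀ hε).mpr h1, (div_le_iff₀ hε).mpr h2⟩

lemma le_natCeil_div_mul {ε t : ℝ} (hε : 0 < ε) : t ≤ ⌈t / ε⌉₊ * ε :=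
  (div_le_iff₀ hε).mp (Nat.le_ceil _)

lemma natCeil_div_mul_le {ε t : ℝ} (hε : 0 < ε) (ht : 0 ≤ t) : ⌈t / ε⌉₊ * ε ≤ t + ε := by
  have h1 := (Nat.ceil_lt_add_one (div_nonneg ht hε.le)).le
  calc ⌈t / ε⌉₊ * ε ≤ (t / ε + 1) * ε := by gcongr
    _ = t + ε := by field_simp

lemma tendsto_natCeil_div_mul {ε : ℕ → ℝ} (hε : ∀ k, 0 < ε k) (hlim : Tendsto ε atTop (𝓝 0))
    {t : ℝ} (ht : 0 ≤ t) : Tendsto (fun k => ⌈t / ε k⌉₊ * ε k) atTop (𝓝 t) := by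
  refine tendsto_of_tendsto_of_tendsto_of_le_of_le tendsto_const_nhds
    (by simpa using hlim.const_add t) (fun k => le_natCeil_div_mul (hε k))
    (fun k => natCeil_div_mul_le (hε k) ht)

variable [CompleteSpace E]

lemma integral_comp_natCeil_div (g : ℕ → E) {ε : ℝ} (hε : 0 < ε) (n : ℕ) :
    ∫ s in (0 : ℝ)..n * ε, g ⌈s / ε⌉₊ = ε • ∑ j ∈ Finset.range n, g (j + 1) := by
  have hmono : ∀ k : ℕ, (k : ℝ) * ε ≤ (k + 1 : ℕ) * ε := fun k => by
    gcongr; exact k.le_succ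
  have h1 : ∀ k < n, IntervalIntegrable (fun s : ℝ => g ⌈s / ε⌉₊) volume (k * ε)
      ((k + 1 : ℕ) * ε) := fun k _ => by
    rw [intervalIntegrable_iff_integrableOn_Ioc_of_le (hmono k)]
    exact (integrableOn_comp_natCeil_div g hε _).mono_set
      (Ioc_subset_Ioc_left (by positivity))
  have h2 := intervalIntegral.sum_integral_adjacent_intervals (a := fun k : ℕ => (k : ℝ) * ε) h1
  rw [Nat.cast_zero, zero_mul] at h2
  rw [← h2, Finset.smul_sum]
  refine Finset.sum_congr rfl fun k _ => ?_
  rw [intervalIntegral.integral_of_le (hmono k),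
    setIntegral_congr_fun (g := fun _ => g (k + 1)) measurableSet_Ioc
      fun s hs => congrArg g (natCeil_div_eq hε hs.1 hs.2)]
  rw [setIntegral_const, measureReal_def, Real.volume_Ioc,
    ENNReal.toReal_ofReal (sub_nonneg.mpr (hmono k))]
  congr 1
  push_cast
  ring

lemma average_comp_natCeil_div (g : ℕ → E) {ε : ℝ} (hε : 0 < ε) (n : ℕ) :
    (n : ℝ)⁻¹ • ∑ j ∈ Finset.range n, g (j + 1)
      = (n * ε)⁻¹ • ∫ s in (0 : ℝ)..n * ε, g ⌈s / ε⌉₊ := by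
  rw [integral_comp_natCeil_div g hε, smul_smul, mul_inv, mul_assoc, inv_mul_cancel₀ hε.ne',
    mul_one]

/-- If step functions converge in `L^1_loc`, then so do their averages at lattice points. -/
lemma tendsto_average_comp_natCeil_div {g : ℕ → ℕ → E} {ε : ℕ → ℝ} (hε : ∀ k, 0 < ε k)
    (hlim : Tendsto ε atTop (𝓝 0)) {h : ℝ → E} (hh : LocallyIntegrable h)
    (hconv : ∀ R : ℕ,
      Tendsto (fun k => ∫⁻ s in Ioc (0 : ℝ) R, ‖g k ⌈s / ε k⌉₊ - h s‖ₑ) atTop (𝓝 0))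
    {t : ℝ} (ht : 0 < t) :
    Tendsto (fun k => (⌈t / ε k⌉₊ : ℝ)⁻¹ • ∑ j ∈ Finset.range ⌈t / ε k⌉₊, g k (j + 1)) atTop
      (𝓝 (t⁻¹ • ∫ s in (0 : ℝ)..t, h s)) := by
  have hint : ∀ a b, IntervalIntegrable h volume a b := fun a b =>
    intervalIntegrable_iff.mpr
      ((hh.integrableOn_isCompact isCompact_uIcc).mono_set uIoc_subset_uIcc)
  have hT := tendsto_natCeil_div_mul hε hlim ht.le
  refine Tendsto.congr (fun k => (average_comp_natCeil_div (g k) (hε k) _).symm)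
    ((hT.inv₀ ht.ne').smul ?_)
  have h1 : Tendsto (fun k => ∫ s in (0 : ℝ)..⌈t / ε k⌉₊ * ε k, h s) atTop
      (𝓝 (∫ s in (0 : ℝ)..t, h s)) :=
    ((intervalIntegral.continuous_primitive hint 0).tendsto t).comp hT
  obtain ⟨R, hR⟩ := exists_nat_gt t
  have h2 : Tendsto (fun k => (∫ s in (0 : ℝ)..⌈t / ε k⌉₊ * ε k, g k ⌈s / ε k⌉₊)
      - ∫ s in (0 : ℝ)..⌈t / ε k⌉₊ * ε k, h s) atTop (𝓝 0) := by
    rw [tendsto_zero_iff_enorm_tendsto_zero]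
    refine tendsto_of_tendsto_of_tendsto_of_le_of_le' tendsto_const_nhds (hconv R)
      (Eventually.of_forall fun _ => zero_le) ?_
    filter_upwards [hT.eventually (gt_mem_nhds hR)] with k hk
    have h0 : (0 : ℝ) ≤ ⌈t / ε k⌉₊ * ε k := mul_nonneg (Nat.cast_nonneg _) (hε k).le
    rw [← intervalIntegral.integral_sub
      ((intervalIntegrable_iff_integrableOn_Ioc_of_le h0).mpr
        (integrableOn_comp_natCeil_div _ (hε k) _)) (hint _ _),
      intervalIntegral.integral_of_le h0]
    exact (enorm_integral_le_lintegral_enorm _).trans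
      (lintegral_mono_set (Ioc_subset_Ioc_right hk.le))
  simpa using h2.add h1

section Limit

variable {α : Type*} [MeasurableSpace α] {ν : Measure α} {h : ℕ → α → E}

omit [NormedSpace ℝ E] in
/-- A fast Cauchy sequence in `L^1` converges almost everywhere. -/
lemma ae_tendsto_limUnder_of_tsum_lintegral_ne_top (hm : ∀ k, AEStronglyMeasurable (h k) ν)
    (hsum : ∑' k, ∫⁻ s, ‖h (k + 1) s - h k s‖ₑ ∂ν ≠ ∞) [Nonempty E] :
    ∀ᵐ s ∂ν, Tendsto (h · s) atTop (𝓝 (limUnder atTop (h · s))) := by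
  have hm' : ∀ k, AEMeasurable (fun s => ‖h (k + 1) s - h k s‖ₑ) ν :=
    fun k => ((hm (k + 1)).sub (hm k)).enorm
  rw [← lintegral_tsum hm'] at hsum
  filter_upwards [ae_lt_top' (AEMeasurable.tsum hm') hsum] with s hs
  refine (cauchySeq_of_edist_le_of_tsum_ne_top (fun k => ‖h (k + 1) s - h k s‖ₑ)
    (fun k => ?_) hs.ne).tendsto_limUnder
  rw [edist_comm, edist_eq_enorm_sub]

omit [NormedSpace ℝ E] [CompleteSpace E] in
lemma tendsto_lintegral_enorm_sub (hm : ∀ k, AEStronglyMeasurable (h k) ν)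
    (hsum : ∑' k, ∫⁻ s, ‖h (k + 1) s - h k s‖ₑ ∂ν ≠ ∞) {g : α → E}
    (hg : ∀ᵐ s ∂ν, Tendsto (h · s) atTop (𝓝 (g s))) :
    Tendsto (fun k => ∫⁻ s, ‖h k s - g s‖ₑ ∂ν) atTop (𝓝 0) := by
  have htail := ENNReal.tendsto_sum_nat_add _ hsum
  refine tendsto_of_tendsto_of_tendsto_of_le_of_le tendsto_const_nhds htail
    (fun _ => zero_le) fun k => ?_
  calc ∫⁻ s, ‖h k s - g s‖ₑ ∂ν
      ≤ ∫⁻ s, ∑' j, ‖h (k + j + 1) s - h (k + j) s‖ₑ ∂ν := by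
        refine lintegral_mono_ae ?_
        filter_upwards [hg] with s hs
        have := edist_le_tsum_of_edist_le_of_tendsto (fun k => ‖h (k + 1) s - h k s‖ₑ)
          (fun k => by rw [edist_comm, edist_eq_enorm_sub]) hs k
        rwa [edist_eq_enorm_sub] at this
    _ = ∑' j, ∫⁻ s, ‖h (k + j + 1) s - h (k + j) s‖ₑ ∂ν :=
        lintegral_tsum fun j => ((hm _).sub (hm _)).enorm
    _ = _ := by simp_rw [add_comm k]

end Limit

lemma ae_restrict_Ioi_of_forall_nat {P : ℝ → Prop}
    (h : ∀ R : ℕ, ∀ᵐ s ∂(volume.restrict (Ioc (0 : ℝ) R)), P s) :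
    ∀ᵐ s ∂(volume.restrict (Ioi (0 : ℝ))), P s := by
  have : Ioi (0 : ℝ) = ⋃ R : ℕ, Ioc (0 : ℝ) R := by
    ext s
    simp only [mem_Ioi, mem_iUnion, mem_Ioc, exists_and_left]
    exact ⟨fun hs => ⟨hs, exists_nat_ge s⟩, fun hs => hs.1⟩
  rw [this, ae_restrict_iUnion_eq]
  simpa using h

/-- Step functions which form a fast Cauchy sequence in `L^1_loc` have a locally integrable
limit. -/
lemma exists_limit_of_tsum_lintegral_ne_top {g : ℕ → ℕ → E} {ε : ℕ → ℝ} (hε : ∀ k, 0 < ε k)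
    (hlim : Tendsto ε atTop (𝓝 0))
    (hsum : ∀ R : ℕ, ∑' k, ∫⁻ s in Ioc (0 : ℝ) R,
      ‖g (k + 1) ⌈s / ε (k + 1)⌉₊ - g k ⌈s / ε k⌉₊‖ₑ ≠ ∞) :
    ∃ h : ℝ → E, LocallyIntegrable h ∧
      (∀ᵐ s ∂(volume.restrict (Ioi (0 : ℝ))),
        Tendsto (fun k => g k ⌈s / ε k⌉₊) atTop (𝓝 (h s))) ∧
      ∀ t, 0 < t → Tendsto (fun k => (⌈t / ε k⌉₊ : ℝ)⁻¹ •
        ∑ j ∈ Finset.range ⌈t / ε k⌉₊, g k (j + 1)) atTop (𝓝 (t⁻¹ • ∫ s in (0 : ℝ)..t, h s)) := by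
  set G : ℕ → ℝ → E := fun k s => g k ⌈s / ε k⌉₊ with hG
  have hm : ∀ (R : ℕ) k, AEStronglyMeasurable (G k) (volume.restrict (Ioc (0 : ℝ) R)) :=
    fun R k => (stronglyMeasurable_comp_natCeil_div _ _).aestronglyMeasurable
  set h : ℝ → E := (Ioi (0 : ℝ)).indicator fun s => limUnder atTop (G · s) with hh
  have hae : ∀ R : ℕ, ∀ᵐ s ∂(volume.restrict (Ioc (0 : ℝ) R)),
      Tendsto (G · s) atTop (𝓝 (h s)) := by
    intro R
    filter_upwards [ae_tendsto_limUnder_of_tsum_lintegral_ne_top (hm R) (hsum R),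
      ae_restrict_mem measurableSet_Ioc] with s hs hs'
    rwa [hh, indicator_of_mem (mem_Ioi.mpr hs'.1)]
  have hconv : ∀ R : ℕ, Tendsto (fun k => ∫⁻ s in Ioc (0 : ℝ) R, ‖G k s - h s‖ₑ) atTop (𝓝 0) :=
    fun R => tendsto_lintegral_enorm_sub (hm R) (hsum R) (hae R)
  have hint : ∀ R : ℕ, IntegrableOn h (Ioc (0 : ℝ) R) := by
    intro R
    have hmh : AEStronglyMeasurable h (volume.restrict (Ioc (0 : ℝ) R)) :=
      aestronglyMeasurable_of_tendsto_ae atTop (hm R) (hae R)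
    obtain ⟨k, hk⟩ := ((ENNReal.tendsto_nhds_zero.mp (hconv R)) 1 one_pos).exists
    have h1 : Integrable (fun s => G k s - h s) (volume.restrict (Ioc (0 : ℝ) R)) :=
      ⟨(hm R k).sub hmh, hk.trans_lt ENNReal.one_lt_top⟩
    have h2 := (integrableOn_comp_natCeil_div (g k) (hε k) R).sub h1
    refine h2.congr (Eventually.of_forall fun s => ?_)
    simp [hG]
  have hloc : LocallyIntegrable h := by
    rw [locallyIntegrable_iff]
    intro K hK
    obtain ⟨b, hb⟩ := hK.bddAbove
    obtain ⟨R, hR⟩ := exists_nat_ge b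
    have h1 : IntegrableOn h (Iic 0) :=
      integrableOn_zero.congr_fun (fun s hs => by
        rw [hh, indicator_of_notMem (by simpa using hs)]) measurableSet_Iic
    refine (h1.union (hint R)).mono_set fun s hs => ?_
    rcases le_or_gt s 0 with h0 | h0
    · exact Or.inl h0
    · exact Or.inr ⟨h0, (hb hs).trans hR⟩
  exact ⟨h, hloc, ae_restrict_Ioi_of_forall_nat hae, fun t ht =>
    tendsto_average_comp_natCeil_div hε hlim hloc hconv ht⟩

omit [CompleteSpace E] in
lemma continuousOn_average {h : ℝ → E} (hh : LocallyIntegrable h) :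
    ContinuousOn (fun t => t⁻¹ • ∫ s in (0 : ℝ)..t, h s) (Ioi 0) := by
  have hint : ∀ a b, IntervalIntegrable h volume a b := fun a b =>
    intervalIntegrable_iff.mpr
      ((hh.integrableOn_isCompact isCompact_uIcc).mono_set uIoc_subset_uIcc)
  exact ((continuousOn_inv₀ (G₀ := ℝ)).mono fun t ht => (mem_Ioi.mp ht).ne').smul
    (intervalIntegral.continuous_primitive hint 0).continuousOn

/-- `t ∂_t M_t = h - M_t` for the averages `M_t = t⁻¹ ∫_0^t h`. -/
lemma ae_hasDerivAt_average {h : ℝ → E} (hh : LocallyIntegrable h) :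
    ∀ᵐ t ∂(volume.restrict (Ioi (0 : ℝ))), HasDerivAt (fun t => t⁻¹ • ∫ s in (0 : ℝ)..t, h s)
      (t⁻¹ • (h t - t⁻¹ • ∫ s in (0 : ℝ)..t, h s)) t := by
  filter_upwards [ae_restrict_of_ae (_root_.LocallyIntegrable.ae_hasDerivAt_integral hh),
    ae_restrict_mem measurableSet_Ioi]
    with t h1 ht
  have h2 := (hasDerivAt_inv (mem_Ioi.mp ht).ne').smul (h1 0)
  refine HasDerivAt.congr_deriv h2 ?_
  rw [smul_sub, smul_smul, neg_smul, sub_eq_add_neg]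
  congr 3
  rw [sq, mul_inv]

end Trajectory

section StepSquareFunction

variable {E : Type*} [NormedAddCommGroup E] [NormedSpace ℝ E]

/-- Comparison of an integral against `dt/t` with a sum. The integral of `dt/t` over the first
interval `(0, ε]` diverges, which is harmless because `w 1 = 0`; over `(nε, (n + 1)ε]` it is at
most `1/n ≤ 2/(n + 1)`. -/
lemma lintegral_comp_natCeil_div_le {ε : ℝ} (hε : 0 < ε) {w : ℕ → ℝ≥0∞} (hw : w 1 = 0) :
    ∫⁻ t in Ioi (0 : ℝ), w ⌈t / ε⌉₊ / ENNReal.ofReal t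
      ≤ 2 * ∑' n : ℕ, ENNReal.ofReal ((n : ℝ) + 1)⁻¹ * w (n + 1) := by
  have hcover : Ioi (0 : ℝ) ⊆ ⋃ n : ℕ, Ioc (n * ε) ((n + 1 : ℕ) * ε) := by
    intro t ht
    have h0 : 0 < ⌈t / ε⌉₊ := Nat.ceil_pos.mpr (div_pos ht hε)
    obtain ⟨n, hn⟩ := Nat.exists_eq_succ_of_ne_zero h0.ne'
    obtain ⟨h1, h2⟩ := (Nat.ceil_eq_iff n.succ_ne_zero).mp hn
    exact mem_iUnion.mpr ⟨n, (lt_div_iff₀ hε).mp h1, (div_le_iff₀ hε).mp h2⟩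
  rw [← ENNReal.tsum_mul_left]
  refine (lintegral_mono_set hcover).trans ((lintegral_iUnion_le _ _).trans ?_)
  refine ENNReal.tsum_le_tsum fun n => ?_
  rcases Nat.eq_zero_or_pos n with rfl | hn
  · rw [setLIntegral_congr_fun (g := fun _ => 0) measurableSet_Ioc fun t ht => ?_]
    · simp
    · simp only
      rw [natCeil_div_eq hε ht.1 ht.2, zero_add, hw, ENNReal.zero_div]
  have hn' : (0 : ℝ) < n * ε := by positivity
  calc ∫⁻ t in Ioc (n * ε) ((n + 1 : ℕ) * ε), w ⌈t / ε⌉₊ / ENNReal.ofReal t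
      ≤ ∫⁻ _ in Ioc (n * ε) ((n + 1 : ℕ) * ε), w (n + 1) / ENNReal.ofReal (n * ε) := by
        refine setLIntegral_mono' measurableSet_Ioc fun t ht => ?_
        rw [natCeil_div_eq hε ht.1 ht.2]
        exact ENNReal.div_le_div_left (ENNReal.ofReal_le_ofReal ht.1.le) _
    _ = w (n + 1) * ENNReal.ofReal (n : ℝ)⁻¹ := by
        rw [setLIntegral_const, Real.volume_Ioc, div_eq_mul_inv, mul_assoc,
          ← ENNReal.ofReal_inv_of_pos hn', ← ENNReal.ofReal_mul (by positivity)]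
        congr 2
        push_cast
        field_simp
        ring
    _ ≤ w (n + 1) * (2 * ENNReal.ofReal ((n : ℝ) + 1)⁻¹) := by
        gcongr
        rw [← ENNReal.ofReal_ofNat, ← ENNReal.ofReal_mul (by norm_num)]
        refine ENNReal.ofReal_le_ofReal ?_
        have h1 : (1 : ℝ) ≤ n := by exact_mod_cast hn
        rw [inv_eq_one_div, ← div_eq_mul_inv, div_le_div_iff₀ (by positivity) (by positivity)]
        linarith
    _ = _ := by ring

lemma tsum_avgDev_le_iSup_sqSum {q : ℝ} (hq : 0 < q) (z : ℕ → E) :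
    ∑' n : ℕ, ENNReal.ofReal ((n : ℝ) + 1)⁻¹ * ‖avgDev z (n + 1)‖ₑ ^ q
      ≤ (⨆ M : ℕ, ENNReal.ofReal (sqSum q (2 ^ M) z)) ^ q := by
  rw [ENNReal.tsum_eq_iSup_nat]
  refine iSup_le fun N => ?_
  calc ∑ n ∈ Finset.range N, ENNReal.ofReal ((n : ℝ) + 1)⁻¹ * ‖avgDev z (n + 1)‖ₑ ^ q
      ≤ ∑ n ∈ Finset.range (2 ^ N), ENNReal.ofReal ((n : ℝ) + 1)⁻¹ * ‖avgDev z (n + 1)‖ₑ ^ q :=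
        Finset.sum_le_sum_of_subset (Finset.range_mono Nat.lt_two_pow_self.le)
    _ = ENNReal.ofReal (sqSum q (2 ^ N) z) ^ q := by
        rw [ENNReal.ofReal_rpow_of_nonneg (sqSum_nonneg _ _ _) hq.le, sqSum,
          ← Real.rpow_mul (Finset.sum_nonneg fun _ _ => by positivity),
          one_div_mul_cancel hq.ne', Real.rpow_one,
          ENNReal.ofReal_sum_of_nonneg fun _ _ => by positivity]
        refine Finset.sum_congr rfl fun n _ => ?_
        rw [ENNReal.ofReal_mul (by positivity), ← ofReal_norm,
          ENNReal.ofReal_rpow_of_nonneg (norm_nonneg _) hq.le]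
    _ ≤ _ := by
        gcongr
        exact le_iSup (fun M : ℕ => ENNReal.ofReal (sqSum q (2 ^ M) z)) N

/-- The continuous square function of a step function is controlled by the discrete one. -/
lemma lintegral_avgDev_natCeil_div_le {q : ℝ} (hq : 0 < q) {ε : ℝ} (hε : 0 < ε) (z : ℕ → E) :
    (∫⁻ t in Ioi (0 : ℝ), ‖avgDev z ⌈t / ε⌉₊‖ₑ ^ q / ENNReal.ofReal t) ^ (1 / q)
      ≤ 2 ^ (1 / q) * ⨆ M : ℕ, ENNReal.ofReal (sqSum q (2 ^ M) z) := by
  have h1 := (lintegral_comp_natCeil_div_le hε (w := fun n => ‖avgDev z n‖ₑ ^ q)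
    (by simp [avgDev_one, hq])).trans (mul_le_mul_right (tsum_avgDev_le_iSup_sqSum hq z) 2)
  have h2 := ENNReal.rpow_le_rpow h1 (by positivity : 0 ≤ 1 / q)
  rwa [ENNReal.mul_rpow_of_nonneg _ _ (by positivity), ← ENNReal.rpow_mul,
    mul_one_div_cancel hq.ne', ENNReal.rpow_one] at h2

end StepSquareFunction

/-! ### Pointwise trajectories of curves in `L^p_B` -/

section Curve

variable {Ω : Type*} [MeasurableSpace Ω] {μ : Measure Ω} {p : ℝ≥0∞} [Fact (1 ≤ p)]
  {B : Type*} [NormedAddCommGroup B] [NormedSpace ℝ B]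

/-- A form of Minkowski's integral inequality for functions with countably many values. No
`σ`-finiteness of `μ` is needed. -/
lemma ae_tsum_lintegral_ne_top {ι κ β : Type*} [Countable ι] [Countable κ] [MeasurableSpace ι]
    [MeasurableSingletonClass ι] [MeasurableSpace β] (ν : Measure β) [IsFiniteMeasure ν]
    {φ : κ → β → ι} (hφ : ∀ k, Measurable (φ k)) (w : κ → ι → Lp B p μ)
    (h : ∑' k, ∫⁻ s, ‖w k (φ k s)‖ₑ ∂ν ≠ ∞) :
    ∀ᵐ x ∂μ, ∑' k, ∫⁻ s, ‖w k (φ k s) x‖ₑ ∂ν ≠ ∞ := by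
  set c : κ → ι → ℝ≥0∞ := fun k i => ν.map (φ k) {i} with hc
  have hctop : ∀ k i, c k i ≠ ∞ := fun k i => measure_ne_top _ _
  have hlin : ∀ (k : κ) (v : ι → ℝ≥0∞), ∫⁻ s, v (φ k s) ∂ν = ∑' i, c k i * v i := by
    intro k v
    rw [← lintegral_map (measurable_of_countable v) (hφ k), lintegral_countable']
    simp_rw [hc, mul_comm]
  have hce : ∀ k i, ‖(c k i).toReal‖ₑ = c k i := fun k i => by
    rw [Real.enorm_of_nonneg ENNReal.toReal_nonneg, ENNReal.ofReal_toReal (hctop k i)]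
  have h1 : ∑' z : κ × ι, eLpNorm ((c z.1 z.2).toReal • ⇑(w z.1 z.2)) p μ ≠ ∞ := by
    simp_rw [eLpNorm_const_smul, hce, ← Lp.enorm_def]
    rw [ENNReal.tsum_prod (f := fun k i => c k i * ‖w k i‖ₑ)]
    rwa [tsum_congr fun k => (hlin k fun i => ‖w k i‖ₑ).symm]
  filter_upwards [summable_norm_of_tsum_eLpNorm_ne_top Fact.out
    (fun z : κ × ι => (Lp.aestronglyMeasurable (w z.1 z.2)).const_smul (c z.1 z.2).toReal) h1]
    with x hx
  have h2 := tsum_enorm_ne_top_iff_summable_norm.mpr hx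
  simp_rw [Pi.smul_apply, enorm_smul, hce] at h2
  rw [ENNReal.tsum_prod (f := fun k i => c k i * ‖w k i x‖ₑ)] at h2
  rwa [tsum_congr fun k => hlin k fun i => ‖w k i x‖ₑ]

omit [NormedSpace ℝ B] in
/-- Lattices so fine that the `k`-th step approximation of `u` is uniformly within `2^{-k}`. -/
lemma exists_mesh {u : ℝ → Lp B p μ} (hu : UniformContinuous u) :
    ∃ ε : ℕ → ℝ, (∀ k, 0 < ε k) ∧ Tendsto ε atTop (𝓝 0) ∧
      ∀ k s, 0 ≤ s → ‖u (⌈s / ε k⌉₊ * ε k) - u s‖ ≤ (1 / 2 : ℝ) ^ k := by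
  choose δ hδ h using fun k : ℕ => Metric.uniformContinuous_iff.mp hu ((1 / 2 : ℝ) ^ k)
    (by positivity)
  have hpow := tendsto_pow_atTop_nhds_zero_of_lt_one (r := (1 / 2 : ℝ)) (by norm_num) (by norm_num)
  refine ⟨fun k => min (δ k / 2) ((1 / 2) ^ k), fun k => lt_min (half_pos (hδ k)) (by positivity),
    ?_, fun k s hs => ?_⟩
  · exact tendsto_of_tendsto_of_tendsto_of_le_of_le tendsto_const_nhds hpow
      (fun k => (lt_min (half_pos (hδ k)) (by positivity)).le) fun k => min_le_right _ _
  · have hpos : 0 < min (δ k / 2) ((1 / 2 : ℝ) ^ k) := lt_min (half_pos (hδ k)) (by positivity)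
    rw [← dist_eq_norm]
    refine (h k ?_).le
    rw [Real.dist_eq, abs_of_nonneg (sub_nonneg.mpr (le_natCeil_div_mul hpos))]
    have h1 := natCeil_div_mul_le hpos hs
    have h2 := min_le_left (δ k / 2) ((1 / 2 : ℝ) ^ k)
    have h3 := hδ k
    linarith

variable {u : ℝ → Lp B p μ} {ε : ℕ → ℝ}

/-- For almost every `x` the trajectories of consecutive step approximations of the curve `u` are so
close in `L^1_loc` that they form a fast Cauchy sequence. -/
lemma ae_tsum_lintegral_step_ne_top
    (hmesh : ∀ k s, 0 ≤ s → ‖u (⌈s / ε k⌉₊ * ε k) - u s‖ ≤ (1 / 2 : ℝ) ^ k) :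
    ∀ᵐ x ∂μ, ∀ R : ℕ, ∑' k, ∫⁻ s in Ioc (0 : ℝ) R,
      ‖u (⌈s / ε (k + 1)⌉₊ * ε (k + 1)) x - u (⌈s / ε k⌉₊ * ε k) x‖ₑ ≠ ∞ := by
  rw [ae_all_iff]
  intro R
  set w : ℕ → ℕ × ℕ → Lp B p μ := fun k z => u (z.1 * ε (k + 1)) - u (z.2 * ε k) with hw
  have hφ : ∀ k, Measurable fun s : ℝ => (⌈s / ε (k + 1)⌉₊, ⌈s / ε k⌉₊) := fun k =>
    (Nat.measurable_ceil.comp (measurable_id.div_const _)).prodMk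
      (Nat.measurable_ceil.comp (measurable_id.div_const _))
  have hsum : ∑' k, ∫⁻ s in Ioc (0 : ℝ) R, ‖w k (⌈s / ε (k + 1)⌉₊, ⌈s / ε k⌉₊)‖ₑ ≠ ∞ := by
    have h1 : ∀ k, ∫⁻ s in Ioc (0 : ℝ) R, ‖w k (⌈s / ε (k + 1)⌉₊, ⌈s / ε k⌉₊)‖ₑ
        ≤ ENNReal.ofReal (2 * (1 / 2 : ℝ) ^ k) * ENNReal.ofReal R := by
      intro k
      calc ∫⁻ s in Ioc (0 : ℝ) R, ‖w k (⌈s / ε (k + 1)⌉₊, ⌈s / ε k⌉₊)‖ₑ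
          ≤ ∫⁻ _ in Ioc (0 : ℝ) R, ENNReal.ofReal (2 * (1 / 2 : ℝ) ^ k) := by
            refine setLIntegral_mono' measurableSet_Ioc fun s hs => ?_
            rw [← ofReal_norm]
            refine ENNReal.ofReal_le_ofReal ?_
            have h2 := hmesh (k + 1) s hs.1.le
            have h3 := hmesh k s hs.1.le
            have h4 : (1 / 2 : ℝ) ^ (k + 1) ≤ (1 / 2 : ℝ) ^ k :=
              pow_le_pow_of_le_one (by norm_num) (by norm_num) k.le_succ
            calc ‖w k (⌈s / ε (k + 1)⌉₊, ⌈s / ε k⌉₊)‖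
                = ‖(u (⌈s / ε (k + 1)⌉₊ * ε (k + 1)) - u s) - (u (⌈s / ε k⌉₊ * ε k) - u s)‖ := by
                  rw [sub_sub_sub_cancel_right]
              _ ≤ _ := (norm_sub_le _ _).trans (by linarith)
        _ = _ := by rw [setLIntegral_const, Real.volume_Ioc, sub_zero]
    refine ne_top_of_le_ne_top ?_ (ENNReal.tsum_le_tsum h1)
    rw [ENNReal.tsum_mul_right]
    exact ENNReal.mul_ne_top
      (summable_geometric_two.mul_left 2).tsum_ofReal_ne_top ENNReal.ofReal_ne_top
  filter_upwards [ae_tsum_lintegral_ne_top (volume.restrict (Ioc (0 : ℝ) R)) hφ w hsum,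
    ae_all_iff.mpr fun k : ℕ => ae_all_iff.mpr fun i : ℕ => ae_all_iff.mpr fun j : ℕ =>
      Lp.coeFn_sub (u (i * ε (k + 1))) (u (j * ε k))] with x hx hsub
  convert hx using 6 with k s
  rw [hw]
  exact (hsub k _ _).symm

variable [CompleteSpace B]

/-- For almost every `x` the step approximations of the trajectory converge. -/
lemma exists_trajectory (hε : ∀ k, 0 < ε k) (hlim : Tendsto ε atTop (𝓝 0))
    (hmesh : ∀ k s, 0 ≤ s → ‖u (⌈s / ε k⌉₊ * ε k) - u s‖ ≤ (1 / 2 : ℝ) ^ k) :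
    ∃ h : Ω → ℝ → B, ∀ᵐ x ∂μ, LocallyIntegrable (h x) ∧
      (∀ᵐ s ∂(volume.restrict (Ioi (0 : ℝ))),
        Tendsto (fun k => u (⌈s / ε k⌉₊ * ε k) x) atTop (𝓝 (h x s))) ∧
      ∀ t, 0 < t → Tendsto (fun k => (⌈t / ε k⌉₊ : ℝ)⁻¹ •
        ∑ j ∈ Finset.range ⌈t / ε k⌉₊, u ((j + 1 : ℕ) * ε k) x) atTop
          (𝓝 (t⁻¹ • ∫ s in (0 : ℝ)..t, h x s)) := by
  have key := fun (x : Ω) hx =>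
    exists_limit_of_tsum_lintegral_ne_top (g := fun k n => u (n * ε k) x) hε hlim hx
  choose! h hh using key
  exact ⟨h, (ae_tsum_lintegral_step_ne_top hmesh).mono hh⟩

/-- Convergence in `L^p_B` of the Riemann sums on the lattices `ε k ℕ`. -/
lemma tendsto_average_mesh (hu : Continuous u) (hε : ∀ k, 0 < ε k) (hlim : Tendsto ε atTop (𝓝 0))
    (hmesh : ∀ k s, 0 ≤ s → ‖u (⌈s / ε k⌉₊ * ε k) - u s‖ ≤ (1 / 2 : ℝ) ^ k) {t : ℝ} (ht : 0 < t) :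
    Tendsto (fun k => (⌈t / ε k⌉₊ : ℝ)⁻¹ •
      ∑ j ∈ Finset.range ⌈t / ε k⌉₊, u ((j + 1 : ℕ) * ε k)) atTop
        (𝓝 (t⁻¹ • ∫ s in (0 : ℝ)..t, u s)) := by
  refine tendsto_average_comp_natCeil_div (g := fun k n => u (n * ε k)) hε hlim
    hu.locallyIntegrable (fun R => ?_) ht
  have h1 : Tendsto (fun k : ℕ => ENNReal.ofReal ((1 / 2 : ℝ) ^ k) * ENNReal.ofReal R) atTop
      (𝓝 0) := by
    have h2 := (ENNReal.continuous_ofReal.tendsto 0).comp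
      (tendsto_pow_atTop_nhds_zero_of_lt_one (r := (1 / 2 : ℝ)) (by norm_num) (by norm_num))
    have h3 := ENNReal.Tendsto.mul_const (b := ENNReal.ofReal R) h2
      (Or.inr ENNReal.ofReal_ne_top)
    simpa using h3
  refine tendsto_of_tendsto_of_tendsto_of_le_of_le tendsto_const_nhds h1
    (fun _ => zero_le) fun k => ?_
  calc ∫⁻ s in Ioc (0 : ℝ) R, ‖u (⌈s / ε k⌉₊ * ε k) - u s‖ₑ
      ≤ ∫⁻ _ in Ioc (0 : ℝ) R, ENNReal.ofReal ((1 / 2 : ℝ) ^ k) := by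
        refine setLIntegral_mono' measurableSet_Ioc fun s hs => ?_
        rw [← ofReal_norm]
        exact ENNReal.ofReal_le_ofReal (hmesh k s hs.1.le)
    _ = _ := by rw [setLIntegral_const, Real.volume_Ioc, sub_zero]

/-- The averages of the trajectories represent the averages in `L^p_B`. -/
lemma average_trajectory_ae_eq (hu : Continuous u) (hε : ∀ k, 0 < ε k)
    (hlim : Tendsto ε atTop (𝓝 0))
    (hmesh : ∀ k s, 0 ≤ s → ‖u (⌈s / ε k⌉₊ * ε k) - u s‖ ≤ (1 / 2 : ℝ) ^ k) {t : ℝ} (ht : 0 < t)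
    {v : Ω → B} (hv : ∀ᵐ x ∂μ, Tendsto (fun k => (⌈t / ε k⌉₊ : ℝ)⁻¹ •
        ∑ j ∈ Finset.range ⌈t / ε k⌉₊, u ((j + 1 : ℕ) * ε k) x) atTop (𝓝 (v x))) :
    v =ᵐ[μ] ⇑(t⁻¹ • ∫ s in (0 : ℝ)..t, u s : Lp B p μ) := by
  obtain ⟨ns, hns, hconv⟩ := (tendstoInMeasure_of_tendsto_Lp
    (tendsto_average_mesh hu hε hlim hmesh ht)).exists_seq_tendsto_ae
  have hcoe : ∀ᵐ x ∂μ, ∀ k, ((⌈t / ε k⌉₊ : ℝ)⁻¹ •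
      ∑ j ∈ Finset.range ⌈t / ε k⌉₊, u ((j + 1 : ℕ) * ε k) : Lp B p μ) x
        = (⌈t / ε k⌉₊ : ℝ)⁻¹ • ∑ j ∈ Finset.range ⌈t / ε k⌉₊, u ((j + 1 : ℕ) * ε k) x := by
    refine ae_all_iff.mpr fun k => ?_
    filter_upwards [Lp.coeFn_smul (⌈t / ε k⌉₊ : ℝ)⁻¹
        (∑ j ∈ Finset.range ⌈t / ε k⌉₊, u ((j + 1 : ℕ) * ε k)),
      Lp.coeFn_finsetSum (Finset.range ⌈t / ε k⌉₊) fun j => u ((j + 1 : ℕ) * ε k)] with x h1 h2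
    rw [h1, Pi.smul_apply, h2, Finset.sum_apply]
  filter_upwards [hv, hconv, hcoe] with x h1 h2 h3
  refine tendsto_nhds_unique (h1.comp hns.tendsto_atTop) (h2.congr fun i => ?_)
  exact h3 _

end Curve

section SquareFunctionLimit

variable {B : Type*} [NormedAddCommGroup B] [NormedSpace ℝ B] [CompleteSpace B]

/-- A function on `(0, ∞)` which is given by the averages of a limit of step functions is almost
everywhere differentiable, and `t v'(t)` is a limit of deviations from averages. -/
lemma ae_tendsto_avgDev {g : ℕ → ℕ → B} {ε : ℕ → ℝ} {h v : ℝ → B} (hh : LocallyIntegrable h)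
    (hconv : ∀ᵐ s ∂(volume.restrict (Ioi (0 : ℝ))),
      Tendsto (fun k => g k ⌈s / ε k⌉₊) atTop (𝓝 (h s)))
    (havg : ∀ t, 0 < t → Tendsto (fun k => (⌈t / ε k⌉₊ : ℝ)⁻¹ •
      ∑ j ∈ Finset.range ⌈t / ε k⌉₊, g k (j + 1)) atTop (𝓝 (t⁻¹ • ∫ s in (0 : ℝ)..t, h s)))
    (hv : EqOn v (fun t => t⁻¹ • ∫ s in (0 : ℝ)..t, h s) (Ioi 0)) :
    ∀ᵐ t ∂(volume.restrict (Ioi (0 : ℝ))), DifferentiableAt ℝ v t ∧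
      Tendsto (fun k => avgDev (g k) ⌈t / ε k⌉₊) atTop (𝓝 (t • deriv v t)) := by
  filter_upwards [ae_hasDerivAt_average hh, hconv, ae_restrict_mem measurableSet_Ioi]
    with t h1 h2 ht
  have h3 := h1.congr_of_eventuallyEq (hv.eventuallyEq_of_mem (Ioi_mem_nhds ht))
  refine ⟨h3.differentiableAt, ?_⟩
  rw [h3.deriv, smul_inv_smul₀ (mem_Ioi.mp ht).ne']
  exact h2.sub (havg t ht)

lemma liminf_rpow {r : ℝ} (hr : 0 < r) (a : ℕ → ℝ≥0∞) :
    liminf a atTop ^ r = liminf (fun k => a k ^ r) atTop :=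
  (ENNReal.orderIsoRpow r hr).liminf_apply (u := a) (f := atTop)

/-- Fatou's lemma in `k` after monotone convergence in `M`. -/
lemma lintegral_liminf_iSup_rpow_le {Ω : Type*} [MeasurableSpace Ω] {μ : Measure Ω} {r : ℝ}
    (hr : 0 < r) {a : ℕ → ℕ → Ω → ℝ≥0∞} (ha : ∀ k M, Measurable (a k M))
    (hmono : ∀ k, Monotone (a k)) {K : ℝ≥0∞} (hK : ∀ k M, ∫⁻ x, a k M x ^ r ∂μ ≤ K) :
    ∫⁻ x, liminf (fun k => ⨆ M, a k M x) atTop ^ r ∂μ ≤ K := by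
  simp_rw [liminf_rpow hr]
  have h1 : ∀ k x, (⨆ M, a k M x) ^ r = ⨆ M, a k M x ^ r := fun k x =>
    (ENNReal.orderIsoRpow r hr).map_iSup fun M => a k M x
  refine (lintegral_liminf_le fun k => (Measurable.iSup (ha k)).pow_const r).trans ?_
  refine liminf_le_of_frequently_le' (Frequently.of_forall fun k => ?_)
  simp_rw [h1]
  rw [lintegral_iSup (fun M => (ha k M).pow_const r)
    fun M N h x => ENNReal.rpow_le_rpow (hmono k h x) hr.le]
  exact iSup_le (hK k)

omit [CompleteSpace B] in
lemma sqSum_mono {q : ℝ} (hq : 0 < q) (z : ℕ → B) {M N : ℕ} (h : M ≤ N) :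
    sqSum q M z ≤ sqSum q N z :=
  Real.rpow_le_rpow (Finset.sum_nonneg fun _ _ => by positivity)
    (Finset.sum_le_sum_of_subset_of_nonneg (Finset.range_mono h) fun _ _ _ => by positivity)
    (by positivity)

end SquareFunctionLimit

/-! ### The square function inequality -/

section SquareFunction

variable {Ω : Type*} [MeasurableSpace Ω] {μ : Measure Ω} {p : ℝ≥0∞} [Fact (1 ≤ p)]
  {B : Type*} [NormedAddCommGroup B] [NormedSpace ℝ B]

/-- The square function of a curve `u` in `L^p_B` defined through its step approximations on the
lattices `ε k ℕ`. Unlike `squareFunction`, it is measurable by construction. -/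
noncomputable def stepSquareFunction (q : ℝ) (u : ℝ → Lp B p μ) (ε : ℕ → ℝ) (x : Ω) : ℝ≥0∞ :=
  (∫⁻ t in Ioi (0 : ℝ), liminf (fun k =>
    ‖avgDev (fun n : ℕ => u (n * ε k) x) ⌈t / ε k⌉₊‖ₑ ^ q / ENNReal.ofReal t) atTop) ^ (1 / q)

lemma stronglyMeasurable_avgDev {z : ℕ → Ω → B} (hz : ∀ n, StronglyMeasurable (z n)) (n : ℕ) :
    StronglyMeasurable fun x => avgDev (fun k => z k x) n :=
  (hz n).sub ((Finset.stronglyMeasurable_fun_sum _ fun k _ => hz (k + 1)).const_smul _)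

omit [Fact (1 ≤ p)] in
lemma measurable_avgDev_natCeil (q : ℝ) (u : ℝ → Lp B p μ) (ε : ℝ) :
    Measurable fun z : ℝ × Ω =>
      ‖avgDev (fun n : ℕ => u (n * ε) z.2) ⌈z.1 / ε⌉₊‖ₑ ^ q / ENNReal.ofReal z.1 := by
  have h1 : Measurable fun z : ℕ × Ω => ‖avgDev (fun n : ℕ => u (n * ε) z.2) z.1‖ₑ :=
    measurable_from_prod_countable_right fun n =>
      (stronglyMeasurable_avgDev (fun n => Lp.stronglyMeasurable (u (n * ε))) n).enorm
  have h2 : Measurable fun z : ℝ × Ω => (⌈z.1 / ε⌉₊, z.2) :=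
    (Nat.measurable_ceil.comp (measurable_fst.div_const ε)).prodMk measurable_snd
  exact ((h1.comp h2).pow_const q).div measurable_fst.ennreal_ofReal

omit [Fact (1 ≤ p)] in
lemma measurable_stepSquareFunction (q : ℝ) (u : ℝ → Lp B p μ) (ε : ℕ → ℝ) :
    Measurable (stepSquareFunction q u ε) :=
  (Measurable.lintegral_prod_left' (μ := volume.restrict (Ioi (0 : ℝ)))
    (f := fun z : ℝ × Ω => liminf (fun k =>
      ‖avgDev (fun n : ℕ => u (n * ε k) z.2) ⌈z.1 / ε k⌉₊‖ₑ ^ q / ENNReal.ofReal z.1) atTop)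
    (Measurable.liminf fun k => measurable_avgDev_natCeil q u (ε k))).pow_const _

omit [Fact (1 ≤ p)] in
lemma stepSquareFunction_le {q : ℝ} (hq : 0 < q) (u : ℝ → Lp B p μ) {ε : ℕ → ℝ}
    (hε : ∀ k, 0 < ε k) (x : Ω) :
    stepSquareFunction q u ε x ≤ 2 ^ (1 / q) * liminf (fun k => ⨆ M : ℕ,
      ENNReal.ofReal (sqSum q (2 ^ M) fun n : ℕ => u (n * ε k) x)) atTop := by
  have hq' : 0 < 1 / q := by positivity
  have hm : ∀ k, Measurable fun t : ℝ =>
      ‖avgDev (fun n : ℕ => u (n * ε k) x) ⌈t / ε k⌉₊‖ₑ ^ q / ENNReal.ofReal t :=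
    fun k => (measurable_avgDev_natCeil q u (ε k)).comp
      (g := fun z : ℝ × Ω =>
        ‖avgDev (fun n : ℕ => u (n * ε k) z.2) ⌈z.1 / ε k⌉₊‖ₑ ^ q / ENNReal.ofReal z.1)
      (f := fun t : ℝ => (t, x)) measurable_prodMk_right
  have h2 : (2 : ℝ≥0∞) ^ (1 / q) ≠ ∞ := ENNReal.rpow_ne_top_of_nonneg hq'.le ENNReal.ofNat_ne_top
  rw [← ENNReal.liminf_const_mul_of_ne_top h2]
  calc stepSquareFunction q u ε x
      ≤ liminf (fun k => ∫⁻ t in Ioi (0 : ℝ),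
          ‖avgDev (fun n : ℕ => u (n * ε k) x) ⌈t / ε k⌉₊‖ₑ ^ q / ENNReal.ofReal t) atTop
            ^ (1 / q) := ENNReal.rpow_le_rpow (lintegral_liminf_le hm) hq'.le
    _ = liminf (fun k => (∫⁻ t in Ioi (0 : ℝ),
          ‖avgDev (fun n : ℕ => u (n * ε k) x) ⌈t / ε k⌉₊‖ₑ ^ q / ENNReal.ofReal t)
            ^ (1 / q)) atTop := liminf_rpow hq' _
    _ ≤ _ := liminf_le_liminf (Eventually.of_forall fun k =>
        lintegral_avgDev_natCeil_div_le hq (hε k) _)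

lemma measurable_sqSum (q : ℝ) (N : ℕ) {z : ℕ → Ω → B} (hz : ∀ n, StronglyMeasurable (z n)) :
    Measurable fun x => sqSum q N fun n => z n x := by
  unfold sqSum
  exact (Finset.measurable_fun_sum _ fun n _ =>
    (((stronglyMeasurable_avgDev hz (n + 1)).norm.measurable.pow_const q).const_mul _)).pow_const _

lemma eLpNorm_stepSquareFunction_le {q : ℝ} (hq : 0 < q) (hp' : p ≠ ∞) {u : ℝ → Lp B p μ}
    {ε : ℕ → ℝ} (hε : ∀ k, 0 < ε k) {K : ℝ≥0∞}
    (hK : ∀ k M, eLpNorm (fun x => sqSum q (2 ^ M) fun n : ℕ => u (n * ε k) x) p μ ≤ K) :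
    eLpNorm (stepSquareFunction q u ε) p μ ≤ 2 ^ (1 / q) * K := by
  have hp0 : p ≠ 0 := (zero_lt_one.trans_le (Fact.out : 1 ≤ p)).ne'
  have hpr : 0 < p.toReal := ENNReal.toReal_pos hp0 hp'
  set a : ℕ → ℕ → Ω → ℝ≥0∞ := fun k M x =>
    ENNReal.ofReal (sqSum q (2 ^ M) fun n : ℕ => u (n * ε k) x) with ha
  have hmeas : ∀ k M, Measurable (a k M) := fun k M =>
    (measurable_sqSum q _ fun n : ℕ => Lp.stronglyMeasurable (u (n * ε k))).ennreal_ofReal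
  have hint : ∀ k M, ∫⁻ x, a k M x ^ p.toReal ∂μ ≤ K ^ p.toReal := by
    intro k M
    have h1 := ENNReal.rpow_le_rpow (hK k M) hpr.le
    rw [eLpNorm_eq_lintegral_rpow_enorm_toReal hp0 hp', ← ENNReal.rpow_mul,
      one_div_mul_cancel hpr.ne', ENNReal.rpow_one] at h1
    simp_rw [Real.enorm_of_nonneg (sqSum_nonneg _ _ _)] at h1
    exact h1
  have hmono : ∀ k, Monotone (a k) := fun k M N h x => ENNReal.ofReal_le_ofReal
    (sqSum_mono hq _ (Nat.pow_le_pow_right two_pos h))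
  have h2 := lintegral_liminf_iSup_rpow_le hpr hmeas hmono hint
  calc eLpNorm (stepSquareFunction q u ε) p μ
      ≤ (∫⁻ x, (2 ^ (1 / q) * liminf (fun k => ⨆ M, a k M x) atTop) ^ p.toReal ∂μ)
          ^ (1 / p.toReal) := by
        rw [eLpNorm_eq_lintegral_rpow_enorm_toReal hp0 hp']
        gcongr with x
        exact stepSquareFunction_le hq u hε x
    _ = 2 ^ (1 / q) * (∫⁻ x, liminf (fun k => ⨆ M, a k M x) atTop ^ p.toReal ∂μ)
          ^ (1 / p.toReal) := by
        simp_rw [ENNReal.mul_rpow_of_nonneg _ _ hpr.le]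
        rw [lintegral_const_mul _ ((Measurable.liminf fun k =>
          Measurable.iSup (hmeas k)).pow_const _),
          ENNReal.mul_rpow_of_nonneg _ _ (by positivity), ← ENNReal.rpow_mul _ p.toReal,
          mul_one_div_cancel hpr.ne', ENNReal.rpow_one]
    _ ≤ 2 ^ (1 / q) * (K ^ p.toReal) ^ (1 / p.toReal) := by gcongr
    _ = _ := by rw [← ENNReal.rpow_mul, mul_one_div_cancel hpr.ne', ENNReal.rpow_one]

end SquareFunction

lemma eqOn_Ioi_of_eqOn_rat {E : Type*} [TopologicalSpace E] [T2Space E] {v w : ℝ → E}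
    (hv : ContinuousOn v (Ioi 0)) (hw : ContinuousOn w (Ioi 0))
    (h : ∀ r : ℚ, (0 : ℝ) < r → v r = w r) : EqOn v w (Ioi 0) := by
  refine EqOn.of_subset_closure (s := Ioi (0 : ℝ) ∩ range ((↑) : ℚ → ℝ)) ?_ hv hw
    inter_subset_left (Dense.open_subset_closure_inter Rat.denseRange_cast isOpen_Ioi)
  rintro _ ⟨h0, r, rfl⟩
  exact h r h0

theorem theorem2p3 {B : Type*} [NormedAddCommGroup B] [NormedSpace ℝ B] [CompleteSpace B]
    (q : ℝ) (hq : 2 ≤ q) (hB : HasMartingaleCotype B q)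
    (p : ℝ≥0∞) [Fact (1 ≤ p)] (hp : 1 < p) (hp' : p < ∞) :
    ∃ C : ℝ≥0, ∀ (Ω : Type*) [MeasurableSpace Ω] (μ : Measure Ω)
      (T : SymmetricDiffusionSemigroup μ) (f : Lp B p μ),
      -- the integral defining `M_t f` converges in `L^p_B(Ω)`
      (∀ t : ℝ, 0 < t → IntervalIntegrable (fun s => T.vectorOp s f) volume 0 t) ∧
      -- `M_t f(x)` makes sense pointwise
      (∃ m : ℝ → Ω → B, T.IsMeanVersion f m) ∧
      -- the derivative `∂M_t f(x)/∂t` exists almost everywhere and satisfies the inequality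
      ∀ m : ℝ → Ω → B, T.IsMeanVersion f m →
        (∀ᵐ x ∂μ, ∀ᵐ t ∂(volume.restrict (Ioi (0 : ℝ))), DifferentiableAt ℝ (fun r => m r x) t) ∧
        AEMeasurable (squareFunction q m) μ ∧
        eLpNorm (squareFunction q m) p μ ≤ C * ‖f‖ₑ := by
  have hq0 : 0 < q := by linarith
  obtain ⟨C, hC, hbound⟩ := hB.exists_skeleton_bound (by linarith) hp hp'.ne
  -- the factor `2 ^ (1 / q)` comes from replacing `dt / t` by `1 / n` on the steps
  refine ⟨(2 : ℝ≥0) ^ (1 / q) * C.toNNReal, fun Ω _ μ T f => ?_⟩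
  have hu := T.uniformContinuous_vectorOp hp hp'.ne f
  obtain ⟨ε, hε, hlim, hmesh⟩ := exists_mesh hu
  -- one pointwise version is given by the averages of the limit trajectories
  obtain ⟨h, hh⟩ := exists_trajectory (u := fun s => T.vectorOp s f) hε hlim hmesh
  have hversion : T.IsMeanVersion f fun t x => t⁻¹ • ∫ s in (0 : ℝ)..t, h x s := by
    refine ⟨fun t ht => ?_, ?_⟩
    · exact average_trajectory_ae_eq hu.continuous hε hlim hmesh ht
        (hh.mono fun x hx => hx.2.2 t ht)
    · filter_upwards [hh] with x hx
      exact continuousOn_average hx.1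
  refine ⟨fun t _ => hu.continuous.intervalIntegrable 0 t, ⟨_, hversion⟩, fun m hm => ?_⟩
  -- any other version agrees with it at rational times, hence at all times by continuity
  have heq : ∀ᵐ x ∂μ, EqOn (fun t => m t x) (fun t => t⁻¹ • ∫ s in (0 : ℝ)..t, h x s) (Ioi 0) := by
    have hrat : ∀ᵐ x ∂μ, ∀ r : ℚ, (0 : ℝ) < r →
        m r x = (r : ℝ)⁻¹ • ∫ s in (0 : ℝ)..r, h x s := by
      refine ae_all_iff.mpr fun r => ?_
      by_cases hr : (0 : ℝ) < r
      · filter_upwards [hm.1 r hr, hversion.1 r hr] with x h1 h2 _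
        rw [h1, h2]
      · exact Eventually.of_forall fun x h0 => absurd h0 hr
    filter_upwards [hrat, hm.2, hversion.2] with x h1 h2 h3
    exact eqOn_Ioi_of_eqOn_rat h2 h3 h1
  have hderiv : ∀ᵐ x ∂μ, ∀ᵐ t ∂(volume.restrict (Ioi (0 : ℝ))),
      DifferentiableAt ℝ (fun r => m r x) t ∧
        Tendsto (fun k => avgDev (fun n : ℕ => T.vectorOp (n * ε k) f x) ⌈t / ε k⌉₊) atTop
          (𝓝 (t • deriv (fun r => m r x) t)) := by
    filter_upwards [hh, heq] with x h1 h2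
    exact ae_tendsto_avgDev (g := fun k n => T.vectorOp (n * ε k) f x) h1.1 h1.2.1 h1.2.2 h2
  have hsq : squareFunction q m =ᵐ[μ] stepSquareFunction q (fun s => T.vectorOp s f) ε := by
    filter_upwards [hderiv] with x hx
    rw [squareFunction, stepSquareFunction]
    congr 1
    refine lintegral_congr_ae ?_
    filter_upwards [hx, ae_restrict_mem measurableSet_Ioi] with t h1 ht
    refine (Tendsto.liminf_eq ?_).symm
    exact ENNReal.Tendsto.div_const (((ENNReal.continuous_rpow_const (y := q)).tendsto _).comp
      h1.2.enorm) (Or.inr (by simpa using ht))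
  refine ⟨hderiv.mono fun x hx => hx.mono fun t ht => ht.1,
    ⟨_, measurable_stepSquareFunction q _ ε, hsq⟩, ?_⟩
  rw [eLpNorm_congr_ae hsq]
  have hK : ∀ k M, eLpNorm (fun x => sqSum q (2 ^ M) fun n : ℕ => T.vectorOp (n * ε k) f x) p μ
      ≤ ENNReal.ofReal (C * ‖f‖) := fun k M => hbound Ω μ T f (ε k) (hε k).le M
  refine (eLpNorm_stepSquareFunction_le (u := fun s => T.vectorOp s f) hq0 hp'.ne hε hK).trans
    (le_of_eq ?_)
  rw [ENNReal.ofReal_mul hC, ofReal_norm, ENNReal.coe_mul, mul_assoc,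
    ENNReal.coe_rpow_of_nonneg _ (by positivity), ENNReal.coe_ofNat, ENNReal.ofReal]
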